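/- **Theorem (Identification of the Darboux coordinates and Lax matrices).** Let $g\ge 1$ and let $\Omega\subset\mathbb{C}^g$ be open, with coordinates $\mathbf t=(t_{\infty,1},t_{\infty,3},\dots,t_{\infty,2g-1})$. Let $\mathbf t=D\mathbf s$, $D=\mathrm{diag}(1,3,\dots,2g-1)$, i.e. $t_{\infty,2\ell+1}=(2\ell+1)s_{2\ell+1}$ for $0\le \ell\le g-1$, write $x=s_1$, and let $\Omega'=D^{-1}\Omega$ be the corresponding domain in the variables $\mathbf s=(s_1,s_3,\dots,s_{2g-1})$. *Isomonodromic side.* Complete the times by the canonical choice of trivial times: $t_{\infty,2k}=0$ for $1\le k\le g+2$, $t_{\infty,2g+1}=0$, $t_{\infty,2g+3}=2$. An isomonodromic system over $\Omega$ consists of families, holomorphic in $\mathbf t\in\Omega$, of $2\times2$ matrices $\hat L(\lambda)$ and $\hat A_{\mathbf e_{2\ell+1}}(\lambda)$ $(0\le \ell\le g-1)$, polynomial in $\lambda$, such that for every $\mathbf t \in\Omega$: 1. $\hat L(\lambda)=\begin{pmatrix}0&0\\1&0\end{pmatrix}\lambda^{g+1}+\begin{pmatrix}0&1\\X&0\end{pmatrix}\lambda^{g}+O(\lambda^{g-1})$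 for some $X=X(\mathbf t)\in\mathbb C$; 2. $\hat L$ has irregular times $(t_{\infty,k})_{1\le k\le 2g+4}$ at infinity: with $z=\lambda^{1/2}$, the equation $\partial_\lambda\hat\Psi=\hat L\hat\Psi$ has a formal fundamental solution $F(z)\,\mathrm{diag}\big(e^{\sum_k \frac{t_{\infty,k}}{k}z^k-\frac12\ln z},\,e^{\sum_k(-1)^k\frac{t_{\infty,k}}{k}z^k-\frac12\ln z}\big)$ with $F\in GL_2(\mathbb C((z^{-1})))$; 3. the $\hat A_{\mathbf e_{2\ell+1}}$ are traceless, of degree at most $g+1$ in $\lambda$, and satisfy $\partial_{t_{\infty,2\ell+1}}\hat L-\partial_\lambda\hat A_{\mathbf e_{2\ell+1}}+[\hat L,\hat A_{\mathbf e_{2\ell+1}}]=0$. The oper Darboux coordinates $(q_j,p_j)_{1\le j\le g}$ are the $g$ zeros $q_j$ (with multiplicity) of $\hat L_{1,2}$, and $p_j=\hat L_{1,1}(q_j)$. *String equation side.* For a holomorphic $u(\mathbf s)$ let $B(\lambda)=\sum_{k\ge0}R_{2k-1}[u]\lambda^{-k}$, $R_{-1}=1$, be the unique formal series $1+O(\lambda^{-1})$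 with $\frac14(\partial_xB)^2+\big((\lambda-u)B-\frac12\partial_x^2B\big)B=\lambda$. Put $A=-\frac12\partial_xB$, $C=-\frac12\partial_x^2B+(\lambda-u)B$, $U=\begin{pmatrix}A&B\\C&-A\end{pmatrix}$ and $\mathcal U_{2n+1}(\lambda)=[\lambda^nU(\lambda)]_{\infty,+}-\begin{pmatrix}0&0\\R_{2n+1}[u]&0\end{pmatrix}$, where $[\cdot]_{\infty,+}$ is the polynomial part in $\lambda$. A solution of the $g$-th member of the Painlevé I hierarchy is a holomorphic $u$ on $\Omega'$ with $$R_{2g+1}[u]+\sum_{\ell=0}^{g-1}\tfrac{2\ell+1}{2}s_{2\ell+1}R_{2\ell-1}[u]=0,\qquad \frac{\partial u}{\partial s_{2\ell+1}}=2\,\partial_xR_{2\ell+1}[u]\quad(1\le \ell\le g-1).$$ Its Lax matrix is $\mathcal A^{(g)}(\lambda)=\mathcal U_{2g+1}(\lambda)+\sum_{\ell=1}^{g-1}\frac{2\ell+1}{2}s_{2\ell+1}\,\mathcal U_{2\ell-1}(\lambda)$. The spectral Darboux coordinates $(\lambda_j,\mu_j)_{1\le j\le g}$ are the $g$ zeros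 $\lambda_j$ (with multiplicity) of $[\mathcal A^{(g)}]_{1,2}$, and $\mu_j=[\mathcal A^{(g)}(\lambda_j)]_{1,1}$. *Claim.* The two sides are identified: for every isomonodromic system over $\Omega$ there is a solution $u$ of the $g$-th member of the Painlevé I hierarchy on $\Omega'$, unique among solutions with $\hat L=\mathcal A^{(g)}$, and conversely for every solution $u$ on $\Omega'$ there is an isomonodromic system over $\Omega$, such that for all $\mathbf s\in\Omega'$ and $\mathbf t=D\mathbf s$ $$\hat L(\lambda)=\mathcal A^{(g)}(\lambda),\qquad (q_j,p_j)=(\lambda_j,\mu_j)\ \ (1\le j\le g,\ \text{up to the labelling}),\qquad (2\ell+1)\,\hat A_{\mathbf e_{2\ell+1}}(\lambda)=\mathcal U_{2\ell+1}(\lambda)\ \ (0\le \ell\le g-1).$$ -/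

import Mathlib

open Polynomial

noncomputable section

namespace PainleveOne

/-- `2 × 2` matrices whose entries are polynomials in the spectral variable `λ`. -/
abbrev PolyMat : Type := Matrix (Fin 2) (Fin 2) ℂ[X]

/-- The partial derivative `∂ f / ∂ sᵢ` of a function of `g` complex variables. -/
def pderiv {g : ℕ} (i : Fin g) (f : (Fin g → ℂ) → ℂ) (s : Fin g → ℂ) : ℂ :=
  fderiv ℂ f s (Pi.single i 1)

/-! ### The times

The `g` times are numbered by `ℓ = 0, …, g - 1`: the coordinate `s ℓ` stands for `s_{2ℓ+1}`, and
`t ℓ` stands for `t_{∞,2ℓ+1}`. -/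

/-- The map `s ↦ t = D s`, `D = diag(1, 3, …, 2g - 1)`: `t_{∞,2ℓ+1} = (2ℓ+1) s_{2ℓ+1}`. -/
def timeMap (g : ℕ) (s : Fin g → ℂ) : Fin g → ℂ :=
  fun l => (2 * (l : ℂ) + 1) * s l

/-- The complete vector of irregular times `t_{∞,k}`, `1 ≤ k ≤ 2g + 4`, for the canonical choice
of the trivial times: all even times vanish, `t_{∞,2g+3} = 2`, `t_{∞,2g+1} = 0`, while
`t_{∞,2ℓ+1} = t ℓ` for `ℓ = 0, …, g - 1`. -/
def irregularTimes (g : ℕ) (t : Fin g → ℂ) (k : ℕ) : ℂ :=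
  if h : k % 2 = 1 ∧ k / 2 < g then t ⟨k / 2, h.2⟩
  else if k = 2 * g + 3 then 2 else 0

/-! ### The geometric (isomonodromic) side, with a pole of order `r = g + 3` at infinity

Formal Laurent series in `z⁻¹`, where `z = λ^{1/2}`, are Mathlib's Laurent series whose variable
`HahnSeries.single 1 1` is `z⁻¹`; hence `zᵏ` is `HahnSeries.single (-k) 1` and `λ` is
`HahnSeries.single (-2) 1`. -/

/-- The derivation `d/dλ = -(1/2) w³ d/dw` on Laurent series in `w = z⁻¹ = λ^{-1/2}`. -/
def lamDeriv (f : LaurentSeries ℂ) : LaurentSeries ℂ :=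
  HahnSeries.single 3 (-(1 / 2) : ℂ) * LaurentSeries.derivative ℂ f

/-- A polynomial in `λ`, seen as a Laurent series in `z⁻¹` through `λ = z²`. -/
def toPuiseux (p : ℂ[X]) : LaurentSeries ℂ :=
  Polynomial.aeval (HahnSeries.single (-2) (1 : ℂ) : LaurentSeries ℂ) p

/-- `(1/2) ∑_{k=1}^{2g+4} εᵏ t_{∞,k} z^{k-2} - 1/(4 z²)`, the diagonal entries (`ε = 1` and
`ε = -1`) of the formal diagonal form at infinity. -/
def irregularEntry (g : ℕ) (t : ℕ → ℂ) (ε : ℂ) : LaurentSeries ℂ :=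
  ∑ k ∈ Finset.Icc 1 (2 * g + 4), HahnSeries.single (2 - (k : ℤ)) (ε ^ k * t k / 2)
    - HahnSeries.single 2 (1 / 4)

/-- The connection `∂_λ Ψ = L(λ) Ψ` has irregular times `t` at infinity: it has a formal
fundamental solution `F(z) diag(exp(∑ t_k zᵏ / k - (ln z)/2), exp(∑ (-1)ᵏ t_k zᵏ / k - (ln z)/2))`
with `F` an invertible matrix of formal Laurent series in `z⁻¹ = λ^{-1/2}`. -/
def HasIrregularTimes (g : ℕ) (L : PolyMat) (t : ℕ → ℂ) : Prop :=
  ∃ F : Matrix (Fin 2) (Fin 2) (LaurentSeries ℂ), IsUnit F.det ∧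
    F.map lamDeriv + F * Matrix.diagonal ![irregularEntry g t 1, irregularEntry g t (-1)]
      = L.map toPuiseux * F

/-- The normalization of the representative in its orbit under conjugation:
`L(λ) = (0 0; 1 0) λ^{g+1} + (0 1; x 0) λ^g + O(λ^{g-1})` for some `x`. -/
def IsNormalized (g : ℕ) (L : PolyMat) : Prop :=
  ∃ x : ℂ, ∀ i j : Fin 2,
    (L i j - (C ((!![0, 0; 1, 0] : Matrix (Fin 2) (Fin 2) ℂ) i j) * X ^ (g + 1)
      + C ((!![0, 1; x, 0] : Matrix (Fin 2) (Fin 2) ℂ) i j) * X ^ g)).degree < (g : WithBot ℕ)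

/-- An isomonodromic deformation over an open set `Ω` of times `t = (t_{∞,1}, …, t_{∞,2g-1})`,
under the canonical choice of trivial times: a holomorphic family of normalized Lax matrices
`L t` with irregular times `t`, together with auxiliary matrices `A ℓ t` for the directions
`e_{2ℓ+1}`, which are traceless and polynomial in `λ` of degree at most `g + 1`, subject to the
zero curvature equations `∂_{t_{2ℓ+1}} L - ∂_λ A_ℓ + [L, A_ℓ] = 0`. -/
structure IsIsomonodromic (g : ℕ) (Ω : Set (Fin g → ℂ)) (L : (Fin g → ℂ) → PolyMat)
    (A : Fin g → (Fin g → ℂ) → PolyMat) : Prop where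
  analytic_lax : ∀ i j n, AnalyticOnNhd ℂ (fun t => (L t i j).coeff n) Ω
  analytic_aux : ∀ l i j n, AnalyticOnNhd ℂ (fun t => (A l t i j).coeff n) Ω
  normalized : ∀ t ∈ Ω, IsNormalized g (L t)
  irregular_times : ∀ t ∈ Ω, HasIrregularTimes g (L t) (irregularTimes g t)
  natDegree_aux : ∀ l, ∀ t ∈ Ω, ∀ i j, (A l t i j).natDegree ≤ g + 1
  trace_aux : ∀ l, ∀ t ∈ Ω, (A l t).trace = 0
  zero_curvature : ∀ l, ∀ t ∈ Ω, ∀ i j n,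
    pderiv l (fun t' => (L t' i j).coeff n) t - (derivative (A l t i j)).coeff n
      + ((L t * A l t - A l t * L t) i j).coeff n = 0

/-- `(q, p)` are the oper Darboux coordinates of `L` (with some labelling): the `q j` are the `g`
zeros, with multiplicity, of `L₁₂`, and `p j = L₁₁(q j)`. -/
def IsOperDarboux {g : ℕ} (L : PolyMat) (q p : Fin g → ℂ) : Prop :=
  (L 0 1).roots = Finset.univ.val.map q ∧ ∀ j, p j = (L 0 0).eval (q j)

/-! ### The minimal model (string equation) side -/

section MinimalModel

variable {g : ℕ} [NeZero g]

/-- `∂/∂x`, where `x = s_1`. -/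
def dx (f : (Fin g → ℂ) → ℂ) : (Fin g → ℂ) → ℂ := pderiv 0 f

/-- The differential polynomials: `R u k` is `R_{2k-1}[u]`. The recursion is the coefficient of
`λ^{-ℓ}` in `(1/4) (∂ₓ B)² + ((λ - u) B - (1/2) ∂ₓ² B) B = λ`, for `B = ∑ R_{2k-1} λ^{-k}`. -/
def R (u : (Fin g → ℂ) → ℂ) : ℕ → (Fin g → ℂ) → ℂ
  | 0 => fun _ => 1
  | l + 1 => fun s =>
      -(1 / 8) * ∑ i : Fin (l + 1), dx (R u i.val) s * dx (R u (l - i.val)) s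
      + u s / 2 * ∑ i : Fin (l + 1), R u i.val s * R u (l - i.val) s
      + 1 / 4 * ∑ i : Fin (l + 1), R u (l - i.val) s * dx (dx (R u i.val)) s
      - 1 / 2 * ∑ i : Fin l, R u (i.val + 1) s * R u (l - i.val) s
  termination_by k => k
  decreasing_by all_goals omega

/-- `c g s k` is `c_{2k-1}(s)`: equal to `(2k+1)/2 * s_{2k+1}` for `0 ≤ k ≤ g - 1`, to `0` for
`k = g`, and to `1` for `k = g + 1`. -/
def c (g : ℕ) (s : Fin g → ℂ) (k : ℕ) : ℂ :=
  if h : k < g then (2 * (k : ℂ) + 1) / 2 * s ⟨k, h⟩ else if k = g + 1 then 1 else 0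

/-- `u` is a holomorphic solution on `Ω` of the `g`-th member of the Painlevé I hierarchy:
the string equation and the KdV flows. -/
structure IsPISolution (Ω : Set (Fin g → ℂ)) (u : (Fin g → ℂ) → ℂ) : Prop where
  analytic : AnalyticOnNhd ℂ u Ω
  string_equation : ∀ s ∈ Ω,
    R u (g + 1) s + ∑ l : Fin g, (2 * (l : ℂ) + 1) / 2 * s l * R u l.val s = 0
  kdv_flows : ∀ l : Fin g, 1 ≤ l.val → ∀ s ∈ Ω, pderiv l u s = 2 * dx (R u (l.val + 1)) s

/-- For a Laurent series `f` in `λ⁻¹` (the variable `HahnSeries.single 1 1` is `λ⁻¹`), the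
polynomial part `[f]_{∞,+}`, as a polynomial in `λ`. -/
def polyPart (f : LaurentSeries ℂ) : ℂ[X] :=
  ∑ k ∈ Finset.range (f.order.natAbs + 1), Polynomial.monomial k (f.coeff (-(k : ℤ)))

theorem coeff_polyPart (f : LaurentSeries ℂ) (k : ℕ) :
    (polyPart f).coeff k = f.coeff (-(k : ℤ)) := by
  simp only [polyPart, Polynomial.finsetSum_coeff, Polynomial.coeff_monomial]
  rw [Finset.sum_ite_eq' (Finset.range (f.order.natAbs + 1)) k]
  split_ifs with h
  · rfl
  · refine (HahnSeries.coeff_eq_zero_of_lt_order ?_).symm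
    simp only [Finset.mem_range, not_lt] at h
    omega

/-- The formal series `∑_k a_k λ^{-k}`. -/
def seriesAtInfinity (a : ℕ → ℂ) : LaurentSeries ℂ :=
  HahnSeries.ofPowerSeries ℤ ℂ (PowerSeries.mk a)

/-- `B(λ) = ∑_k R_{2k-1}[u] λ^{-k}`, at the point `s`. -/
def seriesB (u : (Fin g → ℂ) → ℂ) (s : Fin g → ℂ) : LaurentSeries ℂ :=
  seriesAtInfinity fun k => R u k s

/-- `A(λ) = -(1/2) ∂ₓ B(λ)`. -/
def seriesA (u : (Fin g → ℂ) → ℂ) (s : Fin g → ℂ) : LaurentSeries ℂ :=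
  seriesAtInfinity fun k => -(1 / 2) * dx (R u k) s

/-- `C(λ) = -(1/2) ∂ₓ² B(λ) + (λ - u) B(λ)`. -/
def seriesC (u : (Fin g → ℂ) → ℂ) (s : Fin g → ℂ) : LaurentSeries ℂ :=
  seriesAtInfinity (fun k => -(1 / 2) * dx (dx (R u k)) s)
    + (HahnSeries.single (-1) 1 - HahnSeries.single 0 (u s)) * seriesB u s

/-- `U(λ) = (A B; C -A)`. -/
def matU (u : (Fin g → ℂ) → ℂ) (s : Fin g → ℂ) : Matrix (Fin 2) (Fin 2) (LaurentSeries ℂ) :=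
  !![seriesA u s, seriesB u s; seriesC u s, -seriesA u s]

/-- `calU u n s` is `𝒰_{2n+1}(λ) = [λⁿ U(λ)]_{∞,+} - (0 0; R_{2n+1}[u] 0)`. -/
def calU (u : (Fin g → ℂ) → ℂ) (n : ℕ) (s : Fin g → ℂ) : PolyMat :=
  (matU u s).map (fun f => polyPart (HahnSeries.single (-(n : ℤ)) 1 * f))
    - !![0, 0; C (R u (n + 1) s), 0]

/-- The Lax matrix `𝒜^{(g)}(λ) = ∑_{ℓ=1}^{g+1} c_{2ℓ-1}(s) 𝒰_{2ℓ-1}(λ)` of the string equation. -/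
def stringLax (u : (Fin g → ℂ) → ℂ) (s : Fin g → ℂ) : PolyMat :=
  ∑ l ∈ Finset.range (g + 1), c g s (l + 1) • calU u l s

/-- `(lam, mu)` are the spectral Darboux coordinates at `s` (with some labelling): the `lam j` are
the `g` zeros, with multiplicity, of `[𝒜^{(g)}]₁₂`, and `mu j = [𝒜^{(g)}(lam j)]₁₁`. -/
def IsSpectralDarboux (u : (Fin g → ℂ) → ℂ) (s : Fin g → ℂ) (lam mu : Fin g → ℂ) : Prop :=
  (stringLax u s 0 1).roots = Finset.univ.val.map lam ∧
    ∀ j, mu j = (stringLax u s 0 0).eval (lam j)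

/-! ### The identification -/

/-- The identification at the times `s` and `t = D s`: the Lax matrices agree; both sides have the
same Darboux coordinates `(q_j, p_j) = (λ_j, μ_j)`, which are unique up to a relabelling; and
`(2ℓ+1) Â_{e_{2ℓ+1}} = 𝒰_{2ℓ+1}` for `ℓ = 0, …, g - 1`. -/
structure Identified (L : (Fin g → ℂ) → PolyMat) (A : Fin g → (Fin g → ℂ) → PolyMat)
    (u : (Fin g → ℂ) → ℂ) (s : Fin g → ℂ) : Prop where
  lax : L (timeMap g s) = stringLax u s
  darboux_exists : ∃ q p : Fin g → ℂ, IsOperDarboux (L (timeMap g s)) q p ∧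
    IsSpectralDarboux u s q p
  darboux_eq : ∀ q p lam mu : Fin g → ℂ, IsOperDarboux (L (timeMap g s)) q p →
    IsSpectralDarboux u s lam mu →
      ∃ σ : Equiv.Perm (Fin g), ∀ j, (q j, p j) = (lam (σ j), mu (σ j))
  aux : ∀ l : Fin g, (2 * (l : ℂ) + 1) • A l (timeMap g s) = calU u l.val s

end MinimalModel

end PainleveOne

end

noncomputable section

namespace PainleveOne

/-! ### Laurent series: orders, coefficientwise derivations, embeddings of polynomials -/

section Laurent

variable {K : Type*} [CommRing K]

/-! Both sides are governed by one object: a traceless Laurent matrix `U` in `1/λ` with `U² = λ` and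
leading part `(0 1; λ 0)`. On the string side `U` is the KdV resolvent. On the isomonodromic side it
is `L` divided by a scalar: `L` is traceless, so `L² = -det L`, and `L = Y U` where `Y² = -det L /
λ`. Prescribing the irregular times amounts to prescribing the singular part of the spectral curve:
for a normalized `L` it means that `L` is traceless and that `-λ det L` and `(∑ c_{2k-1} λ^k)²`
agree in all degrees above `g` (`HasIrregularTimes.trace_eq_zero_and_det`,
`hasIrregularTimes_of_det`). Equivalently, `Y` differs from `timeSeries`, that is `∑ c_{2l-1}
λ^{l-1}`, by `O(λ^{-2})`.

From isomonodromy to the string equation. Split an auxiliary matrix `V` into a multiple of `U` and a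
part anticommuting with `U`. The commutator with `L = Y U` sees only the second part, which the
derivative terms of the zero curvature equation therefore bound; a trace identity fixes the first
part up to negative powers; polynomiality then forces `V = 𝒰_{2n+1}` (`IsNormalLax.eq_truncU`). For
`n = 0` this is the Schrödinger matrix, so `U` satisfies the resolvent equations up to
`O(λ^{-g-1})`, which is enough to identify its upper right coefficients with `R_{2k-1}[u]` for `k ≤
g + 1`. The string equation is the absence of `1/λ` in `L₁₂ = Y U₁₂`, and the KdV flows are the
`1/λ` coefficient of the flow of `U₁₂` (`IsFormalSystem.exists_resolvent`).

From the string equation to isomonodromy. The string equation makes `timeSeries • U - L` small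
(`IsSpectral.shear_of_string`), which yields the spectral curve (`IsResolvent.det_laxOf`). A matrix
solving the linearized resolvent equations is zero (`IsResolvent.eq_zero_of_linearized`); this gives
the KdV evolution of `U` (`IsResolvent.flow_of_kdv`) and the equation `∂_λ U = [L, U] + U / (2λ)`
(`IsResolvent.lambda_flow`). Hence the curvature commutes with `U`, so it is a scalar multiple of
`U`; a trace estimate shows that it has only negative powers of `λ`, and being polynomial it
vanishes (`IsResolvent.zero_curvature_laxOf`).

This algebra is carried out over a commutative `ℂ`-algebra with derivations and then specialised to
the algebra `Hol` of holomorphic functions. Orders of matrices are measured in the grading `Shear`,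
in which `U` is homogeneous to leading order. Finally, `L₁₂` is monic of degree `g`, so its roots
give the Darboux coordinates, and `-u/2` is the coefficient of `λ^g` in `L₂₁`, which gives
uniqueness. -/

/-- All coefficients of `f` of index smaller than `n` vanish. -/
def VanishBelow (f : LaurentSeries K) (n : ℤ) : Prop := ∀ k < n, f.coeff k = 0

theorem VanishBelow.mono {f : LaurentSeries K} {m n : ℤ} (h : VanishBelow f n) (hmn : m ≤ n) :
    VanishBelow f m := fun k hk => h k (hk.trans_le hmn)

theorem vanishBelow_zero (n : ℤ) : VanishBelow (0 : LaurentSeries K) n := fun _ _ => rfl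

theorem VanishBelow.add {f h : LaurentSeries K} {n : ℤ} (hf : VanishBelow f n)
    (hh : VanishBelow h n) : VanishBelow (f + h) n := fun k hk => by
  simp [hf k hk, hh k hk]

theorem VanishBelow.sub {f h : LaurentSeries K} {n : ℤ} (hf : VanishBelow f n)
    (hh : VanishBelow h n) : VanishBelow (f - h) n := fun k hk => by
  simp [hf k hk, hh k hk]

theorem VanishBelow.neg {f : LaurentSeries K} {n : ℤ} (hf : VanishBelow f n) :
    VanishBelow (-f) n := fun k hk => by
  simp [hf k hk]

theorem vanishBelow_single (n : ℤ) (a : K) : VanishBelow (HahnSeries.single n a) n :=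
  fun _ hk => HahnSeries.coeff_single_of_ne hk.ne

theorem vanishBelow_ofPowerSeries (p : PowerSeries K) :
    VanishBelow (HahnSeries.ofPowerSeries ℤ K p) 0 := fun k hk => by
  rw [HahnSeries.ofPowerSeries_apply]
  refine HahnSeries.embDomain_of_notMem_range ?_
  rintro ⟨n, rfl⟩
  simp at hk
  omega

theorem coeff_ofPowerSeries (p : PowerSeries K) (n : ℕ) :
    (HahnSeries.ofPowerSeries ℤ K p).coeff n = PowerSeries.coeff n p :=
  HahnSeries.ofPowerSeries_apply_coeff p n

/-- Factoring out the power of the variable reduces questions on products and inverses to power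
series. -/
theorem VanishBelow.eq_single_mul {f : LaurentSeries K} {n : ℤ} (hf : VanishBelow f n) :
    f = HahnSeries.single n 1 *
      HahnSeries.ofPowerSeries ℤ K (PowerSeries.mk fun k => f.coeff (n + k)) := by
  ext k
  rw [HahnSeries.coeff_single_mul, one_mul]
  rcases lt_or_ge k n with h | h
  · rw [hf k h, vanishBelow_ofPowerSeries _ _ (by omega)]
  · obtain ⟨m, rfl⟩ := Int.le.dest h
    rw [add_sub_cancel_left, coeff_ofPowerSeries, PowerSeries.coeff_mk]

theorem single_mul_ofPowerSeries_mul (a b : ℤ) (p q : PowerSeries K) :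
    HahnSeries.single a 1 * HahnSeries.ofPowerSeries ℤ K p *
      (HahnSeries.single b 1 * HahnSeries.ofPowerSeries ℤ K q)
      = HahnSeries.single (a + b) 1 * HahnSeries.ofPowerSeries ℤ K (p * q) := by
  rw [mul_mul_mul_comm, HahnSeries.single_mul_single, one_mul, map_mul]

theorem VanishBelow.mul {f h : LaurentSeries K} {m n : ℤ} (hf : VanishBelow f m)
    (hh : VanishBelow h n) : VanishBelow (f * h) (m + n) := fun k hk => by
  rw [hf.eq_single_mul, hh.eq_single_mul, single_mul_ofPowerSeries_mul,
    HahnSeries.coeff_single_mul, vanishBelow_ofPowerSeries _ _ (by omega), mul_zero]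

theorem VanishBelow.coeff_mul_add_nat {f h : LaurentSeries K} {m n : ℤ} (hf : VanishBelow f m)
    (hh : VanishBelow h n) (k : ℕ) : (f * h).coeff (m + n + k) =
      ∑ ij ∈ Finset.HasAntidiagonal.antidiagonal k, f.coeff (m + ij.1) * h.coeff (n + ij.2) := by
  rw [hf.eq_single_mul, hh.eq_single_mul, single_mul_ofPowerSeries_mul,
    HahnSeries.coeff_single_mul, add_sub_cancel_left, one_mul, coeff_ofPowerSeries,
    PowerSeries.coeff_mul]
  refine Finset.sum_congr rfl fun ij _ => ?_
  simp only [PowerSeries.coeff_mk]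
  rw [← hf.eq_single_mul, ← hh.eq_single_mul]

theorem VanishBelow.coeff_mul {f h : LaurentSeries K} {m n : ℤ} (hf : VanishBelow f m)
    (hh : VanishBelow h n) : (f * h).coeff (m + n) = f.coeff m * h.coeff n := by
  simpa using hf.coeff_mul_add_nat hh 0

theorem VanishBelow.succ {f : LaurentSeries K} {n : ℤ} (hf : VanishBelow f n)
    (h : f.coeff n = 0) : VanishBelow f (n + 1) := fun k hk => by
  rcases (Int.lt_add_one_iff.mp hk).lt_or_eq with hk | rfl
  exacts [hf k hk, h]

theorem VanishBelow.single_mul {f : LaurentSeries K} {n : ℤ} (hf : VanishBelow f n) (m : ℤ)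
    (a : K) : VanishBelow (HahnSeries.single m a * f) (m + n) :=
  (vanishBelow_single m a).mul hf

/-- A series whose leading coefficient is `1` has an inverse. -/
theorem exists_inverse_of_leading {f : LaurentSeries K} {n : ℤ} (hf : VanishBelow f n)
    (h : f.coeff n = 1) :
    ∃ e : LaurentSeries K, f * e = 1 ∧ VanishBelow e (-n) ∧ e.coeff (-n) = 1 := by
  have hu : IsUnit (PowerSeries.mk fun k : ℕ => f.coeff (n + k)) := by
    rw [PowerSeries.isUnit_iff_constantCoeff, ← PowerSeries.coeff_zero_eq_constantCoeff_apply,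
      PowerSeries.coeff_mk]
    simp [h]
  obtain ⟨q, hq⟩ := hu.exists_right_inv
  refine ⟨HahnSeries.single (-n) 1 * HahnSeries.ofPowerSeries ℤ K q, ?_, ?_, ?_⟩
  · conv_lhs => rw [hf.eq_single_mul]
    rw [single_mul_ofPowerSeries_mul, hq]
    simp
  · simpa using (vanishBelow_ofPowerSeries q).single_mul (-n) 1
  · rw [HahnSeries.coeff_single_mul, sub_self, one_mul]
    have := congrArg (PowerSeries.coeff 0) hq
    rw [PowerSeries.coeff_mul] at this
    simp [h] at this
    simpa [this] using coeff_ofPowerSeries q 0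

/-- The factor `e` is invertible because its leading coefficient is `1`; the coefficient ring may
have zero divisors, as holomorphic functions on a disconnected set do. -/
theorem VanishBelow.of_mul_left {f e : LaurentSeries K} {m n : ℤ} (he : VanishBelow e m)
    (h1 : e.coeff m = 1) (h : VanishBelow (e * f) (m + n)) : VanishBelow f n := by
  obtain ⟨e', hee, he', -⟩ := exists_inverse_of_leading he h1
  have : f = e' * (e * f) := by rw [← mul_assoc, mul_comm e', hee, one_mul]
  rw [this]
  simpa using he'.mul h

/-- A degree-preserving family of additive maps, coefficient by coefficient. -/
def gradedMap (d : ℤ → K →+ K) (f : LaurentSeries K) : LaurentSeries K where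
  coeff n := d n (f.coeff n)
  isPWO_support' := f.isPWO_support.mono fun n hn h0 => hn (by simp [h0])

/-- The Leibniz rule for an additive self-map of a commutative ring. -/
def IsLeibniz {A : Type*} [CommRing A] (δ : A →+ A) : Prop :=
  ∀ f h, δ (f * h) = f * δ h + h * δ f

/-- A degree-preserving family of additive maps, as an additive map of Laurent series. -/
def gradedHom (d : ℤ → K →+ K) : LaurentSeries K →+ LaurentSeries K where
  toFun := gradedMap d
  map_zero' := by ext; simp [gradedMap]
  map_add' := fun f h => by ext; simp [gradedMap]

/-- Leibniz is checked on each pair of indices of sum `n`. Letting the additive map depend on the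
index covers both coefficientwise derivations and the Euler operator. -/
theorem isLeibniz_gradedHom (d : ℤ → K →+ K)
    (hd : ∀ i j a b, d (i + j) (a * b) = a * d j b + b * d i a) : IsLeibniz (gradedHom d) := by
  intro f h
  have hsub : ∀ f, (gradedMap d f).support ⊆ f.support :=
    fun f n hn h0 => hn (by simp [gradedMap, h0])
  ext n
  change d n ((f * h).coeff n) = (f * gradedMap d h + h * gradedMap d f).coeff n
  rw [HahnSeries.coeff_add, mul_comm h, HahnSeries.coeff_mul_left' f.isPWO_support (hsub f),
    HahnSeries.coeff_mul_right' h.isPWO_support (hsub h), HahnSeries.coeff_mul, map_sum,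
    ← Finset.sum_add_distrib]
  refine Finset.sum_congr rfl fun ij hij => ?_
  rw [Finset.mem_antidiagonal] at hij
  rw [← hij.2.2, hd]
  simp only [gradedMap, mul_comm]

/-- A derivation of the coefficient ring, acting on Laurent series. -/
def coeffDerivation {R : Type*} [CommRing R] [Algebra R K] (D : Derivation R K K) :
    LaurentSeries K →+ LaurentSeries K :=
  gradedHom fun _ => D.toLinearMap.toAddMonoidHom

theorem isLeibniz_coeffDerivation {R : Type*} [CommRing R] [Algebra R K] (D : Derivation R K K) :
    IsLeibniz (coeffDerivation D) :=
  isLeibniz_gradedHom _ fun _ _ a b => by simp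

@[simp]
theorem coeff_coeffDerivation {R : Type*} [CommRing R] [Algebra R K] (D : Derivation R K K)
    (f : LaurentSeries K) (n : ℤ) : (coeffDerivation D f).coeff n = D (f.coeff n) := rfl

/-- The Euler derivation `f ↦ ∑ -n fₙ wⁿ`: for `w = 1/λ` this is `λ d/dλ`. -/
def eulerDerivation (K : Type*) [CommRing K] : LaurentSeries K →+ LaurentSeries K :=
  gradedHom fun n => AddMonoidHom.mulLeft (-(n : K))

theorem isLeibniz_eulerDerivation : IsLeibniz (eulerDerivation K) :=
  isLeibniz_gradedHom _ fun i j a b => by simp; ring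

@[simp]
theorem coeff_eulerDerivation (f : LaurentSeries K) (n : ℤ) :
    (eulerDerivation K f).coeff n = -n * f.coeff n := rfl

/-- The derivation `d/dλ` of Laurent series in `w = 1/λ`. -/
def lambdaDerivation (K : Type*) [CommRing K] : LaurentSeries K →+ LaurentSeries K :=
  (AddMonoidHom.mulLeft (HahnSeries.single (1 : ℤ) (1 : K))).comp (eulerDerivation K)

theorem lambdaDerivation_apply (f : LaurentSeries K) :
    lambdaDerivation K f = HahnSeries.single (1 : ℤ) (1 : K) * eulerDerivation K f := rfl

theorem isLeibniz_lambdaDerivation : IsLeibniz (lambdaDerivation K) := fun f h => by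
  rw [lambdaDerivation_apply, lambdaDerivation_apply, lambdaDerivation_apply,
    isLeibniz_eulerDerivation]
  ring

theorem coeff_lambdaDerivation (f : LaurentSeries K) (n : ℤ) :
    (lambdaDerivation K f).coeff n = -(n - 1 : ℤ) * f.coeff (n - 1) := by
  rw [lambdaDerivation_apply, HahnSeries.coeff_single_mul, one_mul, coeff_eulerDerivation]

theorem VanishBelow.coeffDerivation {R : Type*} [CommRing R] [Algebra R K] {f : LaurentSeries K}
    {n : ℤ} (hf : VanishBelow f n) (D : Derivation R K K) :
    VanishBelow (coeffDerivation D f) n := fun k hk => by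
  simp [hf k hk]

theorem VanishBelow.lambdaDerivation {f : LaurentSeries K}
    {n : ℤ} (hf : VanishBelow f n) :
    VanishBelow (lambdaDerivation K f) (n + 1) := fun k hk => by
  simp [coeff_lambdaDerivation, hf (k - 1) (by omega)]

theorem coeffDerivation_single {R : Type*} [CommRing R] [Algebra R K] (D : Derivation R K K)
    (n : ℤ) (a : K) :
    coeffDerivation D (HahnSeries.single n a) = HahnSeries.single n (D a) := by
  ext k
  by_cases h : k = n <;> simp [h]

theorem lambdaDerivation_single (n : ℤ) (a : K) :
    lambdaDerivation K (HahnSeries.single n a) = HahnSeries.single (n + 1) (-n * a) := by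
  ext k
  rw [coeff_lambdaDerivation]
  by_cases h : k = n + 1
  · subst h; simp
  · rw [HahnSeries.coeff_single_of_ne h, HahnSeries.coeff_single_of_ne (by omega), mul_zero]

theorem coeffDerivation_comm {R : Type*} [CommRing R] [Algebra R K] {D E : Derivation R K K}
    (h : ∀ a, D (E a) = E (D a)) (f : LaurentSeries K) :
    coeffDerivation D (coeffDerivation E f) = coeffDerivation E (coeffDerivation D f) := by
  ext n; simp [h]

theorem coeffDerivation_lambdaDerivation {R : Type*} [CommRing R] [Algebra R K]
    (D : Derivation R K K) (f : LaurentSeries K) :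
    coeffDerivation D (lambdaDerivation K f) = lambdaDerivation K (coeffDerivation D f) := by
  ext n
  rw [coeff_coeffDerivation, coeff_lambdaDerivation, coeff_lambdaDerivation,
    coeff_coeffDerivation, ← Int.cast_neg, ← zsmul_eq_mul, ← zsmul_eq_mul, map_zsmul]

/-! Polynomials in `λ` as Laurent series in `λ^{-1/m}`. -/

theorem algebraMap_laurentSeries (a : K) :
    algebraMap K (LaurentSeries K) a = HahnSeries.single 0 a := by
  rw [HahnSeries.algebraMap_apply', PowerSeries.algebraMap_apply, HahnSeries.ofPowerSeries_C]
  rfl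

theorem aeval_single_eq_sum (m : ℕ) (p : K[X]) :
    aeval (HahnSeries.single (-(m : ℤ)) (1 : K) : LaurentSeries K) p =
      ∑ i ∈ Finset.range (p.natDegree + 1), HahnSeries.single (-(m * i : ℤ)) (p.coeff i) := by
  rw [aeval_def, eval₂_eq_sum_range]
  refine Finset.sum_congr rfl fun i _ => ?_
  rw [algebraMap_laurentSeries, HahnSeries.single_pow, HahnSeries.single_mul_single]
  simp [mul_comm]

theorem coeff_aeval_single {m : ℕ} (hm : 0 < m) (p : K[X]) (n : ℕ) :
    (aeval (HahnSeries.single (-(m : ℤ)) (1 : K) : LaurentSeries K) p).coeff (-(m * n))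
      = p.coeff n := by
  rw [aeval_single_eq_sum, HahnSeries.coeff_sum]
  have h : ∀ i ∈ Finset.range (p.natDegree + 1),
      (HahnSeries.single (-(m * i : ℤ)) (p.coeff i) : LaurentSeries K).coeff (-(m * n))
      = if i = n then p.coeff i else 0 := by
    intro i _
    rw [HahnSeries.coeff_single]
    have : -(m * n : ℤ) = -(m * i) ↔ i = n := by
      rw [neg_inj, mul_right_inj' (by exact_mod_cast hm.ne'), Nat.cast_inj, eq_comm]
    simp only [this]
  rw [Finset.sum_congr rfl h, Finset.sum_ite_eq']
  split_ifs with hn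
  · rfl
  · exact (coeff_eq_zero_of_natDegree_lt (by simpa [Nat.lt_succ_iff] using hn)).symm

theorem coeff_aeval_single_of_ne {m : ℕ} (p : K[X]) (k : ℤ)
    (hk : ∀ n : ℕ, k ≠ -(m * n)) :
    (aeval (HahnSeries.single (-(m : ℤ)) (1 : K) : LaurentSeries K) p).coeff k = 0 := by
  rw [aeval_single_eq_sum, HahnSeries.coeff_sum]
  exact Finset.sum_eq_zero fun i _ => HahnSeries.coeff_single_of_ne (hk i)

/-- A polynomial in `λ`, as a Laurent series in `1/λ`. -/
def polyLaurent (K : Type*) [CommRing K] : K[X] →ₐ[K] LaurentSeries K :=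
  aeval (HahnSeries.single (-1) (1 : K) : LaurentSeries K)

theorem coeff_polyLaurent (p : K[X]) (n : ℕ) : (polyLaurent K p).coeff (-n) = p.coeff n := by
  simpa [polyLaurent] using coeff_aeval_single one_pos p n

theorem coeff_polyLaurent_of_pos (p : K[X]) {k : ℤ} (hk : 0 < k) :
    (polyLaurent K p).coeff k = 0 := by
  have := coeff_aeval_single_of_ne (m := 1) p k (fun n => by omega)
  simpa [polyLaurent] using this

theorem polyLaurent_derivative (p : K[X]) :
    polyLaurent K (derivative p) = lambdaDerivation K (polyLaurent K p) := by
  ext k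
  rw [coeff_lambdaDerivation]
  rcases lt_or_ge 0 k with h | h
  · rw [coeff_polyLaurent_of_pos _ h]
    rcases (Int.le_sub_one_of_lt h).lt_or_eq with h' | h'
    · rw [coeff_polyLaurent_of_pos _ h', mul_zero]
    · simp [← h']
  · obtain ⟨n, rfl⟩ := Int.exists_eq_neg_ofNat h
    have : (-(n : ℤ) - 1) = -((n + 1 : ℕ) : ℤ) := by push_cast; ring
    rw [this, coeff_polyLaurent, coeff_polyLaurent, coeff_derivative]
    push_cast
    ring


end Laurent

/-! ### Fixed points of contractions of power series rings -/

section FixedPoint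

variable {K : Type*} [CommRing K]

/-- The iterates of `T` at `0` stabilise coefficient by coefficient, since each application of `T`
gains one power of `X`; the diagonal of these stable coefficients is the fixed point. -/
theorem exists_fixedPoint_powerSeries (T : PowerSeries K → PowerSeries K)
    (hT : ∀ f h n, PowerSeries.X ^ n ∣ f - h → PowerSeries.X ^ (n + 1) ∣ T f - T h) :
    ∃ f, T f = f := by
  have h1 : ∀ n k, PowerSeries.X ^ n ∣ T^[n + k] 0 - T^[n] 0 := by
    intro n
    induction n with
    | zero => intro k; simp
    | succ n ih =>
      intro k
      rw [add_right_comm, Function.iterate_succ_apply', Function.iterate_succ_apply']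
      exact hT _ _ _ (ih k)
  let f : PowerSeries K := PowerSeries.mk fun n => PowerSeries.coeff n (T^[n + 1] 0)
  have h2 : ∀ n, PowerSeries.X ^ n ∣ f - T^[n] 0 := by
    intro n
    rw [PowerSeries.X_pow_dvd_iff]
    intro m hm
    obtain ⟨k, rfl⟩ := Nat.exists_eq_add_of_lt hm
    have := (PowerSeries.X_pow_dvd_iff.mp (h1 (m + 1) k)) m (by omega)
    rw [map_sub, sub_eq_zero] at this ⊢
    simp only [f, PowerSeries.coeff_mk]
    rw [← this, add_right_comm]
  refine ⟨f, ?_⟩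
  rw [← sub_eq_zero]
  ext n
  have h3 := dvd_sub (hT _ _ _ (h2 n)) (h2 (n + 1))
  rw [Function.iterate_succ_apply', sub_sub_sub_cancel_right] at h3
  simpa using PowerSeries.X_pow_dvd_iff.mp h3 n (by omega)

/-- Writing `p = 1 + X p₁` and `q = 1 + X k`, the equation `q² = p` becomes `k = (p₁ - X k²)/2`, a
contraction. -/
theorem exists_sqrt_powerSeries (half : K) (hhalf : 2 * half = 1) (p : PowerSeries K)
    (hp : PowerSeries.constantCoeff p = 1) :
    ∃ q : PowerSeries K, q ^ 2 = p ∧ PowerSeries.constantCoeff q = 1 := by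
  obtain ⟨p1, hp1⟩ : PowerSeries.X ∣ p - 1 := by
    rw [PowerSeries.X_dvd_iff]; simp [hp]
  have hC : (2 : PowerSeries K) * PowerSeries.C half = 1 := by
    rw [← map_ofNat PowerSeries.C, ← map_mul, hhalf, map_one]
  obtain ⟨k, hk⟩ := exists_fixedPoint_powerSeries
    (fun k => PowerSeries.C half * (p1 - PowerSeries.X * k ^ 2)) (by
      rintro f h n ⟨e, he⟩
      refine ⟨-PowerSeries.C half * (f + h) * e, ?_⟩
      linear_combination (-PowerSeries.C half * PowerSeries.X * (f + h)) * he)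
  refine ⟨1 + PowerSeries.X * k, ?_, by simp⟩
  linear_combination (2 * PowerSeries.X) * (-hk) - hp1
    + (PowerSeries.X * (p1 - PowerSeries.X * k ^ 2)) * hC

end FixedPoint

/-! ### `2 × 2` matrices of Laurent series -/

section Matrices

variable {K : Type*} [CommRing K]

/-- `2 × 2` matrices of formal Laurent series in `1/λ`. -/
abbrev LMat (K : Type*) [CommRing K] : Type _ := Matrix (Fin 2) (Fin 2) (LaurentSeries K)

/-- The spectral variable `λ` as a Laurent series in `1/λ`. -/
def lam (K : Type*) [CommRing K] : LaurentSeries K := HahnSeries.single (-1) 1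

/-- The inverse `1/λ` of the spectral variable. -/
def lamInv (K : Type*) [CommRing K] : LaurentSeries K := HahnSeries.single 1 1

/-- The embedding of the coefficient ring as constant series. -/
def cst {K : Type*} [CommRing K] : K →+* LaurentSeries K := HahnSeries.C

theorem cst_apply (a : K) : cst a = HahnSeries.single 0 a := rfl

theorem coeff_cst (a : K) (k : ℤ) : (cst a).coeff k = if k = 0 then a else 0 := by
  rw [cst_apply, HahnSeries.coeff_single]
  congr

/-- The lower triangular matrix unit. -/
def E21 (K : Type*) [CommRing K] : LMat K := !![0, 0; 1, 0]

@[simp] theorem E21_apply_00 : E21 K 0 0 = 0 := rfl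
@[simp] theorem E21_apply_01 : E21 K 0 1 = 0 := rfl
@[simp] theorem E21_apply_10 : E21 K 1 0 = 1 := rfl
@[simp] theorem E21_apply_11 : E21 K 1 1 = 0 := rfl

theorem lmat_ext {M N : LMat K} (h00 : M 0 0 = N 0 0) (h01 : M 0 1 = N 0 1)
    (h10 : M 1 0 = N 1 0) (h11 : M 1 1 = N 1 1) : M = N := by
  ext1 i j
  fin_cases i <;> fin_cases j
  exacts [h00, h01, h10, h11]

theorem lam_mul_lamInv : lam K * lamInv K = 1 := by
  rw [lam, lamInv, HahnSeries.single_mul_single]; simp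

theorem coeff_lam_mul (f : LaurentSeries K) (k : ℤ) : (lam K * f).coeff k = f.coeff (k + 1) := by
  rw [lam, HahnSeries.coeff_single_mul, one_mul, sub_neg_eq_add]

theorem coeff_lamInv_mul (f : LaurentSeries K) (k : ℤ) :
    (lamInv K * f).coeff k = f.coeff (k - 1) := by
  rw [lamInv, HahnSeries.coeff_single_mul, one_mul]

theorem lam_pow (n : ℕ) : lam K ^ n = HahnSeries.single (-(n : ℤ)) 1 := by
  rw [lam, HahnSeries.single_pow]; simp

theorem coeff_lam_pow_mul (n : ℕ) (f : LaurentSeries K) (k : ℤ) :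
    (lam K ^ n * f).coeff k = f.coeff (k + n) := by
  rw [lam_pow, HahnSeries.coeff_single_mul, one_mul, sub_neg_eq_add]

theorem coeff_cst_mul (a : K) (f : LaurentSeries K) (k : ℤ) :
    (cst a * f).coeff k = a * f.coeff k := by
  rw [cst_apply, HahnSeries.coeff_single_mul, sub_zero]

theorem coeff_two_mul (f : LaurentSeries K) (k : ℤ) : (2 * f).coeff k = 2 * f.coeff k := by
  rw [two_mul, two_mul, HahnSeries.coeff_add]

theorem vanishBelow_lam : VanishBelow (lam K) (-1) := vanishBelow_single _ _

theorem vanishBelow_lamInv : VanishBelow (lamInv K) 1 := vanishBelow_single _ _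

theorem vanishBelow_cst (a : K) : VanishBelow (cst a) 0 :=
  vanishBelow_single _ _

theorem vanishBelow_one : VanishBelow (1 : LaurentSeries K) 0 :=
  vanishBelow_single _ _

theorem VanishBelow.cst_mul {f : LaurentSeries K} {n : ℤ} (hf : VanishBelow f n) (a : K) :
    VanishBelow (cst a * f) n := by
  simpa using (vanishBelow_cst a).mul hf

theorem VanishBelow.sum {ι : Type*} {s : Finset ι} {f : ι → LaurentSeries K} {n : ℤ}
    (hf : ∀ i ∈ s, VanishBelow (f i) n) : VanishBelow (∑ i ∈ s, f i) n := fun k hk => by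
  rw [HahnSeries.coeff_sum]
  exact Finset.sum_eq_zero fun i hi => hf i hi k hk

theorem exists_vanishBelow (f : LaurentSeries K) : ∃ n, VanishBelow f n :=
  ⟨f.order, fun _ hk => HahnSeries.coeff_eq_zero_of_lt_order hk⟩

theorem lambdaDerivation_lam : lambdaDerivation K (lam K) = 1 := by
  rw [lam, lambdaDerivation_single]; simp

theorem lambdaDerivation_lam_pow (n : ℕ) :
    lambdaDerivation K (lam K ^ (n + 1)) = (n + 1) * lam K ^ n := by
  induction n with
  | zero => simp [lambdaDerivation_lam]
  | succ n ih =>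
    rw [pow_succ, isLeibniz_lambdaDerivation, ih, lambdaDerivation_lam]
    push_cast
    ring

theorem lambdaDerivation_cst (a : K) : lambdaDerivation K (cst a) = 0 := by
  rw [cst_apply, lambdaDerivation_single]; simp

theorem lambdaDerivation_one : lambdaDerivation K (1 : LaurentSeries K) = 0 := by
  rw [← map_one cst, lambdaDerivation_cst]

theorem coeffDerivation_cst {R : Type*} [CommRing R] [Algebra R K] (D : Derivation R K K) (a : K) :
    coeffDerivation D (cst a) = cst (D a) :=
  coeffDerivation_single D 0 a

theorem coeffDerivation_lam {R : Type*} [CommRing R] [Algebra R K] (D : Derivation R K K) :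
    coeffDerivation D (lam K) = 0 := by
  rw [lam, coeffDerivation_single]; simp

theorem coeffDerivation_lamInv {R : Type*} [CommRing R] [Algebra R K] (D : Derivation R K K) :
    coeffDerivation D (lamInv K) = 0 := by
  rw [lamInv, coeffDerivation_single]; simp

theorem coeffDerivation_lam_pow {R : Type*} [CommRing R] [Algebra R K] (D : Derivation R K K)
    (n : ℕ) : coeffDerivation D (lam K ^ n) = 0 := by
  rw [lam_pow, coeffDerivation_single]; simp

/-- A Laurent series in `1/λ` without negative powers of `λ`. -/
def IsPoly (f : LaurentSeries K) : Prop := ∀ k > 0, f.coeff k = 0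

theorem IsPoly.add {f h : LaurentSeries K} (hf : IsPoly f) (hh : IsPoly h) : IsPoly (f + h) :=
  fun k hk => by simp [hf k hk, hh k hk]

theorem IsPoly.sub {f h : LaurentSeries K} (hf : IsPoly f) (hh : IsPoly h) : IsPoly (f - h) :=
  fun k hk => by simp [hf k hk, hh k hk]

theorem IsPoly.neg {f : LaurentSeries K} (hf : IsPoly f) : IsPoly (-f) :=
  fun k hk => by simp [hf k hk]

theorem IsPoly.mul {f h : LaurentSeries K} (hf : IsPoly f) (hh : IsPoly h) : IsPoly (f * h) := by
  intro k hk
  rw [HahnSeries.coeff_mul]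
  refine Finset.sum_eq_zero fun ij hij => ?_
  rw [Finset.mem_antidiagonal] at hij
  rcases lt_or_ge 0 ij.1 with h1 | h1
  · rw [hf _ h1, zero_mul]
  · rw [hh _ (by omega), mul_zero]

theorem isPoly_single {n : ℤ} (hn : n ≤ 0) (a : K) :
    IsPoly (HahnSeries.single n a : LaurentSeries K) :=
  fun _ hk => HahnSeries.coeff_single_of_ne (by omega)

theorem isPoly_zero : IsPoly (0 : LaurentSeries K) := fun _ _ => rfl

theorem isPoly_one : IsPoly (1 : LaurentSeries K) := isPoly_single le_rfl 1

theorem isPoly_lam : IsPoly (lam K) := isPoly_single (by norm_num) 1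

theorem isPoly_cst (a : K) : IsPoly (cst a) := isPoly_single le_rfl a

theorem IsPoly.sum {ι : Type*} {s : Finset ι} {f : ι → LaurentSeries K}
    (hf : ∀ i ∈ s, IsPoly (f i)) : IsPoly (∑ i ∈ s, f i) := fun k hk => by
  rw [HahnSeries.coeff_sum]
  exact Finset.sum_eq_zero fun i hi => hf i hi k hk

theorem IsPoly.coeffDerivation {R : Type*} [CommRing R] [Algebra R K] {f : LaurentSeries K}
    (hf : IsPoly f) (D : Derivation R K K) : IsPoly (coeffDerivation D f) := fun k hk => by
  simp [hf k hk]

theorem IsPoly.lambdaDerivation {f : LaurentSeries K} (hf : IsPoly f) :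
    IsPoly (lambdaDerivation K f) := fun k hk => by
  rw [coeff_lambdaDerivation]
  rcases (Int.le_sub_one_of_lt hk).lt_or_eq with h | h
  · rw [hf _ h, mul_zero]
  · simp [← h]

theorem IsPoly.eq_zero {f : LaurentSeries K} (hf : IsPoly f) (h : VanishBelow f 1) : f = 0 := by
  ext k
  rcases lt_or_ge 0 k with hk | hk
  exacts [hf k hk, h k (by omega)]

/-- The part of a Laurent series without negative powers of `λ`. -/
def plusPart (f : LaurentSeries K) : LaurentSeries K where
  coeff k := if k ≤ 0 then f.coeff k else 0
  isPWO_support' := f.isPWO_support.mono fun n hn h0 => hn (by simp [h0])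

theorem coeff_plusPart (f : LaurentSeries K) (k : ℤ) :
    (plusPart f).coeff k = if k ≤ 0 then f.coeff k else 0 := rfl

theorem isPoly_plusPart (f : LaurentSeries K) : IsPoly (plusPart f) := fun k hk => by
  rw [coeff_plusPart, if_neg (by omega)]

theorem vanishBelow_sub_plusPart (f : LaurentSeries K) : VanishBelow (f - plusPart f) 1 :=
  fun k hk => by
    rw [HahnSeries.coeff_sub, coeff_plusPart, if_pos (by omega), sub_self]

theorem plusPart_neg (f : LaurentSeries K) : plusPart (-f) = -plusPart f := by
  ext k
  simp only [coeff_plusPart, HahnSeries.coeff_neg]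
  split_ifs <;> simp

theorem mapMatrix_mul {δ : LaurentSeries K →+ LaurentSeries K} (hδ : IsLeibniz δ) (M N : LMat K) :
    δ.mapMatrix (M * N) = M * δ.mapMatrix N + δ.mapMatrix M * N := by
  ext1 i j
  simp only [AddMonoidHom.mapMatrix_apply, Matrix.map_apply, Matrix.mul_apply, Fin.sum_univ_two,
    Matrix.add_apply, map_add, hδ _ _]
  ring

theorem mapMatrix_smul {δ : LaurentSeries K →+ LaurentSeries K} (hδ : IsLeibniz δ)
    (f : LaurentSeries K) (M : LMat K) :
    δ.mapMatrix (f • M) = f • δ.mapMatrix M + δ f • M := by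
  ext1 i j
  simp only [AddMonoidHom.mapMatrix_apply, Matrix.map_apply, Matrix.smul_apply, smul_eq_mul,
    Matrix.add_apply, hδ _ _]
  ring

theorem trace_mapMatrix (δ : LaurentSeries K →+ LaurentSeries K) (M : LMat K) :
    (δ.mapMatrix M).trace = δ M.trace := by
  simp [Matrix.trace_fin_two]

/-- `M` becomes of degree at most `m` in `λ^{1/2}` after conjugation by
`diag(λ^{1/4}, λ^{-1/4})`. -/
def Shear (m : ℤ) (M : LMat K) : Prop :=
  ∀ i j : Fin 2, VanishBelow (M i j) (((j : ℤ) - (i : ℤ) - m + 1) / 2)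

theorem Shear.mono {m n : ℤ} {M : LMat K} (h : Shear m M) (hmn : m ≤ n) : Shear n M :=
  fun i j => (h i j).mono (by omega)

theorem Shear.add {m : ℤ} {M N : LMat K} (hM : Shear m M) (hN : Shear m N) : Shear m (M + N) :=
  fun i j => (hM i j).add (hN i j)

theorem Shear.sub {m : ℤ} {M N : LMat K} (hM : Shear m M) (hN : Shear m N) : Shear m (M - N) :=
  fun i j => (hM i j).sub (hN i j)

theorem Shear.mul {m n : ℤ} {M N : LMat K} (hM : Shear m M) (hN : Shear n N) :
    Shear (m + n) (M * N) := by
  intro i j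
  rw [Matrix.mul_apply]
  exact VanishBelow.sum fun l _ => ((hM i l).mul (hN l j)).mono (by omega)

theorem Shear.smul {m n : ℤ} {f : LaurentSeries K} {M : LMat K} (hM : Shear m M)
    (hf : VanishBelow f n) : Shear (m - 2 * n) (f • M) :=
  fun i j => (hf.mul (hM i j)).mono (by omega)

theorem Shear.trace {m : ℤ} {M : LMat K} (hM : Shear m M) :
    VanishBelow M.trace ((-m + 1) / 2) := by
  rw [Matrix.trace]
  exact VanishBelow.sum fun l _ => (hM l l).mono (by omega)

theorem Shear.coeffDerivation {R : Type*} [CommRing R] [Algebra R K] {m : ℤ} {M : LMat K}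
    (hM : Shear m M) (D : Derivation R K K) : Shear m ((coeffDerivation D).mapMatrix M) :=
  fun i j => (hM i j).coeffDerivation D

theorem Shear.lambdaDerivation {m : ℤ} {M : LMat K}
    (hM : Shear m M) : Shear (m - 2) ((lambdaDerivation K).mapMatrix M) :=
  fun i j => (hM i j).lambdaDerivation.mono (by omega)

/-- The bound on the entry `(i, j)` is the ceiling of `(j - i - m)/2`, written as a floor after
adding `1` to the numerator. -/
theorem shear_of_entries {m : ℤ} {M : LMat K} (h00 : VanishBelow (M 0 0) ((-m + 1) / 2))
    (h01 : VanishBelow (M 0 1) ((-m + 2) / 2)) (h10 : VanishBelow (M 1 0) (-m / 2))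
    (h11 : VanishBelow (M 1 1) ((-m + 1) / 2)) : Shear m M := by
  intro i j
  fin_cases i <;> fin_cases j
  · exact h00.mono (by simp)
  · exact h01.mono (by simp; omega)
  · exact h10.mono (by simp; omega)
  · exact h11.mono (by simp)

theorem trace_mul_self_eq {M : LMat K} (hM : M 1 1 = -M 0 0) :
    (M * M).trace = -(2 * M.det) := by
  simp only [Matrix.trace_fin_two, Matrix.mul_apply, Fin.sum_univ_two, Matrix.det_fin_two, hM]
  ring

/-- Polarised Cayley–Hamilton. It turns commutation with `U` into proportionality to `U`, and
trace-orthogonality to `U` into anticommutation. -/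
theorem mul_add_mul_of_traceless {M N : LMat K} (hM : M 1 1 = -M 0 0) (hN : N 1 1 = -N 0 0) :
    M * N + N * M = (M * N).trace • 1 := by
  ext1 i j
  fin_cases i <;> fin_cases j <;>
  simp [Matrix.trace_fin_two, Matrix.mul_apply, Fin.sum_univ_two, hM, hN] <;> ring

theorem traceless_iff {M : LMat K} : M 1 1 = -M 0 0 ↔ M.trace = 0 := by
  rw [Matrix.trace_fin_two, eq_neg_iff_add_eq_zero, add_comm]

theorem trace_commutator (M N : LMat K) : (M * N - N * M).trace = 0 := by
  rw [Matrix.trace_sub, Matrix.trace_mul_comm, sub_self]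

end Matrices

/-! ### Nonzero integers as units of a `ℂ`-algebra -/

section Numbers

variable {K : Type*} [CommRing K] [Algebra ℂ K]

theorem isUnit_intCast {n : ℤ} (hn : n ≠ 0) : IsUnit (n : K) := by
  have h : IsUnit (n : ℂ) := isUnit_iff_ne_zero.mpr (by exact_mod_cast hn)
  simpa using h.map (algebraMap ℂ K)

theorem eq_zero_of_intCast_mul {n : ℤ} (hn : n ≠ 0) {a : K} (h : (n : K) * a = 0) : a = 0 :=
  (isUnit_intCast hn).mul_right_eq_zero.mp h

theorem eq_zero_of_two_mul {a : K} (h : 2 * a = 0) : a = 0 :=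
  eq_zero_of_intCast_mul (n := 2) (by norm_num) (by simpa using h)

theorem VanishBelow.of_two_mul {f : LaurentSeries K} {n : ℤ} (h : VanishBelow (2 * f) n) :
    VanishBelow f n := fun k hk => eq_zero_of_two_mul (by rw [← coeff_two_mul, h k hk])

theorem laurent_eq_of_two_mul {f h : LaurentSeries K} (hfh : 2 * f = 2 * h) : f = h := by
  rw [← sub_eq_zero]
  ext k
  refine eq_zero_of_two_mul ?_
  rw [← coeff_two_mul, mul_sub, hfh, sub_self]; rfl

end Numbers

/-! ### The resolvent matrix and its flows -/

section Resolvent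

variable {K : Type*} [CommRing K] [Algebra ℂ K]

/-- The matrix `(0 1; λ - u 0)` of the Schrödinger equation. -/
def schroedinger (u : K) : LMat K := !![0, 1; lam K - cst u, 0]

section Entries

omit [Algebra ℂ K]

@[simp] theorem schroedinger_apply_00 (u : K) : schroedinger u 0 0 = 0 := rfl
@[simp] theorem schroedinger_apply_01 (u : K) : schroedinger u 0 1 = 1 := rfl
@[simp] theorem schroedinger_apply_10 (u : K) : schroedinger u 1 0 = lam K - cst u := rfl
@[simp] theorem schroedinger_apply_11 (u : K) : schroedinger u 1 1 = 0 := rfl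

end Entries

/-- `U` is a traceless matrix of square `λ`, of the form `(0 1; λ 0) + …`. -/
structure IsSpectral {K : Type*} [CommRing K] (U : LMat K) : Prop where
  traceless : U 1 1 = -U 0 0
  sq : U * U = lam K • 1
  vanish00 : VanishBelow (U 0 0) 1
  vanish01 : VanishBelow (U 0 1) 0
  vanish10 : VanishBelow (U 1 0) (-1)
  coeff01 : (U 0 1).coeff 0 = 1
  coeff10 : (U 1 0).coeff (-1) = 1

/-- `U` is a traceless matrix of square `λ`, of the form `(0 1; λ 0) + …`, whose derivative
along `D` is the commutator with the Schrödinger matrix of potential `u`. -/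
structure IsResolvent (D : Derivation ℂ K K) (u : K) (U : LMat K) : Prop extends IsSpectral U where
  flow : (coeffDerivation D).mapMatrix U = schroedinger u * U - U * schroedinger u

variable {D : Derivation ℂ K K} {u : K} {U : LMat K}

omit [Algebra ℂ K] in
theorem IsSpectral.shear (h : IsSpectral U) : Shear 1 U :=
  shear_of_entries (h.vanish00.mono (by norm_num)) (h.vanish01.mono (by norm_num))
    (h.vanish10.mono (by norm_num)) (by rw [h.traceless]; exact h.vanish00.neg.mono (by norm_num))

/-- Uniqueness for the linearized resolvent equations. -/
theorem IsResolvent.eq_zero_of_linearized (h : IsResolvent D u U) {J : LMat K}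
    (hJt : J 1 1 = -J 0 0)
    (hJ : (coeffDerivation D).mapMatrix J = schroedinger u * J - J * schroedinger u)
    (htr : (U * J).trace = 0) : J = 0 := by
  have e01 : coeffDerivation D (J 0 1) = -(2 * J 0 0) := by
    have := congrFun (congrFun hJ 0) 1
    simp [Matrix.mul_apply, Fin.sum_univ_two, hJt] at this
    rw [this]; ring
  have e00 : coeffDerivation D (J 0 0) = J 1 0 - (lam K - cst u) * J 0 1 := by
    have := congrFun (congrFun hJ 0) 0
    simp [Matrix.mul_apply, Fin.sum_univ_two] at this
    rw [this]; ring
  have e10 : J 1 0 = coeffDerivation D (J 0 0) + (lam K - cst u) * J 0 1 := by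
    rw [e00]; ring
  have et : 2 * U 0 0 * J 0 0 + U 0 1 * J 1 0 + U 1 0 * J 0 1 = 0 := by
    rw [← htr, Matrix.trace_fin_two]
    simp only [Matrix.mul_apply, Fin.sum_univ_two, hJt, h.traceless]
    ring
  -- The equations express `J` through its upper right entry: `J₁₁ = -D J₁₂ / 2` and `J₂₁ = D J₁₁ +
  -- (λ - u) J₁₂`, so orders of vanishing are controlled by `J₁₂` alone.
  have van00 : ∀ n, VanishBelow (J 0 1) n → VanishBelow (J 0 0) n := fun n hn =>
    VanishBelow.of_two_mul (by
      have := hn.coeffDerivation D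
      rw [e01] at this
      simpa using this.neg)
  -- The leading term of `tr(U J)` is twice that of `λ J₁₂`: one copy comes from `U₁₂ J₂₁`, one from
  -- `U₂₁ J₁₂`. Vanishing of the trace therefore raises the order of `J₁₂` by one.
  have step : ∀ n, VanishBelow (J 0 1) n → VanishBelow (J 0 1) (n + 1) := by
    intro n hn
    refine hn.succ (eq_zero_of_two_mul ?_)
    have h00 := van00 n hn
    have h10 : VanishBelow (J 1 0) (n - 1) := by
      rw [e10, sub_mul]
      refine ((h00.coeffDerivation D).mono (by omega)).add (VanishBelow.sub ?_ ?_)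
      · exact (vanishBelow_lam.mul hn).mono (by omega)
      · exact (hn.cst_mul u).mono (by omega)
    have c10 : (J 1 0).coeff (n - 1) = (J 0 1).coeff n := by
      rw [e10, sub_mul, HahnSeries.coeff_add, HahnSeries.coeff_sub, coeff_lam_mul,
        h00.coeffDerivation D _ (by omega), hn.cst_mul u _ (by omega)]
      simp
    have := congrArg (fun f => HahnSeries.coeff f (n - 1)) et
    simp only [HahnSeries.coeff_add, HahnSeries.coeff_zero] at this
    have t1 : (2 * U 0 0 * J 0 0).coeff (n - 1) = 0 := by
      rw [mul_assoc, coeff_two_mul, h.vanish00.mul h00 _ (by omega), mul_zero]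
    have t2 : (U 0 1 * J 1 0).coeff (n - 1) = (J 0 1).coeff n := by
      have := h.vanish01.coeff_mul h10
      rwa [zero_add, h.coeff01, one_mul, c10] at this
    have t3 : (U 1 0 * J 0 1).coeff (n - 1) = (J 0 1).coeff n := by
      have := h.vanish10.coeff_mul hn
      rwa [neg_add_eq_sub, h.coeff10, one_mul] at this
    rw [t1, t2, t3] at this
    linear_combination this
  have hall : ∀ n, VanishBelow (J 0 1) n := by
    obtain ⟨n, hn⟩ := exists_vanishBelow (J 0 1)
    have : ∀ k : ℕ, VanishBelow (J 0 1) (n + k) := by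
      intro k
      induction k with
      | zero => simpa using hn
      | succ k ih => have := step _ ih; push_cast; rwa [← add_assoc]
    exact fun m => (this (m - n).toNat).mono (by omega)
  have z01 : J 0 1 = 0 := by ext k; exact hall (k + 1) k (by omega)
  have z00 : J 0 0 = 0 := by ext k; exact van00 _ (hall (k + 1)) k (by omega)
  ext1 i j
  fin_cases i <;> fin_cases j
  · exact z00
  · exact z01
  · simp [e10, z00, z01]
  · simp [hJt, z00]

theorem IsResolvent.coeffDerivation_entry01 (h : IsResolvent D u U) :
    coeffDerivation D (U 0 1) = -(2 * U 0 0) := by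
  have := congrFun (congrFun h.flow 0) 1
  simp [Matrix.mul_apply, Fin.sum_univ_two, h.traceless] at this
  rw [this]; ring

theorem IsResolvent.entry10 (h : IsResolvent D u U) :
    U 1 0 = coeffDerivation D (U 0 0) + (lam K - cst u) * U 0 1 := by
  have := congrFun (congrFun h.flow 0) 0
  simp [Matrix.mul_apply, Fin.sum_univ_two] at this
  rw [this]; ring

/-! ### Polynomial truncations of `λⁿ U` and their tails -/

section Truncation

omit [Algebra ℂ K]

/-- The matrix `𝒰_{2n+1}` as a Laurent matrix: the polynomial part of `λⁿ U`, corrected by its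
coefficient of `1/λ` in the upper right corner. -/
def truncU (U : LMat K) (n : ℕ) : LMat K :=
  (lam K ^ n • U).map plusPart - cst ((U 0 1).coeff (n + 1)) • E21 K

/-- The complement of `truncU U n` in `λⁿ U`. -/
def tailU (U : LMat K) (n : ℕ) : LMat K := lam K ^ n • U - truncU U n

theorem truncU_traceless (hU : U 1 1 = -U 0 0) (n : ℕ) :
    truncU U n 1 1 = -truncU U n 0 0 := by
  simp [truncU, hU, plusPart_neg]

theorem tailU_traceless (hU : U 1 1 = -U 0 0) (n : ℕ) :
    tailU U n 1 1 = -tailU U n 0 0 := by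
  simp only [tailU, Matrix.sub_apply, truncU_traceless hU, Matrix.smul_apply, hU, smul_eq_mul]
  ring

theorem isPoly_truncU (U : LMat K) (n : ℕ) (i j : Fin 2) : IsPoly (truncU U n i j) := by
  refine (isPoly_plusPart _).sub (IsPoly.mul (isPoly_cst _) ?_)
  fin_cases i <;> fin_cases j
  exacts [isPoly_zero, isPoly_zero, isPoly_one, isPoly_zero]

theorem vanishBelow_tailU {i j : Fin 2} (hij : ¬(i = 1 ∧ j = 0)) (U : LMat K) (n : ℕ) :
    VanishBelow (tailU U n i j) 1 := by
  have h0 : E21 K i j = 0 := by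
    fin_cases i <;> fin_cases j <;> simp_all
  simp only [tailU, truncU, Matrix.sub_apply, Matrix.smul_apply, h0, smul_zero, sub_zero,
    Matrix.map_apply]
  exact vanishBelow_sub_plusPart _

/-- The correction subtracted in `truncU` reappears as the constant term of the tail; it is the only
nonnegative power of `λ` in the tail. -/
theorem vanishBelow_tailU10 (U : LMat K) (n : ℕ) :
    VanishBelow (tailU U n 1 0 - cst ((U 0 1).coeff (n + 1))) 1 := by
  have : tailU U n 1 0 - cst ((U 0 1).coeff (n + 1)) =
      lam K ^ n * U 1 0 - plusPart (lam K ^ n * U 1 0) := by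
    simp [tailU, truncU]
    ring
  rw [this]
  exact vanishBelow_sub_plusPart _

theorem coeff_tailU10 (U : LMat K) (n : ℕ) :
    (tailU U n 1 0).coeff 0 = (U 0 1).coeff (n + 1) := by
  have := vanishBelow_tailU10 U n 0 one_pos
  rw [HahnSeries.coeff_sub, cst_apply, HahnSeries.coeff_single_same, sub_eq_zero] at this
  exact this

theorem coeff_tailU {i j : Fin 2} (hij : ¬(i = 1 ∧ j = 0)) (U : LMat K) (n : ℕ) :
    (tailU U n i j).coeff 1 = (U i j).coeff (n + 1) := by
  have h0 : E21 K i j = 0 := by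
    fin_cases i <;> fin_cases j <;> simp_all
  simp only [tailU, truncU, Matrix.sub_apply, Matrix.smul_apply, h0, Matrix.map_apply,
    smul_eq_mul, HahnSeries.coeff_sub]
  rw [isPoly_plusPart _ _ one_pos, coeff_lam_pow_mul, mul_zero, HahnSeries.coeff_zero, sub_zero,
    sub_zero, add_comm]

theorem vanishBelow_tailU10_zero (U : LMat K) (n : ℕ) : VanishBelow (tailU U n 1 0) 0 := by
  have := ((vanishBelow_tailU10 U n).mono zero_le_one).add
    (vanishBelow_cst ((U 0 1).coeff (n + 1)))
  rwa [sub_add_cancel] at this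

theorem shear_tailU (U : LMat K) (n : ℕ) : Shear (-1) (tailU U n) :=
  shear_of_entries ((vanishBelow_tailU (by decide) U n).mono (by norm_num))
    ((vanishBelow_tailU (by decide) U n).mono (by norm_num))
    ((vanishBelow_tailU10_zero U n).mono (by norm_num))
    ((vanishBelow_tailU (by decide) U n).mono (by norm_num))

theorem isPoly_schroedinger (u : K) (i j : Fin 2) : IsPoly (schroedinger u i j) := by
  fin_cases i <;> fin_cases j
  exacts [isPoly_zero, isPoly_one, isPoly_lam.sub (isPoly_cst u), isPoly_zero]

theorem isPoly_mul {M N : LMat K} (hM : ∀ i j, IsPoly (M i j)) (hN : ∀ i j, IsPoly (N i j))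
    (i j : Fin 2) : IsPoly ((M * N) i j) := by
  rw [Matrix.mul_apply]
  exact IsPoly.sum fun l _ => (hM i l).mul (hN l j)

/-- In the lower left entry the correction changes the constant term `R₁ - u` into `-u`, so that
`𝒰₁` is the Schrödinger matrix. -/
theorem IsSpectral.truncU_zero (h : IsSpectral U) (hu : (U 1 0).coeff 0 = (U 0 1).coeff 1 - u) :
    truncU U 0 = schroedinger u := by
  apply lmat_ext
  · simp [truncU]
    ext k
    rw [coeff_plusPart]
    split_ifs with hk
    exacts [h.vanish00 k (by omega), rfl]
  · simp [truncU]
    ext k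
    rw [coeff_plusPart, ← map_one cst, coeff_cst]
    rcases lt_trichotomy k 0 with hk | rfl | hk
    · rw [if_pos hk.le, if_neg hk.ne, h.vanish01 k hk]
    · simp [h.coeff01]
    · rw [if_neg (by omega), if_neg hk.ne']
  · simp [truncU]
    ext k
    rw [HahnSeries.coeff_sub, HahnSeries.coeff_sub, coeff_plusPart, coeff_cst, coeff_cst, lam]
    rcases lt_trichotomy k 0 with hk | rfl | hk
    · rw [if_pos hk.le, if_neg hk.ne, if_neg hk.ne, HahnSeries.coeff_single]
      split_ifs with h1
      · rw [h1, h.coeff10]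
      · rw [h.vanish10 k (by omega)]
    · simp [hu]
    · rw [if_neg (by omega), if_neg hk.ne', if_neg hk.ne',
        HahnSeries.coeff_single_of_ne (by omega)]
  · simp [truncU, h.traceless, plusPart_neg]
    ext k
    rw [coeff_plusPart]
    split_ifs with hk
    exacts [h.vanish00 k (by omega), rfl]

end Truncation

/-- The zero curvature equations of the KdV hierarchy, up to the equation of motion. -/
theorem IsResolvent.flow_truncU (h : IsResolvent D u U) (n : ℕ) :
    (coeffDerivation D).mapMatrix (truncU U n) =
      schroedinger u * truncU U n - truncU U n * schroedinger u
        - cst (2 * D ((U 0 1).coeff (n + 1))) • E21 K := by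
  set V := truncU U n with hV
  set T := tailU U n with hT
  set b := (U 0 1).coeff (n + 1) with hb
  have hVT : V = lam K ^ n • U - T := by rw [hT, tailU]; abel
  -- `λⁿ U` satisfies the flow exactly, so the defect of its polynomial part is minus the defect of
  -- its tail. The left side is polynomial and the right side has few nonnegative powers: only
  -- finitely many low coefficients have to be compared.
  have e1 : (coeffDerivation D).mapMatrix V - (schroedinger u * V - V * schroedinger u) =
      schroedinger u * T - T * schroedinger u - (coeffDerivation D).mapMatrix T := by
    rw [hVT, map_sub, mapMatrix_smul (isLeibniz_coeffDerivation D), h.flow,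
      coeffDerivation_lam_pow]
    simp only [zero_smul, add_zero, mul_sub, sub_mul, smul_sub, mul_smul_comm, smul_mul_assoc]
    abel
  have hTt : T 1 1 = -T 0 0 := tailU_traceless h.traceless n
  have v00 : VanishBelow (T 0 0) 1 := vanishBelow_tailU (by decide) U n
  have v01 : VanishBelow (T 0 1) 1 := vanishBelow_tailU (by decide) U n
  have v10 : VanishBelow (T 1 0) 0 := vanishBelow_tailU10_zero U n
  have c00 : 2 * (T 0 0).coeff 1 = -D b := by
    rw [hT, coeff_tailU (by decide), hb, ← coeff_coeffDerivation, h.coeffDerivation_entry01]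
    simp [coeff_two_mul]
  have c01 : (T 0 1).coeff 1 = b := coeff_tailU (by decide) U n
  have c10 : (T 1 0).coeff 0 = b := coeff_tailU10 U n
  have e2 : (coeffDerivation D).mapMatrix V - (schroedinger u * V - V * schroedinger u)
      + cst (2 * D b) • E21 K = 0 := by
    have hpoly : ∀ i j, IsPoly (((coeffDerivation D).mapMatrix V
        - (schroedinger u * V - V * schroedinger u) + cst (2 * D b) • E21 K) i j) := by
      intro i j
      have hVp := isPoly_truncU U n
      have hSp := isPoly_schroedinger u
      refine (((hVp i j).coeffDerivation D).sub
        ((isPoly_mul hSp hVp i j).sub (isPoly_mul hVp hSp i j))).add ((isPoly_cst _).mul ?_)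
      fin_cases i <;> fin_cases j
      exacts [isPoly_zero, isPoly_zero, isPoly_one, isPoly_zero]
    ext1 i j
    refine (hpoly i j).eq_zero ?_
    rw [e1]
    -- The constant terms of `T₂₁` and `λ T₁₂` are both `R_{2n+1}`; this cancellation is the purpose
    -- of the correction in `truncU`.
    have key00 : VanishBelow (T 1 0 - T 0 1 * (lam K - cst u)
        - coeffDerivation D (T 0 0)) 1 := by
      have hv : VanishBelow (T 1 0 - lam K * T 0 1) 0 :=
        v10.sub ((vanishBelow_lam.mul v01).mono (by norm_num))
      have hv1 := hv.succ (by
        rw [HahnSeries.coeff_sub, coeff_lam_mul, zero_add, c01, c10, sub_self])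
      have e : T 1 0 - T 0 1 * (lam K - cst u) - coeffDerivation D (T 0 0) =
        (T 1 0 - lam K * T 0 1) + (cst u * T 0 1 - coeffDerivation D (T 0 0)) := by
        ring
      rw [e]
      exact hv1.add ((v01.cst_mul u).sub (v00.coeffDerivation D))
    fin_cases i <;> fin_cases j
    · simpa [Matrix.mul_apply, Fin.sum_univ_two] using key00
    · simp [Matrix.mul_apply, Fin.sum_univ_two, hTt]
      exact (v00.neg.sub v00).sub (v01.coeffDerivation D)
    · simp [Matrix.mul_apply, Fin.sum_univ_two, hTt]
      have e : (lam K - cst u) * T 0 0 + T 0 0 * (lam K - cst u)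
          - coeffDerivation D (T 1 0) + cst 2 * cst (D b) =
        (lam K * T 0 0 + lam K * T 0 0 - coeffDerivation D (T 1 0)
          + cst 2 * cst (D b)) - (cst u * T 0 0
            + cst u * T 0 0) := by ring
      have hv : VanishBelow (lam K * T 0 0) 0 := (vanishBelow_lam.mul v00).mono (by norm_num)
      have hv' := ((hv.add hv).sub (v10.coeffDerivation D)).add
        ((vanishBelow_cst (D b)).cst_mul 2)
      -- At order zero the contributions are `-D b` from `2 λ T₁₁`, `-D b` from `-D T₂₁`, and the
      -- added `2 D b`.
      have hv1 := hv'.succ (by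
        simp only [HahnSeries.coeff_add, HahnSeries.coeff_sub, coeff_lam_mul, zero_add,
          coeff_coeffDerivation, c10, coeff_cst_mul]
        rw [cst_apply, HahnSeries.coeff_single_same]
        linear_combination c00)
      rw [e]
      exact hv1.sub ((v00.cst_mul u).add (v00.cst_mul u))
    · have := key00.neg
      simp [Matrix.mul_apply, Fin.sum_univ_two, hTt]
      convert this using 1
      ring
  rw [← sub_eq_zero, ← e2]
  abel

theorem coeffDerivation_schroedinger (E : Derivation ℂ K K) (u : K) :
    (coeffDerivation E).mapMatrix (schroedinger u) = -(cst (E u) • E21 K) := by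
  have h1 : coeffDerivation E (1 : LaurentSeries K) = 0 := by
    rw [← map_one cst, coeffDerivation_cst]; simp
  apply lmat_ext <;> simp [coeffDerivation_lam, coeffDerivation_cst, h1]

/-- If the potential moves along the `n`-th KdV flow, so does the resolvent matrix. -/
theorem IsResolvent.flow_of_kdv (h : IsResolvent D u U) (n : ℕ) {E : Derivation ℂ K K}
    (hDE : ∀ a, D (E a) = E (D a)) (hE : E u = 2 * D ((U 0 1).coeff (n + 1))) :
    (coeffDerivation E).mapMatrix U = truncU U n * U - U * truncU U n := by
  set V := truncU U n
  set S := schroedinger u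
  set d := (coeffDerivation D).mapMatrix (m := Fin 2) (n := Fin 2) with hd
  set e := (coeffDerivation E).mapMatrix (m := Fin 2) (n := Fin 2) with he
  have hde : ∀ M, d (e M) = e (d M) := fun M => by
    ext1 i j; exact coeffDerivation_comm hDE _
  have dmul : ∀ M N, d (M * N) = M * d N + d M * N := mapMatrix_mul (isLeibniz_coeffDerivation D)
  have emul : ∀ M N, e (M * N) = M * e N + e M * N := mapMatrix_mul (isLeibniz_coeffDerivation E)
  -- The KdV equation for `u` says precisely that the defect of `𝒰_{2n+1}` is the `E`-derivative of
  -- the Schrödinger matrix. With the Jacobi identity, `e U - [V, U]` then solves the linearized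
  -- resolvent equation.
  have hdV : d V = S * V - V * S + e S := by
    rw [hd, h.flow_truncU n, he, coeffDerivation_schroedinger, hE, sub_eq_add_neg]
  have hdU : d U = S * U - U * S := h.flow
  rw [← sub_eq_zero]
  refine h.eq_zero_of_linearized ?_ ?_ ?_
  · rw [traceless_iff, Matrix.trace_sub, trace_commutator, he, trace_mapMatrix,
      traceless_iff.mp h.traceless, map_zero, sub_zero]
  · change d _ = S * _ - _ * S
    rw [map_sub, map_sub, hde, hdU, dmul, dmul, map_sub, emul, emul, hdU, hdV]
    noncomm_ring
  · have h1 : (e (U * U)).trace = 0 := by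
      rw [h.sq, he, trace_mapMatrix, Matrix.trace_smul, Matrix.trace_one]
      simp [isLeibniz_coeffDerivation E _ _, coeffDerivation_lam]
      rw [← map_ofNat cst, coeffDerivation_cst, ← Nat.cast_ofNat, E.map_natCast]; simp
    rw [emul, Matrix.trace_add, Matrix.trace_mul_comm (e U)] at h1
    have h2 : (U * (V * U - U * V)).trace = 0 := by
      rw [mul_sub, Matrix.trace_sub, ← mul_assoc, Matrix.trace_mul_comm (U * V), sub_self]
    rw [mul_sub, Matrix.trace_sub, h2, sub_zero]
    refine laurent_eq_of_two_mul ?_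
    linear_combination h1

end Resolvent

/-! ### The Lax matrix of the string equation -/

section StringLax

variable {K : Type*} [CommRing K] [Algebra ℂ K] {D : Derivation ℂ K K} {u : K} {U : LMat K}

/-- The Lax matrix `∑_{l=1}^{g+1} c_{2l-1} 𝒰_{2l-1}` as a Laurent matrix. -/
def laxOf (U : LMat K) (c : ℕ → K) (g : ℕ) : LMat K :=
  ∑ l ∈ Finset.range (g + 1), cst (c (l + 1)) • truncU U l

/-- The series `∑_{l=0}^{g+1} c_{2l-1} λ^{l-1}`. -/
def timeSeries (c : ℕ → K) (g : ℕ) : LaurentSeries K :=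
  ∑ l ∈ Finset.range (g + 1), cst (c (l + 1)) * lam K ^ l + cst (c 0) * lamInv K

section Algebraic

omit [Algebra ℂ K]

theorem timeSeries_smul_sub_laxOf (U : LMat K) (c : ℕ → K) (g : ℕ) :
    timeSeries c g • U - laxOf U c g =
      ∑ l ∈ Finset.range (g + 1), cst (c (l + 1)) • tailU U l + (cst (c 0) * lamInv K) • U := by
  simp only [timeSeries, laxOf, tailU, smul_sub, Finset.sum_sub_distrib, add_smul, Finset.sum_smul,
    smul_smul]
  abel

theorem laxOf_traceless (hU : U 1 1 = -U 0 0) (c : ℕ → K) (g : ℕ) :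
    laxOf U c g 1 1 = -laxOf U c g 0 0 := by
  simp [laxOf, Matrix.sum_apply, truncU_traceless hU]

theorem isPoly_laxOf (U : LMat K) (c : ℕ → K) (g : ℕ) (i j : Fin 2) :
    IsPoly (laxOf U c g i j) := by
  rw [laxOf, Matrix.sum_apply]
  exact IsPoly.sum fun l _ => (isPoly_cst _).mul (isPoly_truncU U l i j)

theorem vanishBelow_timeSeries (c : ℕ → K) (g : ℕ) : VanishBelow (timeSeries c g) (-g) := by
  refine VanishBelow.add (VanishBelow.sum fun l hl => ?_) ?_
  · rw [lam_pow]
    exact ((vanishBelow_single _ _).cst_mul _).mono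
      (by have := Finset.mem_range.mp hl; omega)
  · exact (vanishBelow_lamInv.cst_mul _).mono (by omega)

end Algebraic

variable {c : ℕ → K} {g : ℕ}

omit [Algebra ℂ K] in
/-- The consequence of the string equation: the Lax matrix agrees with `∑ c_{2l-1} λ^{l-1} U` up to
an error of low order. -/
theorem IsSpectral.shear_of_string (h : IsSpectral U)
    (hstring : ∑ l ∈ Finset.range (g + 2), c l * (U 0 1).coeff l = 0) :
    Shear (-2) (timeSeries c g • U - laxOf U c g) := by
  rw [timeSeries_smul_sub_laxOf]
  rw [Finset.sum_range_succ'] at hstring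
  rw [Nat.cast_zero, h.coeff01, mul_one] at hstring
  have vt : ∀ {i j : Fin 2}, ¬(i = 1 ∧ j = 0) →
      VanishBelow (∑ l ∈ Finset.range (g + 1), cst (c (l + 1)) * tailU U l i j) 1 :=
    fun hij => VanishBelow.sum fun l _ => (vanishBelow_tailU hij U l).cst_mul _
  have vw : ∀ {i j : Fin 2} {n : ℤ}, VanishBelow (U i j) n →
      VanishBelow (cst (c 0) * lamInv K * U i j) (1 + n) := fun hn => by
    rw [mul_assoc]
    exact (vanishBelow_lamInv.mul hn).cst_mul _
  have v10 : VanishBelow (∑ l ∈ Finset.range (g + 1), cst (c (l + 1)) * tailU U l 1 0) 0 :=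
    VanishBelow.sum fun l _ => (vanishBelow_tailU10_zero U l).cst_mul _
  have hentry : ∀ i j, (∑ l ∈ Finset.range (g + 1), cst (c (l + 1)) • tailU U l
      + (cst (c 0) * lamInv K) • U) i j = ∑ l ∈ Finset.range (g + 1),
      cst (c (l + 1)) * tailU U l i j + cst (c 0) * lamInv K * U i j := fun i j => by
    simp [Matrix.sum_apply]
  refine shear_of_entries ?_ ?_ ?_ ?_ <;> rw [hentry]
  · exact ((vt (by decide)).add ((vw h.vanish00).mono (by norm_num))).mono (by norm_num)
  -- The coefficient of `1/λ` is the string expression: the tails give `∑ c_{2l-1} R_{2l-1}` for `l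
  -- ≥ 1`, and `c_{-1}/λ` times the leading `1` of `U₁₂` gives the remaining term.
  · refine VanishBelow.succ (n := 1)
      ((vt (by decide)).add ((vw h.vanish01).mono (by norm_num))) ?_
    rw [HahnSeries.coeff_add, HahnSeries.coeff_sum, mul_assoc, coeff_cst_mul, coeff_lamInv_mul,
      sub_self, h.coeff01, mul_one, ← hstring]
    congr 1
    refine Finset.sum_congr rfl fun l _ => ?_
    rw [coeff_cst_mul, coeff_tailU (by decide)]
    push_cast
    rfl
  -- The same sum occurs as the constant term, now through the constant terms of the tails and the
  -- leading coefficient of `U₂₁`.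
  · refine VanishBelow.succ (n := 0) (v10.add ((vw h.vanish10).mono (by norm_num))) ?_
    rw [HahnSeries.coeff_add, HahnSeries.coeff_sum, mul_assoc, coeff_cst_mul, coeff_lamInv_mul,
      zero_sub, h.coeff10, mul_one, ← hstring]
    congr 1
    refine Finset.sum_congr rfl fun l _ => ?_
    rw [coeff_cst_mul, coeff_tailU10]
    push_cast
    rfl
  · rw [h.traceless]
    exact ((vt (by decide)).add (by
      rw [mul_neg]; exact ((vw h.vanish00).mono (by norm_num)).neg)).mono (by norm_num)

variable (h : IsResolvent D u U)
include h

/-- The spectral curve of the Lax matrix. -/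
theorem IsResolvent.det_laxOf
    (hstring : ∑ l ∈ Finset.range (g + 2), c l * (U 0 1).coeff l = 0) :
    VanishBelow (-(lam K * (laxOf U c g).det) - (lam K * timeSeries c g) ^ 2) (-g) := by
  set L := laxOf U c g
  set Y := timeSeries c g
  set N := Y • U - L with hN
  have hNs : Shear (-2) N := h.shear_of_string hstring
  have hL : L = Y • U - N := by rw [hN]; abel
  have hYv : VanishBelow Y (-g) := vanishBelow_timeSeries c g
  have h1 := trace_mul_self_eq (laxOf_traceless h.traceless c g)
  have h2 : (L * L).trace = 2 * lam K * Y ^ 2 - 2 * Y * (U * N).trace + (N * N).trace := by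
    rw [hL]
    have : (Y • U - N) * (Y • U - N) = (Y * Y) • (U * U) - Y • (U * N + N * U) + N * N := by
      simp only [mul_sub, sub_mul, smul_mul_assoc, mul_smul_comm, smul_smul, smul_add, smul_sub]
      abel
    rw [this, h.sq]
    simp only [Matrix.trace_add, Matrix.trace_sub, Matrix.trace_smul, Matrix.trace_mul_comm N U,
      Matrix.trace_one, smul_eq_mul]
    simp
    ring
  -- With `L = Y U - N` and `U² = λ`, the main part `λ² Y²` cancels. What remains is linear or
  -- quadratic in the small error `N`.
  have h3 : 2 * (-(lam K * L.det) - (lam K * Y) ^ 2) =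
      lam K * (N * N).trace - 2 * (lam K * Y * (U * N).trace) := by
    rw [h1] at h2
    linear_combination (lam K) * h2
  refine VanishBelow.of_two_mul ?_
  rw [h3]
  have v1 : VanishBelow (U * N).trace 1 := (h.shear.mul hNs).trace.mono (by norm_num)
  have v2 : VanishBelow (N * N).trace 2 := (hNs.mul hNs).trace.mono (by norm_num)
  refine ((vanishBelow_lam.mul v2).mono (by omega)).sub ?_
  rw [two_mul]
  have v3 := ((vanishBelow_lam.mul hYv).mul v1).mono (m := -g) (by omega)
  exact v3.add v3

/-- The zero curvature equation in the direction `x`. -/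
theorem IsResolvent.flow_laxOf
    (hstring : ∑ l ∈ Finset.range (g + 2), c l * (U 0 1).coeff l = 0)
    (hc0 : 2 * D (c 0) = 1) (hc : ∀ l, D (c (l + 1)) = 0) :
    (coeffDerivation D).mapMatrix (laxOf U c g) =
      schroedinger u * laxOf U c g - laxOf U c g * schroedinger u + E21 K := by
  -- Differentiating the string equation in `x`, where `c_{-1} = x/2`, gives the total defect of the
  -- KdV flows of the `𝒰_{2l-1}`; it is the source of the term `E21`.
  have h1 : ∑ l ∈ Finset.range (g + 1), c (l + 1) * (2 * D ((U 0 1).coeff (l + 1 : ℕ))) = -1 := by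
    have := congrArg D hstring
    rw [Finset.sum_range_succ', map_add, map_sum, Nat.cast_zero, h.coeff01, mul_one, map_zero,
      Finset.sum_congr rfl (g := fun l => c (l + 1) * D ((U 0 1).coeff (l + 1 : ℕ)))
        (fun l _ => by simp [hc])] at this
    have e : ∑ l ∈ Finset.range (g + 1), c (l + 1) * (2 * D ((U 0 1).coeff (l + 1 : ℕ))) =
        2 * ∑ l ∈ Finset.range (g + 1), c (l + 1) * D ((U 0 1).coeff (l + 1 : ℕ)) := by
      rw [Finset.mul_sum]
      exact Finset.sum_congr rfl fun l _ => by ring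
    rw [e]
    linear_combination 2 * this - hc0
  have h2 : ∑ l ∈ Finset.range (g + 1),
      cst (c (l + 1)) • (cst (2 * D ((U 0 1).coeff (l + 1))) • E21 K) = -E21 K := by
    simp only [smul_smul, ← map_mul, ← Finset.sum_smul, ← map_sum]
    push_cast at h1
    rw [h1]
    simp
  simp only [laxOf, map_sum, mapMatrix_smul (isLeibniz_coeffDerivation D), h.flow_truncU,
    coeffDerivation_cst, hc, map_zero, zero_smul, add_zero, smul_sub, Finset.sum_sub_distrib, h2,
    Finset.mul_sum, Finset.sum_mul, smul_mul_assoc, mul_smul_comm]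
  abel

/-- The relation between the derivative of the resolvent matrix in `λ` and the string equation. -/
theorem IsResolvent.lambda_flow {N : LMat K} {w : LaurentSeries K}
    (hw : 2 * lam K * w = 1) (hDw : coeffDerivation D w = 0)
    (hN : (coeffDerivation D).mapMatrix N =
      schroedinger u * N - N * schroedinger u + w • U - E21 K) :
    N * U - U * N + (lambdaDerivation K).mapMatrix U - w • U = 0 := by
  set S := schroedinger u
  set d := (coeffDerivation D).mapMatrix (m := Fin 2) (n := Fin 2) with hd
  set e := (lambdaDerivation K).mapMatrix (m := Fin 2) (n := Fin 2) with he
  have hde : ∀ M, d (e M) = e (d M) := fun M => by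
    ext1 i j; exact coeffDerivation_lambdaDerivation D _
  have dmul : ∀ M N, d (M * N) = M * d N + d M * N := mapMatrix_mul (isLeibniz_coeffDerivation D)
  have emul : ∀ M N, e (M * N) = M * e N + e M * N := mapMatrix_mul isLeibniz_lambdaDerivation
  have hdU : d U = S * U - U * S := h.flow
  -- `∂_λ` of the Schrödinger matrix is `E21`; this cancels the inhomogeneous term in the flow of
  -- `N`, so that the expression solves the linearized equation.
  have heS : e S = E21 K := by
    have h1 : lambdaDerivation K (1 : LaurentSeries K) = 0 := by
      rw [← map_one cst, lambdaDerivation_cst]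
    apply lmat_ext <;> simp [S, e, lambdaDerivation_lam, lambdaDerivation_cst, h1]
  refine h.eq_zero_of_linearized ?_ ?_ ?_
  · rw [traceless_iff, Matrix.trace_sub, Matrix.trace_add, trace_commutator, he, trace_mapMatrix,
      Matrix.trace_smul, traceless_iff.mp h.traceless, map_zero, smul_zero, sub_zero, add_zero]
  · change d _ = S * _ - _ * S
    rw [map_sub, map_add, map_sub, hde, hdU, dmul, dmul, map_sub, emul, emul, hdU, hN, heS,
      mapMatrix_smul (isLeibniz_coeffDerivation D), h.flow, hDw]
    simp only [zero_smul, add_zero, mul_sub, sub_mul, mul_add, add_mul, smul_mul_assoc,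
      mul_smul_comm, smul_sub]
    noncomm_ring
  · have h1 : (e (U * U)).trace = 2 := by
      rw [h.sq, he, trace_mapMatrix, Matrix.trace_smul, Matrix.trace_one]
      rw [smul_eq_mul, isLeibniz_lambdaDerivation, lambdaDerivation_lam]
      simp
      rw [← map_ofNat cst, lambdaDerivation_cst]; simp
    rw [emul, Matrix.trace_add, Matrix.trace_mul_comm (e U)] at h1
    have h2 : (U * (N * U - U * N)).trace = 0 := by
      rw [mul_sub, Matrix.trace_sub, ← mul_assoc, Matrix.trace_mul_comm (U * N), sub_self]
    rw [mul_sub, mul_add, Matrix.trace_sub, Matrix.trace_add, h2, mul_smul_comm, h.sq]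
    refine laurent_eq_of_two_mul ?_
    simp
    linear_combination h1 - 2 * hw

/-- The zero curvature equations of the Lax matrix in all directions. -/
theorem IsResolvent.zero_curvature_laxOf {n : ℕ} {E : Derivation ℂ K K}
    (hstring : ∑ l ∈ Finset.range (g + 2), c l * (U 0 1).coeff l = 0)
    (hc0 : 2 * D (c 0) = 1) (hc : ∀ l, D (c (l + 1)) = 0)
    (hDE : ∀ a, D (E a) = E (D a)) (hE : E u = 2 * D ((U 0 1).coeff (n + 1)))
    (hEc : 2 * lam K * coeffDerivation E (timeSeries c g) = (2 * n + 1) * lam K ^ n) :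
    (coeffDerivation E).mapMatrix (laxOf U c g) - (lambdaDerivation K).mapMatrix (truncU U n)
      + (laxOf U c g * truncU U n - truncU U n * laxOf U c g) = 0 := by
  set L := laxOf U c g with hL
  set Y := timeSeries c g with hY
  set V := truncU U n
  set T := tailU U n with hT
  obtain ⟨N, hN⟩ : ∃ N, N = Y • U - L := ⟨_, rfl⟩
  set w := coeffDerivation D Y with hw
  set y := coeffDerivation E Y
  set S := schroedinger u
  set e := (coeffDerivation E).mapMatrix (m := Fin 2) (n := Fin 2) with he
  set p := (lambdaDerivation K).mapMatrix (m := Fin 2) (n := Fin 2) with hp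
  have emul : ∀ M N, e (M * N) = M * e N + e M * N := mapMatrix_mul (isLeibniz_coeffDerivation E)
  have pmul : ∀ M N, p (M * N) = M * p N + p M * N := mapMatrix_mul isLeibniz_lambdaDerivation
  have hep : ∀ M, e (p M) = p (e M) := fun M => by
    ext1 i j; exact coeffDerivation_lambdaDerivation E _
  have hwc : w = cst (D (c 0)) * lamInv K := by
    rw [hw, hY, timeSeries, map_add, map_sum, Finset.sum_eq_zero]
    · simp [isLeibniz_coeffDerivation D _ _, coeffDerivation_lamInv, coeffDerivation_cst]
      ring
    · intro l _
      simp [isLeibniz_coeffDerivation D _ _, coeffDerivation_lam_pow, coeffDerivation_cst, hc]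
  have hw2 : 2 * lam K * w = 1 := by
    rw [hwc]
    have : (2 : LaurentSeries K) * cst (D (c 0)) = 1 := by
      rw [← map_ofNat cst, ← map_mul, hc0, map_one]
    linear_combination (lam K * lamInv K) * this + lam_mul_lamInv (K := K)
  have hDc0 : D (D (c 0)) = 0 := by
    refine eq_zero_of_two_mul ?_
    have := congrArg D hc0
    rwa [two_mul, map_add, ← two_mul, D.map_one_eq_zero] at this
  have hDw : coeffDerivation D w = 0 := by
    rw [hwc, isLeibniz_coeffDerivation D, coeffDerivation_cst, coeffDerivation_lamInv, hDc0]
    simp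
  have hEw : coeffDerivation E w = 0 := by
    have h1 : E (D (c 0)) = 0 := by
      refine eq_zero_of_two_mul ?_
      have := congrArg E hc0
      rwa [two_mul, map_add, ← two_mul, E.map_one_eq_zero] at this
    rw [hwc, isLeibniz_coeffDerivation E, coeffDerivation_cst, coeffDerivation_lamInv, h1]
    simp
  have hNflow : (coeffDerivation D).mapMatrix N = S * N - N * S + w • U - E21 K := by
    rw [hN, map_sub, mapMatrix_smul (isLeibniz_coeffDerivation D), h.flow,
      h.flow_laxOf hstring hc0 hc]
    simp only [mul_sub, sub_mul, smul_mul_assoc, mul_smul_comm, smul_sub]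
    abel
  have hJ : N * U - U * N + p U - w • U = 0 := h.lambda_flow hw2 hDw hNflow
  have hU : e U = V * U - U * V := h.flow_of_kdv n hDE hE
  -- `Z` is minus the curvature, rewritten through the small error `N` instead of `L` so that its
  -- size can be estimated.
  obtain ⟨Z, hZ⟩ : ∃ Z, Z = e N - (V * N - N * V) - y • U + p V := ⟨_, rfl⟩
  have hZL : Z = -(e L - p V + (L * V - V * L)) := by
    rw [hZ, hN, map_sub, he, mapMatrix_smul (isLeibniz_coeffDerivation E), ← he, hU]
    simp only [mul_sub, sub_mul, smul_mul_assoc, mul_smul_comm, smul_sub]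
    abel
  suffices hZ0 : Z = 0 by rw [← neg_eq_zero, ← hZL, hZ0]
  have hZpoly : ∀ i j, IsPoly (Z i j) := by
    intro i j
    have hLp := isPoly_laxOf U c g
    have hVp := isPoly_truncU U n
    rw [hZL]
    exact ((((hLp i j).coeffDerivation E).sub (hVp i j).lambdaDerivation).add
      ((isPoly_mul hLp hVp i j).sub (isPoly_mul hVp hLp i j))).neg
  -- Compare the derivative along `E` of `∂_λ U - w U = [U, N]` with its commutator with `V`: the
  -- difference is `[Z, U]`.
  have hZcomm : Z * U = U * Z := by
    have h1 := congrArg e hJ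
    rw [map_sub, map_add, map_sub, emul, emul, hep, he,
      mapMatrix_smul (isLeibniz_coeffDerivation E), hEw, ← he, hU, map_sub, pmul, pmul, map_zero,
      zero_smul, add_zero] at h1
    have h2 : V * (N * U - U * N + p U - w • U) - (N * U - U * N + p U - w • U) * V = 0 := by
      rw [hJ]; simp
    rw [← sub_eq_zero, ← sub_eq_zero.mpr (h1.trans h2.symm), hZ]
    simp only [mul_sub, sub_mul, mul_add, add_mul, smul_mul_assoc, mul_smul_comm, smul_sub]
    noncomm_ring
  have hZt : Z 1 1 = -Z 0 0 := by
    have h1 := traceless_iff.mp (laxOf_traceless h.traceless c g)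
    have h2 := traceless_iff.mp (truncU_traceless h.traceless n)
    rw [traceless_iff, hZL, Matrix.trace_neg, Matrix.trace_add, trace_commutator, Matrix.trace_sub,
      he, hp, trace_mapMatrix, trace_mapMatrix, h1, h2, map_zero, map_zero, sub_self, add_zero,
      neg_zero]
  have hZU : (2 * lam K) • Z = (Z * U).trace • U := by
    have h1 := mul_add_mul_of_traceless hZt h.traceless
    rw [← hZcomm] at h1
    have h2 := congrArg (· * U) h1
    simp only [add_mul, mul_assoc, h.sq, smul_mul_assoc, one_mul, mul_smul_comm, mul_one] at h2
    rw [← h2, two_mul, add_smul]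
  have hVT : V = lam K ^ n • U - T := by rw [hT, tailU]; abel
  have htr2 : (U * U).trace = 2 * lam K := by
    rw [h.sq]; simp; ring
  -- The hypothesis `2 λ E(Y) = (2n + 1) λⁿ` cancels the part of nonnegative degree: the trace of `V
  -- U` contributes `2 λ^{n+1}`, whose image under `∂_λ - w` is `(2n + 1) λⁿ`.
  have htr : (Z * U).trace = (e N * U).trace + w * (T * U).trace
      - lambdaDerivation K (T * U).trace := by
    have a1 : ((V * N - N * V) * U).trace = (V * (N * U - U * N)).trace := by
      rw [sub_mul, mul_sub, Matrix.trace_sub, Matrix.trace_sub, mul_assoc V N U, mul_assoc N V U,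
        Matrix.trace_mul_comm N (V * U), mul_assoc V U N]
    have a2 : N * U - U * N = w • U - p U := by
      rw [← sub_eq_zero, ← hJ]
      abel
    have a3 : (p V * U).trace + (V * p U).trace = lambdaDerivation K (V * U).trace := by
      rw [← trace_mapMatrix, ← Matrix.trace_add, ← hp, pmul, add_comm]
    have a4 : (V * U).trace = 2 * lam K ^ (n + 1) - (T * U).trace := by
      rw [hVT, sub_mul, Matrix.trace_sub, smul_mul_assoc, Matrix.trace_smul, htr2, smul_eq_mul]
      ring
    have a5 : lambdaDerivation K (2 * lam K ^ (n + 1)) = 2 * ((n + 1) * lam K ^ n) := by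
      rw [two_mul, map_add, ← two_mul, lambdaDerivation_lam_pow]
    have b1 : (Z * U).trace = (e N * U).trace - (V * (w • U - p U)).trace - y * (2 * lam K)
        + (p V * U).trace := by
      rw [hZ, add_mul, sub_mul, sub_mul, Matrix.trace_add, Matrix.trace_sub, Matrix.trace_sub, a1,
        a2, smul_mul_assoc, Matrix.trace_smul, htr2, smul_eq_mul]
    have b2 : (V * (w • U - p U)).trace = w * (V * U).trace - (V * p U).trace := by
      rw [mul_sub, Matrix.trace_sub, mul_smul_comm, Matrix.trace_smul, smul_eq_mul]
    rw [a4, map_sub, a5] at a3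
    rw [b1, b2, a4]
    linear_combination a3 - hEc - lam K ^ n * hw2
  have hNs : Shear (-2) N := hN ▸ h.shear_of_string hstring
  have hTs : Shear (-1) T := shear_tailU U n
  have hwv : VanishBelow w 1 := by rw [hwc]; exact vanishBelow_lamInv.cst_mul _
  have vtr : VanishBelow (Z * U).trace 1 := by
    rw [htr]
    have t1 : VanishBelow (T * U).trace 0 := (hTs.mul h.shear).trace.mono (by norm_num)
    refine (VanishBelow.add ?_ ?_).sub (t1.lambdaDerivation.mono (by norm_num))
    · exact ((hNs.coeffDerivation E).mul h.shear).trace.mono (by norm_num)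
    · exact (hwv.mul t1).mono (by norm_num)
  ext1 i j
  refine (hZpoly i j).eq_zero (VanishBelow.of_two_mul ?_)
  have h1 : 2 * Z i j = lamInv K * ((Z * U).trace * U i j) := by
    have := congrFun (congrFun hZU i) j
    simp only [Matrix.smul_apply, smul_eq_mul] at this
    rw [← this]
    linear_combination (-2 * Z i j) * lam_mul_lamInv (K := K)
  rw [h1]
  have hUv : VanishBelow (U i j) (-1) := (h.shear i j).mono (by omega)
  exact (vanishBelow_lamInv.mul (vtr.mul hUv)).mono (by norm_num)

end StringLax

/-! ### The resolvent equation -/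

section ResolventEquation

open Finset.HasAntidiagonal in
/-- Four times the coefficient of `λ^{-l}` in `(1/4) (∂ₓ B)² + ((λ - u) B - (1/2) ∂ₓ² B) B`, where
`B = ∑ bₖ λ^{-k}` and `b'`, `b''` are the first two derivatives of `b`. -/
def resolventCoeff {K : Type*} [CommRing K] (u : K) (b b' b'' : ℕ → K) (l : ℕ) : K :=
  ∑ ij ∈ antidiagonal l, b' ij.1 * b' ij.2 + 4 * ∑ ij ∈ antidiagonal (l + 1), b ij.1 * b ij.2
    - 4 * (u * ∑ ij ∈ antidiagonal l, b ij.1 * b ij.2)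
    - 2 * ∑ ij ∈ antidiagonal l, b ij.1 * b'' ij.2

variable {K : Type*} [CommRing K] [Algebra ℂ K]

/-- `(∂ₓ B)² + 4 (λ - u) B² - 2 B ∂ₓ² B`. -/
def resolventSeries (D : Derivation ℂ K K) (u : K) (B : LaurentSeries K) : LaurentSeries K :=
  coeffDerivation D B * coeffDerivation D B + cst 4 * (lam K * (B * B))
    - cst 4 * (cst u * (B * B)) - cst 2 * (B * coeffDerivation D (coeffDerivation D B))

variable {D : Derivation ℂ K K} {u : K}

theorem coeff_resolventSeries {B : LaurentSeries K} (hB : VanishBelow B 0) (l : ℕ) :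
    (resolventSeries D u B).coeff l = resolventCoeff u (fun k => B.coeff k)
      (fun k => D (B.coeff k)) (fun k => D (D (B.coeff k))) l := by
  have hB' := hB.coeffDerivation D
  have hB'' := hB'.coeffDerivation D
  have h1 := hB'.coeff_mul_add_nat hB' l
  have h2 := hB.coeff_mul_add_nat hB (l + 1)
  have h3 := hB.coeff_mul_add_nat hB l
  have h4 := hB.coeff_mul_add_nat hB'' l
  simp only [zero_add, add_zero, coeff_coeffDerivation, Nat.cast_add, Nat.cast_one] at h1 h2 h3 h4
  simp only [resolventSeries, resolventCoeff, HahnSeries.coeff_add, HahnSeries.coeff_sub,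
    coeff_cst_mul, coeff_lam_mul, h1, h2, h3, h4]

/-- The resolvent matrix attached to a generating series `B`. -/
def resolventMatrix (D : Derivation ℂ K K) (u : K) (B : LaurentSeries K) : LMat K :=
  !![cst (algebraMap ℂ K (-(1 / 2))) * coeffDerivation D B, B;
    coeffDerivation D (cst (algebraMap ℂ K (-(1 / 2))) * coeffDerivation D B)
      + (lam K - cst u) * B, -(cst (algebraMap ℂ K (-(1 / 2))) * coeffDerivation D B)]

/-- The quadratic equation for `B` is `A² + B C = λ`, which gives `U² = λ`. The flow of `A` and `B`
holds by construction; that of `C` follows by differentiating the quadratic relation and dividing by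
`B`, whose leading coefficient is `1`. -/
theorem isResolvent_resolventMatrix {B : LaurentSeries K} (hB : VanishBelow B 0)
    (hB0 : B.coeff 0 = 1) (hQ : ∀ l : ℕ, resolventCoeff u (fun k => B.coeff k)
      (fun k => D (B.coeff k)) (fun k => D (D (B.coeff k))) l = 0) :
    IsResolvent D u (resolventMatrix D u B) := by
  obtain ⟨d, hd⟩ : ∃ d, d = coeffDerivation D := ⟨_, rfl⟩
  have dmul : IsLeibniz d := hd ▸ isLeibniz_coeffDerivation D
  obtain ⟨A, hA⟩ : ∃ A, A = cst (algebraMap ℂ K (-(1 / 2))) * d B := ⟨_, rfl⟩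
  obtain ⟨C, hC⟩ : ∃ C, C = d A + (lam K - cst u) * B := ⟨_, rfl⟩
  obtain ⟨U, hU⟩ : ∃ U, U = resolventMatrix D u B := ⟨_, rfl⟩
  have u00 : U 0 0 = A := by rw [hU, hA, hd]; rfl
  have u01 : U 0 1 = B := by rw [hU]; rfl
  have u10 : U 1 0 = C := by rw [hU, hC, hA, hd]; rfl
  have u11 : U 1 1 = -A := by rw [hU, hA, hd]; rfl
  have half : (2 : LaurentSeries K) * cst (algebraMap ℂ K (-(1 / 2))) = -1 := by
    rw [← map_ofNat cst, ← map_ofNat (algebraMap ℂ K), ← map_mul, ← map_mul]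
    norm_num
  have hA2 : 2 * A = -d B := by rw [hA]; linear_combination d B * half
  have dA2 : 2 * d A = -d (d B) := by rw [two_mul, ← map_add, ← two_mul, hA2, map_neg]
  have hdB : VanishBelow (d B) 1 := hd ▸ (hB.coeffDerivation D).succ (by simp [hB0])
  have hAv : VanishBelow A 1 := hA ▸ hdB.cst_mul _
  have hdA : VanishBelow (d A) 1 := hd ▸ hAv.coeffDerivation D
  have hddB : VanishBelow (d (d B)) 1 := hd ▸ (hd ▸ hdB : VanishBelow (coeffDerivation D B) 1).coeffDerivation D
  have hB1 : (B * B).coeff 0 = 1 := by simpa [hB0] using hB.coeff_mul hB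
  have hquad : A * A + B * C = lam K := by
    have h1 : resolventSeries D u B - 4 * lam K = 0 := by
      ext k
      rw [HahnSeries.coeff_sub, HahnSeries.coeff_zero]
      have e4 : (4 * lam K).coeff k = if k = -1 then 4 else 0 := by
        rw [← map_ofNat cst, coeff_cst_mul, lam, HahnSeries.coeff_single]
        split_ifs <;> simp
      have hBB : VanishBelow (B * B) 0 := hB.mul hB
      have hv1 : VanishBelow (d B * d B - cst 4 * (cst u * (B * B)) - cst 2 * (B * d (d B))) 0 :=
        (((hdB.mul hdB).mono (by norm_num)).sub ((hBB.cst_mul _).cst_mul _)).sub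
          (((hB.mul (hddB)).mono (by norm_num)).cst_mul _)
      have e : resolventSeries D u B = cst 4 * (lam K * (B * B))
          + (d B * d B - cst 4 * (cst u * (B * B)) - cst 2 * (B * d (d B))) := by
        rw [resolventSeries, ← hd]; ring
      rcases lt_trichotomy k (-1) with hk | rfl | hk
      · rw [e4, if_neg (by omega), e, HahnSeries.coeff_add, hv1 _ (by omega), coeff_cst_mul,
          coeff_lam_mul, hBB _ (by omega)]
        simp
      · rw [e4, if_pos rfl, e, HahnSeries.coeff_add, hv1 _ (by norm_num), coeff_cst_mul,
          coeff_lam_mul, neg_add_cancel, hB1]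
        simp
      · obtain ⟨l, rfl⟩ := Int.eq_ofNat_of_zero_le (show 0 ≤ k by omega)
        rw [e4, if_neg (by omega), coeff_resolventSeries hB, hQ, sub_zero]
    refine laurent_eq_of_two_mul (laurent_eq_of_two_mul ?_)
    rw [resolventSeries, ← hd] at h1
    simp only [map_ofNat] at h1
    rw [hC]
    linear_combination h1 + (2 * A - d B) * hA2 + 2 * B * dA2
  have hflow : d C = 2 * (lam K - cst u) * A := by
    have h1 := congrArg d hquad
    have hl : d (lam K) = 0 := hd ▸ coeffDerivation_lam D
    rw [map_add, dmul, dmul, hl] at h1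
    obtain ⟨B', hB', -, -⟩ := exists_inverse_of_leading hB hB0
    have h2 : B * (d C - 2 * (lam K - cst u) * A) = 0 := by
      have e1 : d B = -(2 * A) := by rw [hA2]; ring
      rw [e1] at h1
      linear_combination h1 + 2 * A * hC
    linear_combination B' * h2 - (d C - 2 * (lam K - cst u) * A) * hB'
  have hCv : VanishBelow C (-1) := by
    rw [hC, sub_mul]
    exact (hdA.mono (by norm_num)).add
      (((vanishBelow_lam.mul hB).mono (by norm_num)).sub ((hB.cst_mul u).mono (by norm_num)))
  rw [← hU]
  refine ⟨⟨by rw [u11, u00], ?_, u00 ▸ hAv, u01 ▸ hB, u10 ▸ hCv, u01 ▸ hB0, ?_⟩, ?_⟩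
  · apply lmat_ext <;> simp [Matrix.mul_apply, Fin.sum_univ_two, u00, u01, u10, u11]
    · exact hquad
    · ring
    · ring
    · rw [← hquad]; ring
  · rw [u10, hC, sub_mul, HahnSeries.coeff_add, HahnSeries.coeff_sub, coeff_lam_mul, coeff_cst_mul,
      hB (-1) (by norm_num), hdA _ (by norm_num), neg_add_cancel, hB0]
    simp
  · rw [← hd]
    apply lmat_ext <;> simp [Matrix.mul_apply, Fin.sum_univ_two, u00, u01, u10, u11]
    · rw [hC]; ring
    · linear_combination hA2
    · rw [hflow]; ring
    · rw [hC]; ring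

end ResolventEquation

/-! ### Rigidity of polynomial zero curvature equations -/

section Rigidity

variable {K : Type*} [CommRing K] [Algebra ℂ K]

/-- The constant `1/2`. -/
def halfSeries (K : Type*) [CommRing K] [Algebra ℂ K] : LaurentSeries K :=
  cst (algebraMap ℂ K (1 / 2))

theorem two_mul_halfSeries : 2 * halfSeries K = 1 := by
  rw [halfSeries, ← map_ofNat cst, ← map_ofNat (algebraMap ℂ K), ← map_mul, ← map_mul]
  norm_num

theorem VanishBelow.halfSeries_mul {f : LaurentSeries K} {n : ℤ} (hf : VanishBelow f n) :
    VanishBelow (halfSeries K * f) n := hf.cst_mul _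

theorem exists_sqrt_laurentSeries {f : LaurentSeries K} {m : ℤ} (hf : VanishBelow f (m + m))
    (h1 : f.coeff (m + m) = 1) :
    ∃ Y : LaurentSeries K, Y * Y = f ∧ VanishBelow Y m ∧ Y.coeff m = 1 := by
  obtain ⟨q, hq, hq1⟩ := exists_sqrt_powerSeries (algebraMap ℂ K (1 / 2))
    (by rw [← map_ofNat (algebraMap ℂ K), ← map_mul]; norm_num)
    (PowerSeries.mk fun k : ℕ => f.coeff (m + m + k))
    (by rw [← PowerSeries.coeff_zero_eq_constantCoeff_apply]; simp [h1])
  refine ⟨HahnSeries.single m 1 * HahnSeries.ofPowerSeries ℤ K q, ?_, ?_, ?_⟩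
  · rw [single_mul_ofPowerSeries_mul, ← sq, hq, ← hf.eq_single_mul]
  · simpa using (vanishBelow_ofPowerSeries q).single_mul m 1
  · have := coeff_ofPowerSeries q 0
    rw [PowerSeries.coeff_zero_eq_constantCoeff_apply, hq1] at this
    rw [HahnSeries.coeff_single_mul, sub_self, one_mul]
    exact_mod_cast this

/-- A Laurent series with vanishing square defect: if `a² - b²` is small and `a + b` has leading
coefficient `2`, then `a - b` is small. -/
theorem VanishBelow.sub_of_sq_sub {a b : LaurentSeries K} {m n : ℤ} (ha : VanishBelow a m)
    (hb : VanishBelow b m) (ha1 : a.coeff m = 1) (hb1 : b.coeff m = 1)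
    (h : VanishBelow (a ^ 2 - b ^ 2) (m + n)) : VanishBelow (a - b) n := by
  refine VanishBelow.of_mul_left (e := halfSeries K * (a + b)) (ha.add hb).halfSeries_mul ?_ ?_
  · rw [halfSeries, coeff_cst_mul, HahnSeries.coeff_add, ha1, hb1, ← map_one (algebraMap ℂ K),
      ← map_add, ← map_mul]
    norm_num
  · have : halfSeries K * (a + b) * (a - b) = halfSeries K * (a ^ 2 - b ^ 2) := by ring
    rw [this]
    exact h.halfSeries_mul

omit [Algebra ℂ K] in
theorem coeff_timeSeries_neg {c : ℕ → K} {g : ℕ} (hc : c (g + 1) = 1) :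
    (timeSeries c g).coeff (-g) = 1 := by
  rw [timeSeries, Finset.sum_range_succ, HahnSeries.coeff_add, HahnSeries.coeff_add,
    HahnSeries.coeff_sum, Finset.sum_eq_zero, hc]
  · rw [coeff_cst_mul, coeff_cst_mul, lamInv, HahnSeries.coeff_single_of_ne (by omega), lam_pow,
      HahnSeries.coeff_single_same]
    simp
  · intro l hl
    rw [coeff_cst_mul, lam_pow, HahnSeries.coeff_single_of_ne, mul_zero]
    have := Finset.mem_range.mp hl
    omega

/-- The matrix of an isomonodromic system, normalized and with prescribed spectral curve. -/
structure IsNormalLax (c : ℕ → K) (g : ℕ) (L : LMat K) : Prop where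
  isPoly : ∀ i j, IsPoly (L i j)
  traceless : L 1 1 = -L 0 0
  vanish00 : VanishBelow (L 0 0) (1 - g)
  vanish01 : VanishBelow (L 0 1) (-g)
  vanish10 : VanishBelow (L 1 0) (-g - 1)
  coeff01 : (L 0 1).coeff (-g) = 1
  coeff10 : (L 1 0).coeff (-g - 1) = 1
  det : VanishBelow (-(lam K * L.det) - (lam K * timeSeries c g) ^ 2) (-g)

variable {c : ℕ → K} {g : ℕ} {L : LMat K}

/-- `L` is traceless, so `L² = -det L`; normalization makes `-det L / λ` a series of even order with
leading coefficient `1`, which has a square root `Y`. Then `U = Y⁻¹ L`. -/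
theorem IsNormalLax.exists_isSpectral (h : IsNormalLax c g L) (hc : c (g + 1) = 1) :
    ∃ (Y : LaurentSeries K) (U : LMat K), L = Y • U ∧ IsSpectral U ∧ VanishBelow Y (-g) ∧
      Y.coeff (-g) = 1 ∧ VanishBelow (Y - timeSeries c g) 2 := by
  have v00 : VanishBelow (L 0 0 * L 0 0) (2 - 2 * g) :=
    (h.vanish00.mul h.vanish00).mono (by omega)
  have v01 : VanishBelow (L 0 1 * L 1 0) (-g + (-g - 1)) := h.vanish01.mul h.vanish10
  have hdet : -L.det = L 0 0 * L 0 0 + L 0 1 * L 1 0 := by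
    rw [Matrix.det_fin_two, h.traceless]; ring
  obtain ⟨Y, hY, hYv, hY1⟩ := exists_sqrt_laurentSeries (f := lamInv K * -L.det) (m := -g)
    (by
      rw [hdet]
      exact (vanishBelow_lamInv.mul ((v00.mono (by omega)).add v01)).mono (by omega))
    (by
      have e : -(g : ℤ) + -g - 1 = -g + (-g - 1) := by ring
      rw [coeff_lamInv_mul, hdet, HahnSeries.coeff_add, v00 _ (by omega), e,
        h.vanish01.coeff_mul h.vanish10, h.coeff01, h.coeff10]
      simp)
  obtain ⟨Z, hZ, hZv, hZ1⟩ := exists_inverse_of_leading hYv hY1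
  rw [neg_neg] at hZv hZ1
  have hLL : L * L = (-L.det) • 1 := by
    rw [hdet]
    apply lmat_ext <;> simp [Matrix.mul_apply, Fin.sum_univ_two, h.traceless] <;> ring
  refine ⟨Y, Z • L, ?_, ⟨?_, ?_, ?_, ?_, ?_, ?_, ?_⟩, hYv, hY1, ?_⟩
  · rw [smul_smul, hZ, one_smul]
  · simp [h.traceless]
  · rw [smul_mul_smul_comm, hLL, smul_smul]
    congr 1
    linear_combination (L.det * Z * Z) * lam_mul_lamInv (K := K) - lam K * Z * Z * hY
      + lam K * (Y * Z + 1) * hZ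
  · simpa using (hZv.mul h.vanish00).mono (n := g + (1 - g)) (m := 1) (by omega)
  · simpa using hZv.mul h.vanish01
  · simpa using (hZv.mul h.vanish10).mono (n := g + (-g - 1)) (m := -1) (by omega)
  · have := hZv.coeff_mul h.vanish01
    rw [hZ1, h.coeff01] at this
    simpa using this
  · have := hZv.coeff_mul h.vanish10
    rw [hZ1, h.coeff10, show (g : ℤ) + (-g - 1) = -1 by ring] at this
    simpa using this
  · have hsq : (lam K * Y) ^ 2 = -(lam K * L.det) := by
      linear_combination (lam K) ^ 2 * hY - (lam K * L.det) * lam_mul_lamInv (K := K)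
    -- The squares agree up to degree `g`, while the sum of the two series has degree `g + 1` with
    -- leading coefficient `2`; the difference therefore has degree at most `-1`.
    have hl : VanishBelow (lam K * Y - lam K * timeSeries c g) 1 := by
      refine VanishBelow.sub_of_sq_sub (m := -1 + -g) (vanishBelow_lam.mul hYv)
        (vanishBelow_lam.mul (vanishBelow_timeSeries c g)) ?_ ?_ ?_
      · rw [coeff_lam_mul, ← hY1]; congr 1; ring
      · rw [coeff_lam_mul, ← coeff_timeSeries_neg hc]; congr 1; ring
      · rw [hsq]
        exact h.det.mono (by omega)
    have e : Y - timeSeries c g = lamInv K * (lam K * Y - lam K * timeSeries c g) := by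
      linear_combination (timeSeries c g - Y) * lam_mul_lamInv (K := K)
    rw [e]
    exact vanishBelow_lamInv.mul hl

/-- The vanishing order of `f` when `(1 + 2 λ d/dλ) f` is small: the factors `2 n + 1` are units. -/
theorem vanishBelow_of_half_euler {f : LaurentSeries K} {n : ℤ}
    (h : VanishBelow (f + 2 * (lam K * lambdaDerivation K f)) n) : VanishBelow f n := by
  intro k hk
  have h1 := h k hk
  rw [HahnSeries.coeff_add, coeff_two_mul, coeff_lam_mul, coeff_lambdaDerivation,
    add_sub_cancel_right] at h1
  refine eq_zero_of_intCast_mul (n := 1 - 2 * k) (by omega) ?_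
  push_cast
  linear_combination h1

variable {Y : LaurentSeries K} {U V : LMat K} {E : Derivation ℂ K K} {n : ℕ}

omit [Algebra ℂ K] in
theorem trace_mul_of_sq {f : LaurentSeries K} (hU : U * U = f • 1)
    {δ : LaurentSeries K →+ LaurentSeries K} (hδ : IsLeibniz δ) :
    2 * (U * δ.mapMatrix U).trace = δ (2 * f) := by
  have h1 : (δ.mapMatrix (U * U)).trace = δ (2 * f) := by
    rw [hU, trace_mapMatrix, Matrix.trace_smul, Matrix.trace_one, smul_eq_mul, mul_comm]
    simp
  rw [← h1, mapMatrix_mul hδ, Matrix.trace_add, Matrix.trace_mul_comm (δ.mapMatrix U), two_mul]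

/-- The zero curvature equation, for a polynomial matrix of bounded degree, determines it. -/
theorem IsNormalLax.eq_truncU (h : IsNormalLax c g L) (hg : n < g)
    (hLU : L = Y • U) (hU : IsSpectral U) (hY : VanishBelow Y (-g)) (hY1 : Y.coeff (-g) = 1)
    (hYT : VanishBelow (Y - timeSeries c g) 2)
    (hV : ∀ i j, IsPoly (V i j)) (hVt : V 1 1 = -V 0 0)
    (hVd : ∀ i j, VanishBelow (V i j) (-g - 1))
    (hEc : 2 * lam K * coeffDerivation E (timeSeries c g) = (2 * n + 1) * lam K ^ n)
    (hflow : (coeffDerivation E).mapMatrix L - (lambdaDerivation K).mapMatrix V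
      + (L * V - V * L) = 0) : V = truncU U n := by
  obtain ⟨e, he⟩ : ∃ e, e = (coeffDerivation E).mapMatrix (m := Fin 2) (n := Fin 2) := ⟨_, rfl⟩
  obtain ⟨p, hp⟩ : ∃ p, p = (lambdaDerivation K).mapMatrix (m := Fin 2) (n := Fin 2) := ⟨_, rfl⟩
  rw [← he, ← hp] at hflow
  obtain ⟨Z, hZ, hZv, -⟩ := exists_inverse_of_leading hY hY1
  rw [neg_neg] at hZv
  have eU : (U * e U).trace = 0 := by
    refine laurent_eq_of_two_mul ?_
    rw [he, trace_mul_of_sq hU.sq (isLeibniz_coeffDerivation E), two_mul, map_add,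
      coeffDerivation_lam]
    simp
  have pU : (U * p U).trace = 1 := by
    refine laurent_eq_of_two_mul ?_
    rw [hp, trace_mul_of_sq hU.sq isLeibniz_lambdaDerivation, two_mul, map_add,
      lambdaDerivation_lam]
    ring
  have tUU : (U * U).trace = 2 * lam K := by
    rw [hU.sq, Matrix.trace_smul, Matrix.trace_one]; simp; ring
  have eL : e L = Y • e U + coeffDerivation E Y • U := by
    rw [hLU, he, mapMatrix_smul (isLeibniz_coeffDerivation E)]
  -- the component of `V` along `U`
  obtain ⟨ψ, hψ⟩ : ∃ ψ, ψ = halfSeries K * lamInv K * (U * V).trace := ⟨_, rfl⟩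
  have hψ2 : 2 * lam K * ψ = (U * V).trace := by
    rw [hψ]
    linear_combination (lam K * lamInv K * (U * V).trace) * two_mul_halfSeries (K := K)
      + (U * V).trace * lam_mul_lamInv (K := K)
  obtain ⟨P, hP⟩ : ∃ P, P = V - ψ • U := ⟨_, rfl⟩
  have hVP : V = ψ • U + P := by rw [hP]; abel
  have hPt : P 1 1 = -P 0 0 := by
    rw [traceless_iff, hP, Matrix.trace_sub, Matrix.trace_smul, traceless_iff.mp hVt,
      traceless_iff.mp hU.traceless]
    simp
  have hPU : P * U + U * P = 0 := by
    rw [mul_add_mul_of_traceless hPt hU.traceless, hP, sub_mul, Matrix.trace_sub,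
      smul_mul_assoc, Matrix.trace_smul, tUU, Matrix.trace_mul_comm, ← hψ2, smul_eq_mul]
    rw [show 2 * lam K * ψ - ψ * (2 * lam K) = 0 by ring, zero_smul]
  obtain ⟨Q, hQ⟩ : ∃ Q, Q = e L - p V := ⟨_, rfl⟩
  -- `ψ U` commutes with `L = Y U` and `P` anticommutes with `U`, so `[V, L] = 2 Y P U`. Multiplying
  -- by `U` and using `U² = λ` recovers `P`.
  have hPQ : P = (halfSeries K * lamInv K * Z) • (Q * U) := by
    have h1 : Q = (2 * Y) • (P * U) := by
      have h2 : Q = V * L - L * V := by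
        rw [hQ, ← sub_eq_zero, ← hflow]; abel
      have h3 : U * P = -(P * U) := by rw [eq_neg_iff_add_eq_zero, add_comm, hPU]
      rw [h2, hLU, hVP]
      simp only [add_mul, mul_add, smul_mul_assoc, mul_smul_comm, h3, smul_neg, smul_smul, smul_add]
      rw [two_mul, add_smul, mul_comm ψ Y]
      abel
    rw [h1, smul_mul_assoc, mul_assoc P U U, hU.sq, smul_smul, mul_smul_comm, mul_one, smul_smul]
    rw [show halfSeries K * lamInv K * Z * (2 * Y) * lam K = 1 by
      linear_combination (Z * Y * (lam K * lamInv K)) * two_mul_halfSeries (K := K)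
        + (Z * Y) * lam_mul_lamInv (K := K) + hZ, one_smul]
  have hfac : VanishBelow (halfSeries K * lamInv K * Z) (1 + g) := by
    rw [mul_assoc]; exact (vanishBelow_lamInv.mul hZv).halfSeries_mul
  have heL : Shear (2 * g - 1) (e L) := by
    rw [he]
    refine shear_of_entries ?_ ?_ ?_ ?_
    · exact (h.vanish00.coeffDerivation E).mono (by omega)
    · exact ((h.vanish01.coeffDerivation E).succ
        (by rw [coeff_coeffDerivation, h.coeff01, E.map_one_eq_zero])).mono (by omega)
    · exact ((h.vanish10.coeffDerivation E).succ
        (by rw [coeff_coeffDerivation, h.coeff10, E.map_one_eq_zero])).mono (by omega)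
    · simp only [AddMonoidHom.mapMatrix_apply, Matrix.map_apply, h.traceless, map_neg]
      exact (h.vanish00.coeffDerivation E).neg.mono (by omega)
  -- Dividing by `λ Y` lowers the degree, so a bound on `V` yields a better bound on `P`. The floor
  -- `2g - 1` is the contribution of `e L`. The estimate is used first with the crude degree bound
  -- on `V`, then with the refined one.
  have estimate : ∀ m : ℤ, 2 * (g : ℤ) - 1 ≤ m → Shear (m + 2) V → Shear (m - 1 - 2 * g) P := by
    intro m hm hVm
    have hQm : Shear m Q := by
      rw [hQ, hp]
      exact (heL.mono hm).sub (hVm.lambdaDerivation.mono (by omega))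
    rw [hPQ]
    exact ((hQm.mul hU.shear).smul hfac).mono (by omega)
  have hP0 : Shear 0 P := by
    refine (estimate (2 * g + 1) (by omega) ?_).mono (by omega)
    intro i j
    exact (hVd i j).mono (by omega)
  -- the component along `U` is `λⁿ` up to terms of negative degree
  obtain ⟨χ, hχ⟩ : ∃ χ, χ = ψ - lam K ^ n := ⟨_, rfl⟩
  -- Taking the trace of the zero curvature equation against `U` removes the commutator and leaves a
  -- scalar equation `(1 + 2 λ ∂_λ) ψ = 2 λ E(Y) + tr(∂_λ U · P)`. Its main source `(2n + 1) λⁿ` is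
  -- solved by `λⁿ`.
  have hχv : VanishBelow χ 1 := by
    refine vanishBelow_of_half_euler ?_
    have h1 : (U * e L).trace = 2 * lam K * coeffDerivation E Y := by
      rw [eL, mul_add, Matrix.trace_add, mul_smul_comm, mul_smul_comm, Matrix.trace_smul,
        Matrix.trace_smul, eU, tUU]
      simp; ring
    have h2 : (U * e L).trace = (U * p V).trace := by
      have h3 : e L = p V + (V * L - L * V) := by rw [← sub_eq_zero, ← hflow]; abel
      rw [h3, mul_add, Matrix.trace_add, hLU, mul_sub, Matrix.trace_sub, smul_mul_assoc,
        mul_smul_comm, mul_smul_comm, mul_smul_comm, Matrix.trace_smul, Matrix.trace_smul,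
        ← mul_assoc, Matrix.trace_mul_comm (U * V), sub_self, add_zero]
    have h3 : (U * p V).trace = ψ + 2 * (lam K * lambdaDerivation K ψ) - (p U * P).trace := by
      have h4 : (U * p V).trace + (p U * V).trace = lambdaDerivation K (2 * lam K * ψ) := by
        rw [hψ2, ← trace_mapMatrix, ← hp, ← Matrix.trace_add, hp,
          ← mapMatrix_mul isLeibniz_lambdaDerivation]
      have h5 : (p U * V).trace = ψ + (p U * P).trace := by
        rw [hVP, mul_add, Matrix.trace_add, mul_smul_comm, Matrix.trace_smul,
          Matrix.trace_mul_comm (p U), pU, smul_eq_mul, mul_one]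
      rw [h5, mul_assoc, two_mul, map_add, isLeibniz_lambdaDerivation, lambdaDerivation_lam] at h4
      linear_combination h4
    have h6 : χ + 2 * (lam K * lambdaDerivation K χ) =
        2 * (lam K * coeffDerivation E (Y - timeSeries c g)) + (p U * P).trace := by
      have hl : lam K ^ n + 2 * (lam K * lambdaDerivation K (lam K ^ n)) =
          (2 * n + 1) * lam K ^ n := by
        rcases n with _ | m
        · simp [lambdaDerivation_one]
        · rw [lambdaDerivation_lam_pow]; push_cast; ring
      rw [hχ, map_sub, map_sub]
      linear_combination h1 - h2 - h3 - hl + hEc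
    rw [h6]
    refine VanishBelow.add ?_ ?_
    · have := (vanishBelow_lam.mul (hYT.coeffDerivation E)).mono (n := -1 + 2) (m := 1) (by norm_num)
      rw [two_mul]
      exact this.add this
    · rw [hp]
      exact (hU.shear.lambdaDerivation.mul hP0).trace.mono (by norm_num)
  have hVχ : V = lam K ^ n • U + (χ • U + P) := by
    rw [hVP, hχ, sub_smul]; abel
  have hχU : Shear (-1) (χ • U) := (hU.shear.smul hχv).mono (by norm_num)
  -- Now `V` has `Shear` degree at most `2n + 1 < 2g + 1`, so the estimate applies at its lower
  -- limit.
  have hP2 : Shear (-2) P := by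
    refine (estimate (2 * g - 1) le_rfl ?_).mono (by omega)
    rw [hVχ]
    refine Shear.add ?_ ((hχU.mono (by omega)).add (hP0.mono (by omega)))
    have : VanishBelow (lam K ^ n) (-n) := by rw [lam_pow]; exact vanishBelow_single _ _
    exact (hU.shear.smul this).mono (by omega)
  -- comparison with the truncation
  have hdiff : V - truncU U n = tailU U n + (χ • U + P) := by
    rw [tailU, hVχ]; abel
  have hpoly : ∀ i j, IsPoly ((V - truncU U n) i j) := fun i j =>
    (hV i j).sub (isPoly_truncU U n i j)
  -- `V₁₂` is polynomial, so its coefficient of `1/λ` vanishes. This determines the coefficient of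
  -- `1/λ` in `χ`, which accounts for the correction in the lower left entry of `truncU`.
  have c01 : (U 0 1).coeff (n + 1) + χ.coeff 1 = 0 := by
    have h1 := hpoly 0 1 1 one_pos
    rw [hdiff, Matrix.add_apply, Matrix.add_apply, HahnSeries.coeff_add, HahnSeries.coeff_add,
      coeff_tailU (by decide), hP2 0 1 1 (by norm_num), Matrix.smul_apply, smul_eq_mul] at h1
    have h2 := hχv.coeff_mul hU.vanish01
    rw [add_zero, hU.coeff01, mul_one] at h2
    rw [h2, add_zero] at h1
    exact h1
  rw [← sub_eq_zero]
  have hentry : ∀ i j, VanishBelow ((χ • U + P) i j) 0 := by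
    intro i j
    exact ((hχU.add (hP2.mono (by norm_num))) i j).mono (by omega)
  have v10 : VanishBelow ((V - truncU U n) 1 0) 1 := by
    refine VanishBelow.succ (n := 0) ?_ ?_
    · rw [hdiff]
      exact (vanishBelow_tailU10_zero U n).add (hentry 1 0)
    · have h2 := hχv.coeff_mul hU.vanish10
      rw [hU.coeff10, mul_one, add_neg_cancel] at h2
      rw [hdiff, Matrix.add_apply, Matrix.add_apply, HahnSeries.coeff_add, HahnSeries.coeff_add,
        coeff_tailU10, hP2 1 0 0 (by norm_num), Matrix.smul_apply, smul_eq_mul, h2, add_zero, c01]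
  have vgen : ∀ i j : Fin 2, ¬(i = 1 ∧ j = 0) → VanishBelow ((V - truncU U n) i j) 1 := by
    intro i j hij
    rw [hdiff]
    refine (vanishBelow_tailU hij U n).add (VanishBelow.add ?_ ?_)
    · have := hij
      fin_cases i <;> fin_cases j <;> simp at this
      · exact (hχv.mul hU.vanish00).mono (by norm_num)
      · exact (hχv.mul hU.vanish01).mono (by norm_num)
      · refine VanishBelow.mono (n := 1 + 1) ?_ (by norm_num)
        exact hχv.mul (by
          change VanishBelow (U 1 1) 1
          rw [hU.traceless]; exact hU.vanish00.neg)
    · refine (hP2 i j).mono ?_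
      have := hij
      fin_cases i <;> fin_cases j <;> simp at this <;> norm_num
  ext1 i j
  refine (hpoly i j).eq_zero ?_
  by_cases hij : i = 1 ∧ j = 0
  · rw [hij.1, hij.2]; exact v10
  · exact vgen i j hij

end Rigidity

/-! ### Formal isomonodromic systems satisfy the string equation and the KdV flows -/

section Identification

variable {K : Type*} [CommRing K] [Algebra ℂ K] {c : ℕ → K} {g : ℕ} {L : LMat K}

/-- An isomonodromic system over a differential ring: `L` is normalized, the matrices `V n` are
polynomial, traceless and of bounded degree, and satisfy the zero curvature equations. -/
structure IsFormalSystem (E : ℕ → Derivation ℂ K K) (c : ℕ → K) (g : ℕ) (L : LMat K)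
    (V : ℕ → LMat K) : Prop where
  normal : IsNormalLax c g L
  leading : c (g + 1) = 1
  times : ∀ n < g, 2 * lam K * coeffDerivation (E n) (timeSeries c g) = (2 * n + 1) * lam K ^ n
  isPoly : ∀ n < g, ∀ i j, IsPoly (V n i j)
  traceless : ∀ n < g, V n 1 1 = -V n 0 0
  degree : ∀ n < g, ∀ i j, VanishBelow (V n i j) (-g - 1)
  flow : ∀ n < g, (coeffDerivation (E n)).mapMatrix L - (lambdaDerivation K).mapMatrix (V n)
    + (L * V n - V n * L) = 0

/-- The first `g + 1` coefficients of a spectral matrix satisfy the resolvent equations. -/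
structure IsResolventUpTo (D : Derivation ℂ K K) (u : K) (g : ℕ) (U : LMat K) : Prop
    extends IsSpectral U where
  entry00 : ∀ k : ℕ, k ≤ g → 2 * (U 0 0).coeff k = -D ((U 0 1).coeff k)
  entry10 : ∀ k : ℕ, k ≤ g → (U 1 0).coeff k =
    D ((U 0 0).coeff k) + (U 0 1).coeff (k + 1) - u * (U 0 1).coeff k
  resolvent : ∀ l : ℕ, l ≤ g → resolventCoeff u (fun k => (U 0 1).coeff k)
    (fun k => D ((U 0 1).coeff k)) (fun k => D (D ((U 0 1).coeff k))) l = 0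

variable {E : ℕ → Derivation ℂ K K} {V : ℕ → LMat K}

-- Constant term of the diagonal entry of `U² = λ`. With `u = 2 R₁` it makes the constant term of
-- `U₂₁` equal to `R₁ - u`, as in the resolvent.
omit [Algebra ℂ K] in
theorem IsSpectral.coeff10_zero {U : LMat K} (h : IsSpectral U) :
    (U 1 0).coeff 0 + (U 0 1).coeff 1 = 0 := by
  have h1 : U 0 0 * U 0 0 + U 1 0 * U 0 1 = lam K := by
    have := congrFun (congrFun h.sq 0) 0
    simp [Matrix.mul_apply, Fin.sum_univ_two] at this
    rw [← this]; ring
  have h2 := congrArg (fun f => HahnSeries.coeff f 0) h1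
  have h3 := h.vanish10.coeff_mul_add_nat h.vanish01 1
  simp [Finset.Nat.antidiagonal_succ, h.coeff01, h.coeff10] at h3
  simp only [HahnSeries.coeff_add] at h2
  rw [(h.vanish00.mul h.vanish00) 0 (by norm_num), h3, lam,
    HahnSeries.coeff_single_of_ne (by norm_num)] at h2
  linear_combination h2

/-- Errors of order `λ^{-g-1}` do not touch the coefficients of index at most `g`. Eliminating `U₁₁`
and `U₂₁` from `U² = λ` gives the quadratic equation with an error of the same order. -/
theorem IsSpectral.resolventUpTo {U : LMat K} {D : Derivation ℂ K K} {u : K} (h : IsSpectral U)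
    {E01 E00 : LaurentSeries K}
    (h01 : coeffDerivation D (U 0 1) = -(2 * U 0 0) + E01)
    (h00 : coeffDerivation D (U 0 0) = U 1 0 - (lam K - cst u) * U 0 1 + E00)
    (v01 : VanishBelow E01 (g + 1)) (v00 : VanishBelow E00 (g + 1)) :
    IsResolventUpTo D u g U where
  toIsSpectral := h
  entry00 k hk := by
    have := congrArg (fun f => HahnSeries.coeff f (k : ℤ)) h01
    simp only [coeff_coeffDerivation, HahnSeries.coeff_add, HahnSeries.coeff_neg, coeff_two_mul,
      v01 k (by omega), add_zero] at this
    rw [this, neg_neg]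
  entry10 k hk := by
    have := congrArg (fun f => HahnSeries.coeff f (k : ℤ)) h00
    simp only [coeff_coeffDerivation, HahnSeries.coeff_add, HahnSeries.coeff_sub, sub_mul,
      coeff_lam_mul, coeff_cst_mul, v00 k (by omega), add_zero] at this
    rw [this]; ring
  resolvent l hl := by
    rw [← coeff_resolventSeries h.vanish01]
    obtain ⟨d, hd⟩ : ∃ d, d = coeffDerivation D := ⟨_, rfl⟩
    have h1 : U 0 0 * U 0 0 + U 0 1 * U 1 0 = lam K := by
      have := congrFun (congrFun h.sq 0) 0
      simpa [Matrix.mul_apply, Fin.sum_univ_two] using this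
    have hdd : d (d (U 0 1)) = -(2 * d (U 0 0)) + d E01 := by
      conv_lhs => rw [hd, h01, ← hd]
      rw [map_add, map_neg, two_mul, map_add, two_mul]
    have e : resolventSeries D u (U 0 1) = cst 4 * lam K + (cst 2 * (d (U 0 1) * E01) - E01 * E01
        - cst 2 * (U 0 1 * d E01) + cst 4 * (U 0 1 * E00)) := by
      rw [← hd] at h01 h00
      simp only [resolventSeries, ← hd, hdd, map_ofNat]
      linear_combination 4 * h1 + 4 * U 0 1 * h00 + (d (U 0 1) - 2 * U 0 0 - E01) * h01
    have vd : VanishBelow (d (U 0 1)) 0 := hd ▸ h.vanish01.coeffDerivation D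
    have vE : VanishBelow (d E01) (g + 1) := hd ▸ v01.coeffDerivation D
    have hv : VanishBelow (cst 2 * (d (U 0 1) * E01) - E01 * E01
        - cst 2 * (U 0 1 * d E01) + cst 4 * (U 0 1 * E00)) (g + 1) :=
      ((((((vd.mul v01).mono (by omega)).cst_mul 2).sub ((v01.mul v01).mono (by omega))).sub
        (((h.vanish01.mul vE).mono (by omega)).cst_mul 2))).add
        (((h.vanish01.mul v00).mono (by omega)).cst_mul 4)
    rw [e, HahnSeries.coeff_add, hv l (by omega), coeff_cst_mul, lam,
      HahnSeries.coeff_single_of_ne (by omega), mul_zero, add_zero]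

set_option maxHeartbeats 1000000 in
/-- The identification of a formal isomonodromic system with a solution of the string equation. -/
theorem IsFormalSystem.exists_resolvent (h : IsFormalSystem E c g L V) (hg : 0 < g) :
    ∃ (u : K) (U : LMat K), IsResolventUpTo (E 0) u g U ∧ u = 2 * (U 0 1).coeff 1 ∧
      L = laxOf U c g ∧ (∀ n < g, V n = truncU U n) ∧
      ∑ l ∈ Finset.range (g + 2), c l * (U 0 1).coeff l = 0 ∧
      ∀ n < g, E n u = 2 * E 0 ((U 0 1).coeff (n + 1)) := by
  obtain ⟨Y, U, hLU, hU, hY, hY1, hYT⟩ := h.normal.exists_isSpectral h.leading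
  obtain ⟨Z, hZ, hZv, -⟩ := exists_inverse_of_leading hY hY1
  rw [neg_neg] at hZv
  have hVU : ∀ n < g, V n = truncU U n := fun n hn =>
    h.normal.eq_truncU hn hLU hU hY hY1 hYT (h.isPoly n hn) (h.traceless n hn)
      (h.degree n hn) (h.times n hn) (h.flow n hn)
  obtain ⟨u, hu⟩ : ∃ u, u = 2 * (U 0 1).coeff 1 := ⟨_, rfl⟩
  have hu0 : (U 1 0).coeff 0 = (U 0 1).coeff 1 - u := by
    rw [hu]; linear_combination hU.coeff10_zero
  have hV0 : V 0 = schroedinger u := by rw [hVU 0 hg, hU.truncU_zero hu0]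
  have hflow : ∀ n < g, Y • (coeffDerivation (E n)).mapMatrix U =
      (lambdaDerivation K).mapMatrix (V n) + Y • (V n * U - U * V n)
        - coeffDerivation (E n) Y • U := by
    intro n hn
    have := h.flow n hn
    rw [hLU, mapMatrix_smul (isLeibniz_coeffDerivation (E n))] at this
    rw [← sub_eq_zero, ← this]
    simp only [smul_mul_assoc, mul_smul_comm, smul_sub]
    abel
  -- the flow in the direction `x`
  have hres : IsResolventUpTo (E 0) u g U := by
    obtain ⟨d, hd⟩ : ∃ d, d = coeffDerivation (E 0) := ⟨_, rfl⟩
    have h0 := hflow 0 hg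
    rw [hV0] at h0
    have f01 := congrFun (congrFun h0 0) 1
    have f00 := congrFun (congrFun h0 0) 0
    have f10 := congrFun (congrFun h0 1) 0
    have f11 := congrFun (congrFun h0 1) 1
    simp [Matrix.mul_apply, Fin.sum_univ_two, hU.traceless, lambdaDerivation_one, ← hd,
      lambdaDerivation_lam, lambdaDerivation_cst] at f01 f00 f10 f11
    have q : U 0 0 * U 0 0 + U 0 1 * U 1 0 = lam K := by
      have := congrFun (congrFun hU.sq 0) 0
      simpa [Matrix.mul_apply, Fin.sum_univ_two] using this
    have dq : 2 * (U 0 0 * d (U 0 0)) + U 0 1 * d (U 1 0) + U 1 0 * d (U 0 1) = 0 := by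
      have := congrArg d q
      rw [map_add, hd, isLeibniz_coeffDerivation, isLeibniz_coeffDerivation,
        coeffDerivation_lam] at this
      rw [hd]
      linear_combination this
    -- Trace of the flow against `U`: the terms in `D U` and in the commutator drop out, and `∂_λ V₀
    -- = E21` pairs with `U` to `U₁₂`. Hence `D Y = O(1/λ)`, and dividing by `Y` gives errors of
    -- order `λ^{-g-1}`.
    have key : 2 * lam K * d Y = U 0 1 := by
      linear_combination (2 * U 0 0) * f00 + U 1 0 * f01 + U 0 1 * f10 - Y * dq + (-2 * d Y) * q
    have hdY : d Y = halfSeries K * lamInv K * U 0 1 := by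
      rw [← key]
      linear_combination (-lam K * lamInv K * d Y) * two_mul_halfSeries (K := K)
        - d Y * lam_mul_lamInv (K := K)
    have vdY : VanishBelow (d Y) 1 := by
      rw [hdY, mul_assoc]
      exact ((vanishBelow_lamInv.mul hU.vanish01).mono (by norm_num)).halfSeries_mul
    refine hU.resolventUpTo (E01 := -(Z * (d Y * U 0 1))) (E00 := -(Z * (d Y * U 0 0))) ?_ ?_ ?_ ?_
    · rw [← hd]
      linear_combination Z * f01 - (d (U 0 1) + 2 * U 0 0) * hZ
    · rw [← hd]
      linear_combination Z * f00 - (d (U 0 0) - U 1 0 + (lam K - cst u) * U 0 1) * hZ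
    · exact ((hZv.mul (vdY.mul hU.vanish01)).mono (by omega)).neg
    · exact ((hZv.mul (vdY.mul hU.vanish00)).mono (by omega)).neg
  -- `L₁₂ = Y U₁₂` has no term in `1/λ`, and replacing `Y` by `timeSeries` changes that coefficient
  -- by nothing.
  have hstring : ∑ l ∈ Finset.range (g + 2), c l * (U 0 1).coeff l = 0 := by
    have h1 := h.normal.isPoly 0 1 1 one_pos
    have e : L 0 1 = (Y - timeSeries c g) * U 0 1 + timeSeries c g * U 0 1 := by
      rw [hLU, Matrix.smul_apply, smul_eq_mul]; ring
    rw [e, HahnSeries.coeff_add, (hYT.mul hU.vanish01) 1 (by norm_num), zero_add, timeSeries,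
      add_mul, Finset.sum_mul, HahnSeries.coeff_add, HahnSeries.coeff_sum, mul_assoc,
      coeff_cst_mul, coeff_lamInv_mul] at h1
    rw [Finset.sum_range_succ', ← h1]
    congr 1
    refine Finset.sum_congr rfl fun l _ => ?_
    rw [mul_assoc, coeff_cst_mul, coeff_lam_pow_mul, add_comm (1 : ℤ)]
    push_cast
    rfl
  refine ⟨u, U, hres, hu, ?_, hVU, hstring, ?_⟩
  -- Both `Y - timeSeries` and the string error are small, so every entry of the polynomial
  -- difference has only negative powers of `λ`.
  · have hs : Shear (-2) (L - laxOf U c g) := by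
      have e : L - laxOf U c g = (Y - timeSeries c g) • U + (timeSeries c g • U - laxOf U c g) := by
        rw [hLU, sub_smul]; abel
      rw [e]
      exact ((hU.shear.smul hYT).mono (by norm_num)).add (hU.shear_of_string hstring)
    rw [← sub_eq_zero]
    ext1 i j
    refine IsPoly.eq_zero ((h.normal.isPoly i j).sub (isPoly_laxOf U c g i j)) ((hs i j).mono ?_)
    omega
  · intro n hn
    have h1 := congrFun (congrFun (hflow n hn) 0) 1
    obtain ⟨d, hd⟩ : ∃ d, d = coeffDerivation (E n) := ⟨_, rfl⟩
    have hVT : V n = lam K ^ n • U - tailU U n := by rw [hVU n hn, tailU]; abel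
    have hcomm : V n * U - U * V n = U * tailU U n - tailU U n * U := by
      rw [hVT]
      simp only [sub_mul, mul_sub, smul_mul_assoc, mul_smul_comm]
      abel
    obtain ⟨T, hT⟩ : ∃ T, T = tailU U n := ⟨_, rfl⟩
    have hTt : T 1 1 = -T 0 0 := hT ▸ tailU_traceless hU.traceless n
    rw [hcomm, ← hT] at h1
    simp [Matrix.mul_apply, Fin.sum_univ_two, hU.traceless, hTt, ← hd] at h1
    -- The commutator with `V n` is minus the commutator with the tail, because `λⁿ U` commutes with
    -- `U`. At order `1/λ` only `-2 T₁₁ U₁₂` survives, with coefficient minus twice the coefficient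
    -- of index `n + 1` of `U₁₁`.
    have h2 : d (U 0 1) = 2 * (U 0 0 * T 0 1) - 2 * (T 0 0 * U 0 1)
        + Z * (lambdaDerivation K (V n 0 1) - d Y * U 0 1) := by
      linear_combination Z * h1 - (d (U 0 1) - 2 * (U 0 0 * T 0 1) + 2 * (T 0 0 * U 0 1)) * hZ
    have vlam : VanishBelow (lam K ^ n) (-n) := by rw [lam_pow]; exact vanishBelow_single _ _
    have vT : ∀ {i j : Fin 2}, ¬(i = 1 ∧ j = 0) → VanishBelow (T i j) 1 := fun hij =>
      hT ▸ vanishBelow_tailU hij U n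
    have vV : VanishBelow (V n 0 1) (-n) := by
      rw [hVT, ← hT]
      refine VanishBelow.sub ?_ ((vT (by decide)).mono (by omega))
      exact (vlam.mul hU.vanish01).mono (by omega)
    have vdY : VanishBelow (d Y) (1 - n) := by
      have e : d Y = d (Y - timeSeries c g)
          + halfSeries K * (lamInv K * ((2 * n + 1) * lam K ^ n)) := by
        rw [← h.times n hn, ← hd, map_sub]
        linear_combination (-(lam K * lamInv K) * d (timeSeries c g)) * two_mul_halfSeries (K := K)
          - d (timeSeries c g) * lam_mul_lamInv (K := K)
      rw [e]
      refine VanishBelow.add ?_ (VanishBelow.halfSeries_mul ?_)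
      · rw [hd]
        exact (hYT.coeffDerivation (E n)).mono (by omega)
      · refine vanishBelow_lamInv.mul (n := -n) ?_
        have : (2 * n + 1 : LaurentSeries K) = cst (2 * (n : K) + 1) := by
          rw [map_add, map_mul, map_ofNat, map_natCast, map_one]
        rw [this]
        exact vlam.cst_mul _
    have vrest : VanishBelow (Z * (lambdaDerivation K (V n 0 1) - d Y * U 0 1)) 2 := by
      refine (hZv.mul (VanishBelow.sub (n := 1 - n) (vV.lambdaDerivation.mono (by omega)) ?_)).mono
        (by omega)
      exact (vdY.mul hU.vanish01).mono (by omega)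
    have h3 := congrArg (fun f => HahnSeries.coeff f 1) h2
    have c1 : (T 0 0 * U 0 1).coeff 1 = (U 0 0).coeff (n + 1) := by
      have := (vT (i := 0) (j := 0) (by decide)).coeff_mul hU.vanish01
      rw [add_zero, hU.coeff01, mul_one] at this
      rw [this, hT, coeff_tailU (by decide)]
    simp only [HahnSeries.coeff_add, HahnSeries.coeff_sub, coeff_two_mul, vrest 1 (by norm_num),
      (hU.vanish00.mul (vT (i := 0) (j := 1) (by decide))) 1 (by norm_num), c1] at h3
    rw [hd, coeff_coeffDerivation] at h3
    have h4 := hres.entry00 (n + 1) (by omega)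
    push_cast at h4
    rw [hu, two_mul, map_add, ← two_mul, h3]
    linear_combination (-2 : K) * h4

end Identification

/-! ### Fixed points for Laurent series -/

section FixedPoint

variable {K : Type*} [CommRing K]

/-- A contraction of a ball of Laurent series has a fixed point. -/
theorem exists_fixedPoint_laurentSeries (T : LaurentSeries K → LaurentSeries K)
    (f₀ : LaurentSeries K) (m : ℤ)
    (hmaps : ∀ f, VanishBelow (f - f₀) m → VanishBelow (T f - f₀) m)
    (hT : ∀ f h n, m ≤ n → VanishBelow (f - f₀) m → VanishBelow (h - f₀) m →
      VanishBelow (f - h) n → VanishBelow (T f - T h) (n + 1)) :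
    ∃ f, VanishBelow (f - f₀) m ∧ T f = f := by
  obtain ⟨J, hJ⟩ : ∃ J : PowerSeries K → LaurentSeries K,
      J = fun p => f₀ + HahnSeries.single m 1 * HahnSeries.ofPowerSeries ℤ K p := ⟨_, rfl⟩
  have hJ0 : ∀ p, VanishBelow (J p - f₀) m := fun p => by
    rw [hJ, add_sub_cancel_left]
    simpa using (vanishBelow_ofPowerSeries p).single_mul m 1
  have hJd : ∀ p q (n : ℕ), PowerSeries.X ^ n ∣ p - q → VanishBelow (J p - J q) (m + n) := by
    intro p q n h
    have e : J p - J q = HahnSeries.single m 1 * HahnSeries.ofPowerSeries ℤ K (p - q) := by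
      simp only [hJ, map_sub]; ring
    rw [e]
    refine VanishBelow.single_mul (fun k hk => ?_) m 1
    rcases lt_or_ge k 0 with h0 | h0
    · exact vanishBelow_ofPowerSeries _ k h0
    · obtain ⟨k, rfl⟩ := Int.eq_ofNat_of_zero_le h0
      rw [coeff_ofPowerSeries]
      exact PowerSeries.X_pow_dvd_iff.mp h k (by exact_mod_cast hk)
  obtain ⟨p, hp⟩ := exists_fixedPoint_powerSeries
    (fun p => PowerSeries.mk fun k : ℕ => (T (J p) - f₀).coeff (m + k)) (by
      intro p q n h
      rw [PowerSeries.X_pow_dvd_iff]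
      intro k hk
      have := hT _ _ _ (by omega) (hJ0 p) (hJ0 q) (hJd p q n h) (m + k) (by omega)
      rw [HahnSeries.coeff_sub] at this
      simp only [map_sub, PowerSeries.coeff_mk, HahnSeries.coeff_sub]
      linear_combination this)
  refine ⟨J p, hJ0 p, ?_⟩
  have h1 := (hmaps _ (hJ0 p)).eq_single_mul
  rw [hp] at h1
  have h2 : J p = f₀ + HahnSeries.single m 1 * HahnSeries.ofPowerSeries ℤ K p := by rw [hJ]
  rw [← h1, add_sub_cancel] at h2
  exact h2.symm

end FixedPoint

/-! ### Puiseux series in `λ^{-1/2}` and the irregular diagonal form -/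

section IrregularTimes

theorem lamDeriv_eq (f : LaurentSeries ℂ) :
    lamDeriv f = HahnSeries.single 2 (1 / 2) * eulerDerivation ℂ f := by
  ext k
  rw [lamDeriv, HahnSeries.coeff_single_mul, HahnSeries.coeff_single_mul, coeff_eulerDerivation]
  rw [LaurentSeries.derivative_apply, LaurentSeries.hasseDeriv_coeff]
  simp only [show k - 3 + (1 : ℕ) = k - 2 by push_cast; ring, Ring.choose_one_right', zsmul_eq_mul]
  push_cast
  simp
  ring

theorem lamDeriv_mul (f h : LaurentSeries ℂ) :
    lamDeriv (f * h) = f * lamDeriv h + h * lamDeriv f := by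
  simp only [lamDeriv_eq, isLeibniz_eulerDerivation f h]
  ring

theorem lamDeriv_sub (f h : LaurentSeries ℂ) : lamDeriv (f - h) = lamDeriv f - lamDeriv h := by
  simp only [lamDeriv_eq, map_sub, mul_sub]

theorem coeff_lamDeriv (f : LaurentSeries ℂ) (k : ℤ) :
    (lamDeriv f).coeff k = -((k - 2 : ℤ) : ℂ) / 2 * f.coeff (k - 2) := by
  rw [lamDeriv_eq, HahnSeries.coeff_single_mul, coeff_eulerDerivation]
  ring

theorem VanishBelow.lamDeriv {f : LaurentSeries ℂ} {n : ℤ} (hf : VanishBelow f n) :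
    VanishBelow (lamDeriv f) (n + 2) := fun k hk => by
  rw [coeff_lamDeriv, hf _ (by omega), mul_zero]

theorem exists_inverse_of_ne_zero {f : LaurentSeries ℂ} (hf : f ≠ 0) :
    ∃ (n : ℤ) (e : LaurentSeries ℂ), f * e = 1 ∧ VanishBelow f n ∧ VanishBelow e (-n) := by
  have h0 : f.coeff f.order ≠ 0 := HahnSeries.coeff_order_eq_zero.not.mpr hf
  have hv : VanishBelow f f.order := fun _ hk => HahnSeries.coeff_eq_zero_of_lt_order hk
  obtain ⟨e, he, hev, -⟩ := exists_inverse_of_leading (hv.cst_mul (f.coeff f.order)⁻¹)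
    (by rw [coeff_cst_mul, inv_mul_cancel₀ h0])
  exact ⟨f.order, cst (f.coeff f.order)⁻¹ * e, by rw [← he]; ring, hv, hev.cst_mul _⟩

/-- Logarithmic derivatives are `O(1/λ)`, which is order `2` in `λ^{-1/2}`. -/
theorem vanishBelow_logDeriv {f e : LaurentSeries ℂ} {n : ℤ} (hf : VanishBelow f n)
    (he : VanishBelow e (-n)) : VanishBelow (e * lamDeriv f) 2 :=
  (he.mul hf.lamDeriv).mono (by omega)

/-- `toPuiseux` as an algebra homomorphism. -/
def puiseuxHom : ℂ[X] →ₐ[ℂ] LaurentSeries ℂ := aeval (HahnSeries.single (-2) (1 : ℂ) : LaurentSeries ℂ)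

theorem toPuiseux_eq (p : ℂ[X]) : toPuiseux p = puiseuxHom p := rfl

theorem coeff_puiseuxHom (p : ℂ[X]) (n : ℕ) : (puiseuxHom p).coeff (-(2 * n)) = p.coeff n := by
  simpa [puiseuxHom] using coeff_aeval_single (m := 2) two_pos p n

theorem coeff_puiseuxHom_of_ne (p : ℂ[X]) {k : ℤ} (hk : ∀ n : ℕ, k ≠ -(2 * n)) :
    (puiseuxHom p).coeff k = 0 := by
  have := coeff_aeval_single_of_ne (m := 2) p k (by simpa using hk)
  simpa [puiseuxHom] using this

theorem vanishBelow_puiseuxHom {p : ℂ[X]} {n : ℤ} (h : ∀ k : ℕ, n < k → p.coeff k = 0) :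
    VanishBelow (puiseuxHom p) (-(2 * n)) := fun k hk => by
  by_cases h0 : ∃ m : ℕ, k = -(2 * m)
  · obtain ⟨m, rfl⟩ := h0
    rw [coeff_puiseuxHom, h m (by omega)]
  · exact coeff_puiseuxHom_of_ne _ (by simpa using h0)

theorem puiseuxHom_eq_zero {p : ℂ[X]} (h : VanishBelow (puiseuxHom p) 1) : p = 0 := by
  ext n
  rw [← coeff_puiseuxHom, h _ (by omega), coeff_zero]

theorem puiseuxHom_X : puiseuxHom X = HahnSeries.single (-2) 1 := by simp [puiseuxHom]

/-- The polynomial `∑ cₖ λᵏ`, whose quotient by `λ^{1/2}` is the diagonal irregular part. -/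
def timePoly {K : Type*} [CommRing K] (c : ℕ → K) (g : ℕ) : K[X] := ∑ k ∈ Finset.range (g + 2), C (c k) * X ^ k

theorem coeff_timePoly {K : Type*} [CommRing K] (c : ℕ → K) (g k : ℕ) :
    (timePoly c g).coeff k = if k < g + 2 then c k else 0 := by
  simp [timePoly, finsetSum_coeff, coeff_C_mul, coeff_X_pow]

/-- The leading part of the diagonal entries of the formal diagonal form. -/
def irregularPart (c : ℕ → ℂ) (g : ℕ) : LaurentSeries ℂ :=
  HahnSeries.single 1 1 * puiseuxHom (timePoly c g)

theorem vanishBelow_irregularPart (c : ℕ → ℂ) (g : ℕ) :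
    VanishBelow (irregularPart c g) (-(2 * g) - 1) := by
  refine ((vanishBelow_puiseuxHom (n := g + 1) fun k hk => ?_).single_mul 1 1).mono (by omega)
  rw [coeff_timePoly, if_neg (by omega)]

theorem coeff_irregularPart {c : ℕ → ℂ} {g : ℕ} (hc : c (g + 1) = 1) :
    (irregularPart c g).coeff (-(2 * g) - 1) = 1 := by
  rw [irregularPart, HahnSeries.coeff_single_mul, one_mul,
    show (-(2 * g) - 1 - 1 : ℤ) = -(2 * (g + 1 : ℕ)) by push_cast; ring, coeff_puiseuxHom,
    coeff_timePoly, if_pos (by omega), hc]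

theorem sum_Icc_one_two_mul {M : Type*} [AddCommMonoid M] (f : ℕ → M) (n : ℕ) :
    ∑ k ∈ Finset.Icc 1 (2 * n), f k = ∑ l ∈ Finset.range n, (f (2 * l + 1) + f (2 * l + 2)) := by
  induction n with
  | zero => simp
  | succ n ih =>
    rw [Finset.sum_range_succ, ← ih, show 2 * (n + 1) = 2 * n + 1 + 1 by ring,
      Finset.sum_Icc_succ_top (by omega), Finset.sum_Icc_succ_top (by omega), add_assoc]

theorem irregularTimes_even (g : ℕ) (t : Fin g → ℂ) (l : ℕ) :
    irregularTimes g t (2 * l + 2) = 0 := by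
  rw [irregularTimes, dif_neg (by omega), if_neg (by omega)]

/-- The dictionary between the two normalizations of the times, covering also the fixed values
`t_{∞,2g+1} = 0` and `t_{∞,2g+3} = 2`. -/
theorem irregularTimes_odd (g : ℕ) (s : Fin g → ℂ) {l : ℕ} (hl : l < g + 2) :
    irregularTimes g (timeMap g s) (2 * l + 1) = 2 * c g s l := by
  have h2 : (2 * l + 1) / 2 = l := by omega
  rw [irregularTimes, c]
  by_cases h : l < g
  · rw [dif_pos ⟨by omega, by omega⟩, dif_pos h]
    simp only [h2, timeMap]
    ring
  · rw [dif_neg (by omega), dif_neg h]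
    by_cases h' : l = g + 1
    · rw [if_pos (by omega), if_pos h', mul_one]
    · rw [if_neg (by omega), if_neg h', mul_zero]

/-- Even times vanish, so the singular part is odd in `z` and the sign `ε` factors out. -/
theorem irregularEntry_eq (g : ℕ) (s : Fin g → ℂ) {ε : ℂ} (hε : ε ^ 2 = 1) :
    irregularEntry g (irregularTimes g (timeMap g s)) ε =
      cst ε * irregularPart (c g s) g - HahnSeries.single 2 (1 / 4) := by
  rw [irregularEntry, show 2 * g + 4 = 2 * (g + 2) by ring, sum_Icc_one_two_mul, irregularPart,
    timePoly, map_sum, Finset.mul_sum, Finset.mul_sum]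
  congr 1
  refine Finset.sum_congr rfl fun l hl => ?_
  have e1 : ε ^ (2 * l + 1) = ε := by rw [pow_succ, pow_mul, hε, one_pow, one_mul]
  rw [irregularTimes_even, irregularTimes_odd g s (Finset.mem_range.mp hl), e1, map_mul, map_pow,
    puiseuxHom_X, ← algebraMap_eq, AlgHom.commutes, algebraMap_laurentSeries,
    HahnSeries.single_pow, cst_apply, HahnSeries.single_mul_single, HahnSeries.single_mul_single,
    HahnSeries.single_mul_single]
  simp only [mul_zero, zero_div, map_zero, add_zero, one_pow, mul_one, one_mul, nsmul_eq_mul]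
  rw [show 2 - ((2 * l + 1 : ℕ) : ℤ) = 0 + (1 + (0 + (l : ℤ) * -2)) by push_cast; ring,
    show ε * (2 * c g s l) / 2 = ε * c g s l by ring]

end IrregularTimes

/-! ### From irregular times to the spectral curve -/

section IrregularTimes

variable {g : ℕ} {L : PolyMat} {s : Fin g → ℂ}

theorem IsNormalized.coeff01 (h : IsNormalized g L) : (L 0 1).coeff g = 1 := by
  obtain ⟨x, hx⟩ := h
  have := coeff_eq_zero_of_degree_lt (hx 0 1)
  simp [coeff_X_pow] at this
  linear_combination this

theorem IsNormalized.coeff01_of_lt (h : IsNormalized g L) {k : ℕ} (hk : g < k) :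
    (L 0 1).coeff k = 0 := by
  obtain ⟨x, hx⟩ := h
  have := coeff_eq_zero_of_degree_lt ((hx 0 1).trans (Nat.cast_lt.mpr hk))
  simpa [coeff_X_pow, hk.ne', show k ≠ g from by omega] using this

theorem IsNormalized.coeff00_of_le (h : IsNormalized g L) {k : ℕ} (hk : g ≤ k) :
    (L 0 0).coeff k = 0 := by
  obtain ⟨x, hx⟩ := h
  have := coeff_eq_zero_of_degree_lt ((hx 0 0).trans_le (Nat.cast_le.mpr hk))
  simpa using this

theorem IsNormalized.coeff10 (h : IsNormalized g L) : (L 1 0).coeff (g + 1) = 1 := by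
  obtain ⟨x, hx⟩ := h
  have := coeff_eq_zero_of_degree_lt ((hx 1 0).trans (Nat.cast_lt.mpr g.lt_succ_self))
  simp [coeff_X_pow] at this
  linear_combination this

theorem IsNormalized.coeff10_of_lt (h : IsNormalized g L) {k : ℕ} (hk : g + 1 < k) :
    (L 1 0).coeff k = 0 := by
  obtain ⟨x, hx⟩ := h
  have := coeff_eq_zero_of_degree_lt ((hx 1 0).trans (Nat.cast_lt.mpr (show g < k by omega)))
  simpa [coeff_X_pow, show k ≠ g + 1 from by omega, show k ≠ g from by omega] using this

theorem IsNormalized.vanish00 (h : IsNormalized g L) :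
    VanishBelow (puiseuxHom (L 0 0)) (-(2 * (g - 1))) :=
  vanishBelow_puiseuxHom fun _ hk => h.coeff00_of_le (by omega)

theorem IsNormalized.vanish01 (h : IsNormalized g L) :
    VanishBelow (puiseuxHom (L 0 1)) (-(2 * g)) :=
  vanishBelow_puiseuxHom fun _ hk => h.coeff01_of_lt (by omega)

theorem IsNormalized.vanish10 (h : IsNormalized g L) :
    VanishBelow (puiseuxHom (L 1 0)) (-(2 * (g + 1))) :=
  vanishBelow_puiseuxHom fun _ hk => h.coeff10_of_lt (by omega)

theorem irregularPart_mul_self (c : ℕ → ℂ) (g : ℕ) : irregularPart c g * irregularPart c g =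
    HahnSeries.single 2 1 * puiseuxHom (timePoly c g ^ 2) := by
  rw [irregularPart, mul_mul_mul_comm, HahnSeries.single_mul_single, ← map_mul, mul_one,
    one_add_one_eq_two, sq]

/-- A connection with irregular times `D s` is traceless, and its determinant is determined up to
terms of low degree. -/
theorem HasIrregularTimes.trace_eq_zero_and_det
    (hI : HasIrregularTimes g L (irregularTimes g (timeMap g s))) (hN : IsNormalized g L) :
    L 1 1 = -L 0 0 ∧ ∀ k : ℕ, g < k → (X * L.det + timePoly (c g s) g ^ 2).coeff k = 0 := by
  obtain ⟨F, hF, hFL⟩ := hI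
  rw [irregularEntry_eq g s (one_pow 2), irregularEntry_eq g s (by norm_num)] at hFL
  obtain ⟨η, hη⟩ : ∃ η, η = irregularPart (c g s) g := ⟨_, rfl⟩
  obtain ⟨ω, hω⟩ : ∃ ω : LaurentSeries ℂ, ω = HahnSeries.single 2 (1 / 4) := ⟨_, rfl⟩
  have vω : VanishBelow ω 2 := hω ▸ vanishBelow_single _ _
  have vη : VanishBelow η (-(2 * g) - 1) := hη ▸ vanishBelow_irregularPart _ _
  rw [← hη, ← hω, map_neg, map_one, one_mul, neg_one_mul] at hFL
  obtain ⟨a, ha⟩ : ∃ a, a = puiseuxHom (L 0 0) := ⟨_, rfl⟩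
  obtain ⟨b, hb⟩ : ∃ b, b = puiseuxHom (L 0 1) := ⟨_, rfl⟩
  obtain ⟨c', hc⟩ : ∃ c', c' = puiseuxHom (L 1 0) := ⟨_, rfl⟩
  obtain ⟨e, he⟩ : ∃ e, e = puiseuxHom (L 1 1) := ⟨_, rfl⟩
  have D00 : Matrix.diagonal ![η - ω, -η - ω] 0 0 = η - ω := Matrix.diagonal_apply_eq _ 0
  have D11 : Matrix.diagonal ![η - ω, -η - ω] 1 1 = -η - ω := Matrix.diagonal_apply_eq _ 1
  have D01 : Matrix.diagonal ![η - ω, -η - ω] 0 1 = 0 :=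
    Matrix.diagonal_apply_ne _ (by decide)
  have D10 : Matrix.diagonal ![η - ω, -η - ω] 1 0 = 0 :=
    Matrix.diagonal_apply_ne _ (by decide)
  have e00 := congrFun (congrFun hFL 0) 0
  have e01 := congrFun (congrFun hFL 0) 1
  have e10 := congrFun (congrFun hFL 1) 0
  have e11 := congrFun (congrFun hFL 1) 1
  simp only [Matrix.add_apply, Matrix.map_apply, Matrix.mul_apply,
    Fin.sum_univ_two, toPuiseux_eq, ← ha, ← hb, ← hc, ← he] at e00 e01 e10 e11
  rw [D00, D10, mul_zero, add_zero] at e00 e10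
  rw [D01, D11, mul_zero, zero_add] at e01 e11
  -- By Liouville's formula `tr L` is the logarithmic derivative of `det F` minus `2 ω`, hence
  -- `O(1/λ)`; a polynomial of that size is zero.
  have htr : L 0 0 + L 1 1 = 0 := by
    refine puiseuxHom_eq_zero ?_
    rw [map_add, ← ha, ← he]
    obtain ⟨n, ei, hei, hv, hvi⟩ := exists_inverse_of_ne_zero hF.ne_zero
    have hdet : lamDeriv F.det - F.det * (2 * ω) = (a + e) * F.det := by
      rw [Matrix.det_fin_two, lamDeriv_sub, lamDeriv_mul, lamDeriv_mul]
      linear_combination F 1 1 * e00 - F 1 0 * e01 - F 0 1 * e10 + F 0 0 * e11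
    have : a + e = ei * lamDeriv F.det - 2 * ω := by
      linear_combination (-(a + e) - 2 * ω) * hei - ei * hdet
    rw [this, two_mul]
    exact ((vanishBelow_logDeriv hv hvi).sub (vω.add vω)).mono (by norm_num)
  have htr' : L 1 1 = -L 0 0 := by linear_combination htr
  refine ⟨htr', ?_⟩
  have hea : e = -a := by rw [he, htr', map_neg, ha]
  have va : VanishBelow a (-(2 * (g - 1))) := ha ▸ hN.vanish00
  have vb : VanishBelow b (-(2 * g)) := hb ▸ hN.vanish01
  have b1 : b.coeff (-(2 * g)) = 1 := by rw [hb, coeff_puiseuxHom, hN.coeff01]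
  -- If `F₁₁` vanished, the first equation would force `b F₂₁ = 0`, hence a zero first column.
  have hf : F 0 0 ≠ 0 := by
    intro h0
    obtain ⟨bi, hbi, -⟩ := exists_inverse_of_leading vb b1
    have h1 : F 1 0 = 0 := by
      have : lamDeriv (0 : LaurentSeries ℂ) = 0 := by rw [lamDeriv_eq, map_zero, mul_zero]
      rw [h0, this] at e00
      linear_combination (-F 1 0) * hbi - bi * e00
    apply hF.ne_zero
    rw [Matrix.det_fin_two, h0, h1]; ring
  obtain ⟨n, fi, hfi, hv, hvi⟩ := exists_inverse_of_ne_zero hf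
  obtain ⟨r, hr⟩ : ∃ r, r = fi * F 1 0 := ⟨_, rfl⟩
  have hr' : F 1 0 = r * F 0 0 := by rw [hr]; linear_combination (-F 1 0) * hfi
  obtain ⟨κ, hκ⟩ : ∃ κ, κ = fi * lamDeriv (F 0 0) - ω := ⟨_, rfl⟩
  have vκ : VanishBelow κ 2 := hκ ▸ (vanishBelow_logDeriv hv hvi).sub vω
  have hab : a + b * r = η + κ := by
    rw [hκ, hr]; linear_combination (-a + η - ω) * hfi - fi * e00
  rw [hr', lamDeriv_mul] at e10
  -- Riccati equation for the ratio `r = F₂₁ / F₁₁` of the first column.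
  have hδ : lamDeriv r = c' - 2 * a * r - b * r * r := by
    rw [hea] at e10
    linear_combination fi * e10 - fi * r * e00 + (-(fi * b * r)) * hr' +
      (c' - 2 * a * r - b * r * r - lamDeriv r) * hfi
  have vr : VanishBelow r (-1) := by
    refine VanishBelow.of_mul_left vb b1 ?_
    have : b * r = η + κ - a := by linear_combination hab
    rw [this]
    exact ((vη.add (vκ.mono (by omega))).sub (va.mono (by omega))).mono (by omega)
  -- Eliminating `c'` by the Riccati equation turns `-det L` into `(a + b r)² + b r'`, and `a + b r`
  -- is `η` up to `O(1/λ)`. The first column alone determines the spectral curve in the required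
  -- range.
  have hdet : -(a * e - b * c') - η * η = b * lamDeriv r + κ * (2 * η + κ) := by
    rw [hea, hδ]
    linear_combination (a + b * r + η + κ) * hab
  have vdet : VanishBelow (-(a * e - b * c') - η * η) (1 - 2 * g) := by
    rw [hdet, two_mul]
    exact ((vb.mul vr.lamDeriv).mono (by omega)).add
      ((vκ.mul ((vη.add vη).add (vκ.mono (by omega)))).mono (by omega))
  intro k hk
  have h1 : puiseuxHom (X * L.det + timePoly (c g s) g ^ 2) =
      -(HahnSeries.single (-2) 1 * (-(a * e - b * c') - η * η)) := by
    have h2 : HahnSeries.single (-2) 1 * (η * η) = puiseuxHom (timePoly (c g s) g ^ 2) := by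
      rw [hη, irregularPart_mul_self, ← mul_assoc, HahnSeries.single_mul_single]
      norm_num
    rw [map_add, map_mul, puiseuxHom_X, ← h2, Matrix.det_fin_two, map_sub, map_mul, map_mul, ← ha,
      ← hb, ← hc, ← he]
    ring
  rw [← coeff_puiseuxHom, h1, HahnSeries.coeff_neg, vdet.single_mul (-2) 1 _ (by omega), neg_zero]

end IrregularTimes

/-! ### Construction of formal solutions from the spectral curve -/

section FormalSolution

/-- A formal solution `1 + O(w)` of a scalar equation whose coefficient is `O(w³)`. -/
theorem exists_scalar_solution {q : LaurentSeries ℂ} (hq : VanishBelow q 3) :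
    ∃ f : LaurentSeries ℂ, f.coeff 0 = 1 ∧ lamDeriv f = q * f := by
  obtain ⟨p, hp⟩ : ∃ p, p = HahnSeries.single (-2) (2 : ℂ) * q := ⟨_, rfl⟩
  have vp : VanishBelow p 1 := hp ▸ (hq.single_mul (-2) 2).mono (by norm_num)
  -- Inverse of the Euler operator. At index zero the convention `0⁻¹ = 0` applies; there the
  -- constant `1` in the fixed point equation prescribes the coefficient.
  obtain ⟨I, hI⟩ : ∃ I : LaurentSeries ℂ →+ LaurentSeries ℂ, ∀ f n,
      (I f).coeff n = -(n : ℂ)⁻¹ * f.coeff n :=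
    ⟨gradedHom fun n => AddMonoidHom.mulLeft (-(n : ℂ)⁻¹), fun _ _ => rfl⟩
  have hIv : ∀ {f : LaurentSeries ℂ} {n : ℤ}, VanishBelow f n → VanishBelow (I f) n :=
    fun hf k hk => by rw [hI, hf k hk, mul_zero]
  have v1 : ∀ {f : LaurentSeries ℂ}, VanishBelow (f - 1) 1 → VanishBelow f 0 := fun {f} hf => by
    have := (hf.mono zero_le_one).add (vanishBelow_one (K := ℂ))
    rwa [sub_add_cancel] at this
  obtain ⟨f, hf, hTf⟩ := exists_fixedPoint_laurentSeries (fun f => 1 + I (p * f)) 1 1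
    (fun f hf => by
      rw [add_sub_cancel_left]
      exact hIv ((vp.mul (v1 hf)).mono (by norm_num)))
    (fun f h n _ _ _ hfh => by
      have e : 1 + I (p * f) - (1 + I (p * h)) = I (p * (f - h)) := by
        rw [mul_sub, map_sub]; ring
      rw [e]
      exact hIv ((vp.mul hfh).mono (by omega)))
  have f0 : f.coeff 0 = 1 := by
    have := hf 0 (by norm_num)
    rw [HahnSeries.coeff_sub, HahnSeries.coeff_one, if_pos rfl] at this
    linear_combination this
  refine ⟨f, f0, ?_⟩
  have hE : eulerDerivation ℂ f = p * f := by
    ext k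
    rw [coeff_eulerDerivation]
    by_cases hk : k = 0
    · rw [hk, (vp.mul (v1 hf)) 0 (by norm_num)]; simp
    · have := congrArg (fun f => HahnSeries.coeff f k) hTf
      simp only [HahnSeries.coeff_add, HahnSeries.coeff_one, if_neg hk, hI, zero_add] at this
      rw [← this]
      have : (k : ℂ) ≠ 0 := by exact_mod_cast hk
      field_simp
  rw [lamDeriv_eq, hE, hp, ← mul_assoc, ← mul_assoc, HahnSeries.single_mul_single]
  norm_num

/-- The leading terms force `r ≈ ε z`, since `c/b ≈ z²`. Starting there, `r ↦ r + σ · (residual)` is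
a Newton iteration with frozen slope: the linearized residual is `-2 b r ≈ -2 ε z^{2g+1}`, and `σ =
(ε/2) z^{-2g-1}` is minus its approximate inverse because `ε² = 1`. -/
theorem exists_riccati_solution {a b c : LaurentSeries ℂ} {g : ℕ} {ε : ℂ} (hε : ε * ε = 1)
    (va : VanishBelow a (-(2 * (g - 1)))) (vb : VanishBelow b (-(2 * g)))
    (vc : VanishBelow c (-(2 * (g + 1)))) (b1 : b.coeff (-(2 * g)) = 1)
    (c1 : c.coeff (-(2 * (g + 1))) = 1) :
    ∃ r : LaurentSeries ℂ, VanishBelow r (-1) ∧ r.coeff (-1) = ε ∧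
      lamDeriv r = c - 2 * a * r - b * r * r := by
  obtain ⟨σ, hσ⟩ : ∃ σ : LaurentSeries ℂ, σ = HahnSeries.single (2 * (g : ℤ) + 1) (ε / 2) :=
    ⟨_, rfl⟩
  have vσ : VanishBelow σ (2 * g + 1) := hσ ▸ vanishBelow_single _ _
  have σ1 : σ.coeff (2 * g + 1) = ε / 2 := by rw [hσ, HahnSeries.coeff_single_same]
  have hσ0 : σ ≠ 0 := by
    intro h
    rw [h] at σ1
    have : ε = 0 := by
      have h1 : (0 : ℂ) = ε / 2 := σ1
      linear_combination -2 * h1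
    simp [this] at hε
  have v0 : ∀ {r : LaurentSeries ℂ}, VanishBelow (r - HahnSeries.single (-1) ε) 0 →
      VanishBelow r (-1) ∧ r.coeff (-1) = ε := fun {r} hr => by
    constructor
    · have := (hr.mono (by norm_num)).add (vanishBelow_single (-1) ε)
      rwa [sub_add_cancel] at this
    · have := hr (-1) (by norm_num)
      rw [HahnSeries.coeff_sub, HahnSeries.coeff_single_same] at this
      linear_combination this
  have v2a : VanishBelow (2 * a) (-(2 * (g - 1))) := by rw [two_mul]; exact va.add va
  obtain ⟨r, hr, hT⟩ := exists_fixedPoint_laurentSeries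
    (fun r => r + σ * (c - 2 * a * r - b * r * r - lamDeriv r)) (HahnSeries.single (-1) ε) 0
    (fun r hr => by
      obtain ⟨vr, r1⟩ := v0 hr
      have e : r + σ * (c - 2 * a * r - b * r * r - lamDeriv r) - HahnSeries.single (-1) ε =
        (r - HahnSeries.single (-1) ε) + σ * ((c - b * r * r) - 2 * a * r - lamDeriv r) := by ring
      rw [e]
      refine hr.add (((vσ.mul (n := -(2 * g) - 1) ?_)).mono (by omega))
      refine VanishBelow.sub (VanishBelow.sub ?_ ((v2a.mul vr).mono (by omega)))
        (vr.lamDeriv.mono (by omega))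
      have vbr := (vb.mul vr).mul vr
      have h1 : VanishBelow (c - b * r * r) (-(2 * (g + 1))) := vc.sub (vbr.mono (by omega))
      refine (h1.succ ?_).mono (by omega)
      have h2 := (vb.mul vr).coeff_mul vr
      rw [vb.coeff_mul vr, b1, r1,
        show (-(2 * (g : ℤ)) + -1 + -1) = -(2 * (g + 1)) by ring] at h2
      rw [HahnSeries.coeff_sub, h2, c1]
      linear_combination -hε)
    (fun r h n hn hr hh hrh => by
      obtain ⟨vr, r1⟩ := v0 hr
      obtain ⟨vh, h1⟩ := v0 hh
      have e : r + σ * (c - 2 * a * r - b * r * r - lamDeriv r)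
          - (h + σ * (c - 2 * a * h - b * h * h - lamDeriv h)) =
          (1 - σ * (b * (r + h)) - σ * (2 * a)) * (r - h) - σ * lamDeriv (r - h) := by
        rw [lamDeriv_sub]; ring
      rw [e]
      refine VanishBelow.sub ?_ ((vσ.mul hrh.lamDeriv).mono (by omega))
      refine VanishBelow.mono (VanishBelow.mul (m := 1) ?_ hrh) (by omega)
      refine VanishBelow.sub ?_ ((vσ.mul v2a).mono (by omega))
      have h2 := vσ.mul (vb.mul (vr.add vh))
      refine VanishBelow.mono (VanishBelow.succ (n := 0) ?_ ?_) (by norm_num)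
      · exact (vanishBelow_one).sub (h2.mono (by omega))
      · have h3 := vσ.coeff_mul (vb.mul (vr.add vh))
        rw [vb.coeff_mul (vr.add vh), σ1, b1, HahnSeries.coeff_add, r1, h1,
          show (2 * (g : ℤ) + 1 + (-(2 * g) + -1)) = 0 by ring] at h3
        rw [HahnSeries.coeff_sub, h3, HahnSeries.coeff_one, if_pos rfl]
        linear_combination -hε)
  obtain ⟨vr, r1⟩ := v0 hr
  refine ⟨r, vr, r1, ?_⟩
  have h1 : σ * (c - 2 * a * r - b * r * r - lamDeriv r) = 0 := by linear_combination hT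
  obtain ⟨-, σi, hσi, -⟩ := exists_inverse_of_ne_zero hσ0
  linear_combination (-σi) * h1 + (c - 2 * a * r - b * r * r - lamDeriv r) * hσi

variable {g : ℕ} {L : PolyMat} {s : Fin g → ℂ}

/-- A column of the formal fundamental solution. -/
theorem exists_formal_column (hN : IsNormalized g L) (htr : L 1 1 = -L 0 0)
    (hdet : ∀ k : ℕ, g < k → (X * L.det + timePoly (c g s) g ^ 2).coeff k = 0)
    {ε : ℂ} (hε : ε * ε = 1) :
    ∃ f r : LaurentSeries ℂ, f ≠ 0 ∧ r.coeff (-1) = ε ∧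
      lamDeriv f + f * irregularEntry g (irregularTimes g (timeMap g s)) ε =
        toPuiseux (L 0 0) * f + toPuiseux (L 0 1) * (r * f) ∧
      lamDeriv (r * f) + r * f * irregularEntry g (irregularTimes g (timeMap g s)) ε =
        toPuiseux (L 1 0) * f + toPuiseux (L 1 1) * (r * f) := by
  have hε2 : ε ^ 2 = 1 := by rw [sq, hε]
  obtain ⟨η, hη⟩ : ∃ η, η = irregularPart (c g s) g := ⟨_, rfl⟩
  obtain ⟨ω, hω⟩ : ∃ ω : LaurentSeries ℂ, ω = HahnSeries.single 2 (1 / 4) := ⟨_, rfl⟩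
  obtain ⟨a, ha⟩ : ∃ a, a = puiseuxHom (L 0 0) := ⟨_, rfl⟩
  obtain ⟨b, hb⟩ : ∃ b, b = puiseuxHom (L 0 1) := ⟨_, rfl⟩
  obtain ⟨c', hc⟩ : ∃ c', c' = puiseuxHom (L 1 0) := ⟨_, rfl⟩
  have va : VanishBelow a (-(2 * (g - 1))) := ha ▸ hN.vanish00
  have vb : VanishBelow b (-(2 * g)) := hb ▸ hN.vanish01
  have vc : VanishBelow c' (-(2 * (g + 1))) := hc ▸ hN.vanish10
  have b1 : b.coeff (-(2 * g)) = 1 := by rw [hb, coeff_puiseuxHom, hN.coeff01]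
  have c1 : c'.coeff (-(2 * (g + 1))) = 1 := by
    rw [hc, ← hN.coeff10, ← coeff_puiseuxHom]; push_cast; rfl
  have vω : VanishBelow ω 2 := hω ▸ vanishBelow_single _ _
  have vη : VanishBelow η (-(2 * g) - 1) := hη ▸ vanishBelow_irregularPart _ _
  have η1 : η.coeff (-(2 * g) - 1) = 1 := by
    rw [hη, coeff_irregularPart]
    simp [PainleveOne.c]
  have vdet : VanishBelow (a * a + b * c' - η * η) (2 - 2 * g) := by
    have h1 : a * a + b * c' - η * η =
        -(HahnSeries.single 2 1 * puiseuxHom (X * L.det + timePoly (PainleveOne.c g s) g ^ 2)) := by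
      rw [hη, irregularPart_mul_self, map_add, map_mul, puiseuxHom_X, Matrix.det_fin_two, htr,
        map_sub, map_mul, map_mul, map_neg, ← ha, ← hb, ← hc, mul_add, ← mul_assoc,
        HahnSeries.single_mul_single]
      norm_num
      ring
    rw [h1]
    exact ((vanishBelow_puiseuxHom (n := g) fun k hk => hdet k (by omega)).single_mul 2 1).neg.mono
      (by omega)
  obtain ⟨r, vr, r1, hr⟩ := exists_riccati_solution hε va vb vc b1 c1
  obtain ⟨v, hv⟩ : ∃ v, v = a + b * r := ⟨_, rfl⟩
  have vv : VanishBelow v (-(2 * g) - 1) :=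
    hv ▸ (va.mono (by omega)).add ((vb.mul vr).mono (by omega))
  have v1 : v.coeff (-(2 * g) - 1) = ε := by
    have := vb.coeff_mul vr
    rw [b1, r1, one_mul, ← sub_eq_add_neg] at this
    rw [hv, HahnSeries.coeff_add, va _ (by omega), this, zero_add]
  -- `v² - η²` is small by the spectral curve, so `v` is close to `ε η`; dividing by `v + ε η`, of
  -- leading coefficient `2 ε`, gives the estimate.
  have vq : VanishBelow (v - (cst ε * η - ω)) 3 := by
    have ve : VanishBelow (v + cst ε * η) (-(2 * g) - 1) := vv.add (vη.cst_mul ε)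
    have e1 : (v + cst ε * η).coeff (-(2 * g) - 1) = 2 * ε := by
      rw [HahnSeries.coeff_add, v1, coeff_cst_mul, η1]; ring
    refine VanishBelow.of_mul_left (ve.cst_mul (ε / 2)) ?_ (n := 3) ?_
    · rw [coeff_cst_mul, e1]; linear_combination hε
    have hεc : (cst ε : LaurentSeries ℂ) * cst ε = 1 := by rw [← map_mul, hε, map_one]
    have e : (cst (ε / 2) * (v + cst ε * η)) * (v - (cst ε * η - ω)) =
        cst (ε / 2) * ((a * a + b * c' - η * η) + (ω * (v + cst ε * η) - b * lamDeriv r)) := by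
      rw [hr]
      linear_combination (cst (ε / 2) * (v + a + b * r)) * hv - cst (ε / 2) * η * η * hεc
    rw [e]
    refine VanishBelow.cst_mul (VanishBelow.add (vdet.mono (by omega)) ?_) _
    have w1 := vω.mul ve
    have w2 := vb.mul vr.lamDeriv
    -- The term `1/(4 z²)` in the diagonal form, coming from `-(ln z)/2`, matters here: `ω (v + ε
    -- η)` and `b r'` both have leading coefficient `ε/2` and cancel. The remaining equation for the
    -- factor `f` then has no residue.
    refine (VanishBelow.succ (n := 1 - 2 * g) ((w1.mono (by omega)).sub (w2.mono (by omega)))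
      ?_).mono (by omega)
    have w3 := vω.coeff_mul ve
    have w4 := vb.coeff_mul vr.lamDeriv
    rw [show (2 + (-(2 * (g : ℤ)) - 1)) = 1 - 2 * g by ring] at w3
    rw [show (-(2 * (g : ℤ)) + (-1 + 2)) = 1 - 2 * g by ring] at w4
    rw [HahnSeries.coeff_sub, w3, w4, e1, b1, coeff_lamDeriv, hω, HahnSeries.coeff_single_same,
      show (-1 + 2 - 2 : ℤ) = -1 by norm_num, r1]
    push_cast
    ring
  obtain ⟨f, f0, hf⟩ := exists_scalar_solution vq
  refine ⟨f, r, ?_, r1, ?_, ?_⟩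
  · rintro rfl; simp at f0
  · rw [irregularEntry_eq g s hε2, ← hη, ← hω, toPuiseux_eq, toPuiseux_eq, ← ha, ← hb, hf, hv]
    ring
  · rw [irregularEntry_eq g s hε2, ← hη, ← hω, toPuiseux_eq, toPuiseux_eq, htr, map_neg, ← ha,
      ← hc, lamDeriv_mul, hf, hr, hv]
    ring

/-- The two choices of sign give two columns whose ratios begin with `z` and `-z`, so they are
independent. -/
theorem hasIrregularTimes_of_det (hN : IsNormalized g L) (htr : L 1 1 = -L 0 0)
    (hdet : ∀ k : ℕ, g < k → (X * L.det + timePoly (c g s) g ^ 2).coeff k = 0) :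
    HasIrregularTimes g L (irregularTimes g (timeMap g s)) := by
  obtain ⟨f, r, hf, hr, h0, h1⟩ := exists_formal_column hN htr hdet (ε := 1) (by norm_num)
  obtain ⟨f', r', hf', hr', h0', h1'⟩ := exists_formal_column hN htr hdet (ε := -1) (by norm_num)
  refine ⟨!![f, f'; r * f, r' * f'], ?_, ?_⟩
  · have e : (!![f, f'; r * f, r' * f'] : Matrix (Fin 2) (Fin 2) (LaurentSeries ℂ)).det
        = f * f' * (r' - r) := by
      rw [Matrix.det_fin_two_of]; ring
    rw [e, isUnit_iff_ne_zero]
    refine mul_ne_zero (mul_ne_zero hf hf') fun h => ?_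
    have := congrArg (fun f => HahnSeries.coeff f (-1)) h
    simp [HahnSeries.coeff_sub, hr, hr'] at this
    norm_num at this
  · ext1 i j
    rw [Matrix.add_apply, Matrix.mul_diagonal, Matrix.mul_apply, Fin.sum_univ_two]
    fin_cases i <;> fin_cases j
    exacts [h0, h0', h1, h1']

end FormalSolution

/-! ### Calculus of partial derivatives -/

section PartialDerivatives

variable {g : ℕ} {F G : (Fin g → ℂ) → ℂ} {s : Fin g → ℂ} {i j : Fin g}

theorem pderiv_congr {Ω : Set (Fin g → ℂ)} (hΩ : IsOpen Ω) (h : Set.EqOn F G Ω) (hs : s ∈ Ω) :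
    pderiv i F s = pderiv i G s := by
  rw [pderiv, pderiv, Filter.EventuallyEq.fderiv_eq (h.eventuallyEq_of_mem (hΩ.mem_nhds hs))]

theorem pderiv_add (hF : AnalyticAt ℂ F s) (hG : AnalyticAt ℂ G s) :
    pderiv i (fun t => F t + G t) s = pderiv i F s + pderiv i G s := by
  rw [pderiv, fderiv_fun_add hF.differentiableAt hG.differentiableAt]
  rfl

theorem pderiv_mul (hF : AnalyticAt ℂ F s) (hG : AnalyticAt ℂ G s) :
    pderiv i (fun t => F t * G t) s = F s * pderiv i G s + G s * pderiv i F s := by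
  rw [pderiv, fderiv_fun_mul hF.differentiableAt hG.differentiableAt]
  rfl

theorem pderiv_const_mul (hF : AnalyticAt ℂ F s) (a : ℂ) :
    pderiv i (fun t => a * F t) s = a * pderiv i F s := by
  rw [pderiv, fderiv_const_mul hF.differentiableAt]
  rfl

theorem pderiv_const (a : ℂ) : pderiv i (fun _ => a) s = 0 := by
  rw [pderiv, fderiv_const_apply]; rfl

theorem pderiv_coord : pderiv i (fun t => t j) s = if i = j then 1 else 0 := by
  have h : HasFDerivAt (fun t : Fin g → ℂ => t j)
      (ContinuousLinearMap.proj (R := ℂ) (φ := fun _ => ℂ) j) s := hasFDerivAt_apply j s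
  rw [pderiv, h.fderiv, ContinuousLinearMap.proj_apply, Pi.single_apply]
  simp only [eq_comm]

theorem analyticOnNhd_pderiv {Ω : Set (Fin g → ℂ)} (hF : AnalyticOnNhd ℂ F Ω) (i : Fin g) :
    AnalyticOnNhd ℂ (pderiv i F) Ω :=
  (ContinuousLinearMap.apply ℂ ℂ (Pi.single i (1 : ℂ) : Fin g → ℂ)).comp_analyticOnNhd hF.fderiv

theorem analyticOnNhd_coord (j : Fin g) (Ω : Set (Fin g → ℂ)) :
    AnalyticOnNhd ℂ (fun s : Fin g → ℂ => s j) Ω := fun s _ =>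
  (ContinuousLinearMap.proj (R := ℂ) (φ := fun _ => ℂ) j).analyticAt s

theorem pderiv_comm (hF : AnalyticAt ℂ F s) :
    pderiv i (pderiv j F) s = pderiv j (pderiv i F) s := by
  have h1 : ∀ i j : Fin g, pderiv i (pderiv j F) s =
      fderiv ℂ (fderiv ℂ F) s (Pi.single i 1) (Pi.single j 1) := by
    intro i j
    have h2 := (hF.fderiv.differentiableAt.hasFDerivAt.clm_apply
      (hasFDerivAt_const (Pi.single j (1 : ℂ) : Fin g → ℂ) s)).fderiv
    change fderiv ℂ (fun t => fderiv ℂ F t (Pi.single j 1)) s (Pi.single i 1) = _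
    rw [h2]
    simp
  rw [h1, h1]
  exact (hF.contDiffAt (n := 2)).isSymmSndFDerivAt (by simp) _ _

end PartialDerivatives

/-! ### The differential algebra of holomorphic functions on an open set -/

section HolomorphicFunctions

open TopologicalSpace

variable {g : ℕ} {Ω : Opens (Fin g → ℂ)}

/-- The extension by zero of a function on an open set. -/
def zeroExt (f : Ω → ℂ) : (Fin g → ℂ) → ℂ := Function.extend Subtype.val f 0

theorem zeroExt_apply (f : Ω → ℂ) (s : Ω) : zeroExt f s = f s :=
  Subtype.val_injective.extend_apply _ _ _

theorem analyticOnNhd_zeroExt {f : Ω → ℂ} {F : (Fin g → ℂ) → ℂ} (hF : AnalyticOnNhd ℂ F Ω)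
    (h : ∀ s : Ω, F s = f s) : AnalyticOnNhd ℂ (zeroExt f) Ω :=
  hF.congr Ω.isOpen fun s hs => by
    rw [h ⟨s, hs⟩]; exact (zeroExt_apply f ⟨s, hs⟩).symm

variable (Ω) in
/-- The algebra of holomorphic functions on an open set. -/
def Hol : Subalgebra ℂ (Ω → ℂ) where
  carrier := {f | AnalyticOnNhd ℂ (zeroExt f) Ω}
  mul_mem' {f h} hf hh := analyticOnNhd_zeroExt (AnalyticOnNhd.mul hf hh) fun s => by
    simp [zeroExt_apply]
  add_mem' {f h} hf hh := analyticOnNhd_zeroExt (AnalyticOnNhd.add hf hh) fun s => by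
    simp [zeroExt_apply]
  algebraMap_mem' a := analyticOnNhd_zeroExt (F := fun _ => a) analyticOnNhd_const fun s => rfl

/-- The restriction of a function that is analytic on `Ω`. -/
def Hol.of (F : (Fin g → ℂ) → ℂ) (hF : AnalyticOnNhd ℂ F Ω) : Hol Ω :=
  ⟨fun s => F s, analyticOnNhd_zeroExt hF fun _ => rfl⟩

/-- Evaluation at a point. -/
def Hol.ev (s : Ω) : Hol Ω →ₐ[ℂ] ℂ := (Pi.evalAlgHom ℂ (fun _ : Ω => ℂ) s).comp (Hol Ω).val

theorem Hol.ev_of (F : (Fin g → ℂ) → ℂ) (hF : AnalyticOnNhd ℂ F Ω) (s : Ω) :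
    Hol.ev s (Hol.of F hF) = F s := rfl

theorem Hol.ext_ev {f h : Hol Ω} (H : ∀ s, Hol.ev s f = Hol.ev s h) : f = h :=
  Subtype.ext (funext H)

/-- The extension by zero of a holomorphic function. -/
def Hol.toFun (f : Hol Ω) : (Fin g → ℂ) → ℂ := zeroExt f.1

theorem Hol.toFun_apply (f : Hol Ω) (s : Ω) : (Hol.toFun f) s = Hol.ev s f := zeroExt_apply _ s

theorem Hol.analyticOnNhd (f : Hol Ω) : AnalyticOnNhd ℂ (Hol.toFun f) Ω := f.2

/-- The partial derivatives, as derivations of the algebra of holomorphic functions. -/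
def Hol.D (i : Fin g) : Derivation ℂ (Hol Ω) (Hol Ω) :=
  Derivation.mk'
    { toFun := fun f => Hol.of (pderiv i (Hol.toFun f)) (analyticOnNhd_pderiv (Hol.analyticOnNhd f) i)
      map_add' := fun f h => Hol.ext_ev fun s => by
        rw [map_add, Hol.ev_of, Hol.ev_of, Hol.ev_of,
          ← pderiv_add ((Hol.analyticOnNhd f) s s.2) ((Hol.analyticOnNhd h) s s.2)]
        exact pderiv_congr Ω.isOpen (fun t ht => by
          simp only [Hol.toFun_apply _ ⟨t, ht⟩, map_add]) s.2
      map_smul' := fun a f => Hol.ext_ev fun s => by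
        rw [RingHom.id_apply, map_smul, Hol.ev_of, Hol.ev_of, smul_eq_mul,
          ← pderiv_const_mul ((Hol.analyticOnNhd f) s s.2)]
        exact pderiv_congr Ω.isOpen (fun t ht => by
          simp only [Hol.toFun_apply _ ⟨t, ht⟩, map_smul, smul_eq_mul]) s.2 }
    (fun f h => Hol.ext_ev fun s => by
      simp only [LinearMap.coe_mk, AddHom.coe_mk, smul_eq_mul, map_add, map_mul]
      rw [Hol.ev_of, Hol.ev_of, Hol.ev_of, ← Hol.toFun_apply, ← Hol.toFun_apply,
        ← pderiv_mul ((Hol.analyticOnNhd f) s s.2) ((Hol.analyticOnNhd h) s s.2)]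
      exact pderiv_congr Ω.isOpen (fun t ht => by
        simp only [Hol.toFun_apply _ ⟨t, ht⟩, map_mul]) s.2)

theorem Hol.ev_D (i : Fin g) (f : Hol Ω) (s : Ω) : Hol.ev s (Hol.D i f) = pderiv i (Hol.toFun f) s := rfl

theorem Hol.eqOn_toFun_of {F : (Fin g → ℂ) → ℂ} (hF : AnalyticOnNhd ℂ F Ω) :
    Set.EqOn (Hol.toFun (Hol.of F hF)) F Ω := fun s hs => Hol.toFun_apply _ ⟨s, hs⟩

theorem Hol.ev_D_of {F : (Fin g → ℂ) → ℂ} (hF : AnalyticOnNhd ℂ F Ω) (i : Fin g) (s : Ω) :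
    Hol.ev s (Hol.D i (Hol.of F hF)) = pderiv i F s :=
  pderiv_congr Ω.isOpen (Hol.eqOn_toFun_of hF) s.2

theorem Hol.D_of {F : (Fin g → ℂ) → ℂ} (hF : AnalyticOnNhd ℂ F Ω) (i : Fin g) :
    Hol.D i (Hol.of F hF) = Hol.of (pderiv i F) (analyticOnNhd_pderiv hF i) :=
  Hol.ext_ev fun s => Hol.ev_D_of hF i s

theorem Hol.of_toFun (f : Hol Ω) : Hol.of (Hol.toFun f) (Hol.analyticOnNhd f) = f :=
  Hol.ext_ev fun s => Hol.toFun_apply f s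

theorem Hol.D_comm (i j : Fin g) (f : Hol Ω) : Hol.D i (Hol.D j f) = Hol.D j (Hol.D i f) := by
  rw [← Hol.of_toFun f, Hol.D_of, Hol.D_of, Hol.D_of, Hol.D_of]
  exact Hol.ext_ev fun s => pderiv_comm ((Hol.analyticOnNhd f) s s.2)

/-- The coordinate functions. -/
def Hol.coord (j : Fin g) : Hol Ω :=
  Hol.of (fun s => s j) (analyticOnNhd_coord j Ω)

theorem Hol.D_coord (i j : Fin g) : Hol.D i (Hol.coord j : Hol Ω) = if i = j then 1 else 0 :=
  Hol.ext_ev fun s => by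
    rw [Hol.coord, Hol.ev_D_of, pderiv_coord]
    split_ifs <;> simp

end HolomorphicFunctions

/-! ### The resolvent equations as a recursion -/

section Recursion

theorem sum_antidiagonal_eq_sum_fin {M : Type*} [AddCommMonoid M] (f : ℕ → ℕ → M) (l : ℕ) :
    ∑ ij ∈ Finset.HasAntidiagonal.antidiagonal l, f ij.1 ij.2
      = ∑ i : Fin (l + 1), f i.val (l - i.val) := by
  rw [Finset.Nat.sum_antidiagonal_eq_sum_range_succ f, Finset.sum_range]

theorem sum_antidiagonal_eq_sum_fin_rev {M : Type*} [AddCommMonoid M] (f : ℕ → ℕ → M) (l : ℕ) :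
    ∑ ij ∈ Finset.HasAntidiagonal.antidiagonal l, f ij.1 ij.2
      = ∑ i : Fin (l + 1), f (l - i.val) i.val := by
  rw [← sum_antidiagonal_eq_sum_fin fun i j => f j i, ← Finset.Nat.sum_antidiagonal_swap]
  rfl

/-- The unknown `b_{l+1}` occurs only in the two extreme terms of `4 ∑ b_i b_j`, hence with factor
`8 b₀`. This yields both the recursion for `R` and the uniqueness of its solution. -/
theorem resolventCoeff_eq {K : Type*} [CommRing K] (u : K) (b b' b'' : ℕ → K) (l : ℕ) :
    resolventCoeff u b b' b'' l = 8 * (b 0 * b (l + 1))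
      + (∑ i : Fin (l + 1), b' i.val * b' (l - i.val)
        + 4 * ∑ i : Fin l, b (i.val + 1) * b (l - i.val)
        - 4 * (u * ∑ i : Fin (l + 1), b i.val * b (l - i.val))
        - 2 * ∑ i : Fin (l + 1), b (l - i.val) * b'' i.val) := by
  have h : ∑ ij ∈ Finset.HasAntidiagonal.antidiagonal (l + 1), b ij.1 * b ij.2 =
      2 * (b 0 * b (l + 1)) + ∑ i : Fin l, b (i.val + 1) * b (l - i.val) := by
    rw [Finset.Nat.sum_antidiagonal_eq_sum_range_succ fun i j => b i * b j, Finset.sum_range_succ,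
      Finset.sum_range_succ', Finset.sum_range]
    simp only [Nat.add_sub_add_right, Nat.sub_zero, Nat.sub_self]
    ring
  rw [resolventCoeff, h, sum_antidiagonal_eq_sum_fin fun i j => b' i * b' j,
    sum_antidiagonal_eq_sum_fin fun i j => b i * b j,
    sum_antidiagonal_eq_sum_fin_rev fun i j => b i * b'' j]
  ring

/-- The resolvent equations determine the coefficients. -/
theorem eq_of_resolventCoeff {K : Type*} [CommRing K] [Algebra ℂ K] {D : K → K} {u : K}
    {b h : ℕ → K} {N : ℕ} (hb0 : b 0 = 1) (hh0 : h 0 = 1)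
    (hb : ∀ l ≤ N, resolventCoeff u b (fun k => D (b k)) (fun k => D (D (b k))) l = 0)
    (hh : ∀ l ≤ N, resolventCoeff u h (fun k => D (h k)) (fun k => D (D (h k))) l = 0)
    {k : ℕ} (hk : k ≤ N + 1) : b k = h k := by
  induction k using Nat.strong_induction_on with
  | _ k ih =>
    obtain _ | l := k
    · rw [hb0, hh0]
    have e1 := hb l (by omega)
    have e2 := hh l (by omega)
    rw [resolventCoeff_eq, hb0] at e1
    rw [resolventCoeff_eq, hh0] at e2
    have i1 : ∀ i : Fin (l + 1), b i.val = h i.val := fun i => ih _ i.2 (by omega)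
    have i2 : ∀ i : Fin (l + 1), b (l - i.val) = h (l - i.val) := fun i =>
      ih _ (by omega) (by omega)
    have i3 : ∀ i : Fin l, b (i.val + 1) = h (i.val + 1) := fun i => ih _ (by omega) (by omega)
    have i4 : ∀ i : Fin l, b (l - i.val) = h (l - i.val) := fun i => ih _ (by omega) (by omega)
    simp only [i1, i2, i3, i4] at e1
    rw [← sub_eq_zero]
    refine eq_zero_of_intCast_mul (n := 8) (by norm_num) ?_
    push_cast
    linear_combination e1 - e2

end Recursion

/-! ### Comparison of the concrete matrices with those over holomorphic functions -/

section Bridge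

open TopologicalSpace

variable {g : ℕ} [NeZero g] {Ω : Opens (Fin g → ℂ)} {u : (Fin g → ℂ) → ℂ}

theorem R_zero (u : (Fin g → ℂ) → ℂ) : R u 0 = fun _ => 1 := by
  funext s; rw [R]

theorem R_succ (u : (Fin g → ℂ) → ℂ) (l : ℕ) : R u (l + 1) = fun s =>
      -(1 / 8) * ∑ i : Fin (l + 1), dx (R u i.val) s * dx (R u (l - i.val)) s
      + u s / 2 * ∑ i : Fin (l + 1), R u i.val s * R u (l - i.val) s
      + 1 / 4 * ∑ i : Fin (l + 1), R u (l - i.val) s * dx (dx (R u i.val)) s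
      - 1 / 2 * ∑ i : Fin l, R u (i.val + 1) s * R u (l - i.val) s := by
  funext s; rw [R]

theorem analyticOnNhd_R (hu : AnalyticOnNhd ℂ u Ω) (k : ℕ) : AnalyticOnNhd ℂ (R u k) Ω := by
  induction k using Nat.strong_induction_on with
  | _ k ih =>
    obtain _ | l := k
    · rw [R_zero]; exact analyticOnNhd_const
    rw [R_succ]
    have hd : ∀ F : (Fin g → ℂ) → ℂ, AnalyticOnNhd ℂ F Ω → AnalyticOnNhd ℂ (dx F) Ω :=
      fun F hF => analyticOnNhd_pderiv hF 0
    refine AnalyticOnNhd.sub (AnalyticOnNhd.add (AnalyticOnNhd.add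
      (analyticOnNhd_const.mul ?_) (AnalyticOnNhd.mul (hu.div_const) ?_))
      (analyticOnNhd_const.mul ?_)) (analyticOnNhd_const.mul ?_)
    all_goals
      refine Finset.analyticOnNhd_fun_sum _ fun i _ => AnalyticOnNhd.mul ?_ ?_
    · exact hd _ (ih _ (by omega))
    · exact hd _ (ih _ (by omega))
    · exact ih _ (by omega)
    · exact ih _ (by omega)
    · exact ih _ (by omega)
    · exact hd _ (hd _ (ih _ (by omega)))
    · exact ih _ (by omega)
    · exact ih _ (by omega)

/-- The differential polynomials, as elements of the algebra of holomorphic functions. -/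
def holR (hu : AnalyticOnNhd ℂ u Ω) (k : ℕ) : Hol Ω := Hol.of (R u k) (analyticOnNhd_R hu k)

theorem holR_zero (hu : AnalyticOnNhd ℂ u Ω) : holR hu 0 = 1 :=
  Hol.ext_ev fun s => by rw [holR, Hol.ev_of, R_zero, map_one]

theorem ev_D_holR (hu : AnalyticOnNhd ℂ u Ω) (k : ℕ) (s : Ω) :
    Hol.ev s (Hol.D 0 (holR hu k)) = dx (R u k) s := Hol.ev_D_of _ 0 s

theorem ev_D_D_holR (hu : AnalyticOnNhd ℂ u Ω) (k : ℕ) (s : Ω) :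
    Hol.ev s (Hol.D 0 (Hol.D 0 (holR hu k))) = dx (dx (R u k)) s := by
  rw [holR, Hol.D_of, Hol.ev_D_of]; rfl

/-- The definition of `R` is this equation solved for its top coefficient. -/
theorem resolventCoeff_holR (hu : AnalyticOnNhd ℂ u Ω) (l : ℕ) :
    resolventCoeff (Hol.of u hu) (holR hu) (fun k => Hol.D 0 (holR hu k))
      (fun k => Hol.D 0 (Hol.D 0 (holR hu k))) l = 0 := by
  refine Hol.ext_ev fun s => ?_
  rw [resolventCoeff_eq, holR_zero]
  simp only [map_add, map_sub, map_mul, map_sum, map_ofNat, ev_D_holR, ev_D_D_holR, map_one,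
    map_zero]
  simp only [holR, Hol.ev_of]
  rw [R_succ]
  ring

variable {N : ℕ} {U : LMat (Hol Ω)}

theorem coeff_seriesAtInfinity (a : ℕ → ℂ) (k : ℕ) : (seriesAtInfinity a).coeff k = a k := by
  rw [seriesAtInfinity, coeff_ofPowerSeries, PowerSeries.coeff_mk]

theorem vanishBelow_seriesAtInfinity (a : ℕ → ℂ) : VanishBelow (seriesAtInfinity a) 0 :=
  vanishBelow_ofPowerSeries _

/-- The comparison stops at index `N`, up to which the resolvent equations of `U` are known. The
coefficient of index `k` of `C` involves that of index `k + 1` of `B`, hence the bound `N + 1` on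
the upper right entry. -/
theorem coeff_matU (hu : AnalyticOnNhd ℂ u Ω)
    (hU : IsResolventUpTo (Hol.D 0) (Hol.of u hu) N U)
    (hR : ∀ k : ℕ, k ≤ N + 1 → (U 0 1).coeff k = holR hu k) (s : Ω) {m : ℤ} (hm : m ≤ N)
    (i j : Fin 2) : (matU u s i j).coeff m = Hol.ev s ((U i j).coeff m) := by
  have hA : ∀ m : ℤ, m ≤ N → (seriesA u s).coeff m = Hol.ev s ((U 0 0).coeff m) := by
    intro m hm
    rcases lt_or_ge m 0 with h | h
    · rw [seriesA, vanishBelow_seriesAtInfinity _ _ h, hU.vanish00 _ (by omega), map_zero]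
    obtain ⟨k, rfl⟩ := Int.eq_ofNat_of_zero_le h
    have := congrArg (Hol.ev s) (hU.entry00 k (by omega))
    rw [map_mul, map_ofNat, map_neg, hR k (by omega), ev_D_holR] at this
    rw [seriesA, coeff_seriesAtInfinity]
    linear_combination (-1 / 2 : ℂ) * this
  have hB : ∀ m : ℤ, m ≤ N + 1 → (seriesB u s).coeff m = Hol.ev s ((U 0 1).coeff m) := by
    intro m hm
    rcases lt_or_ge m 0 with h | h
    · rw [seriesB, vanishBelow_seriesAtInfinity _ _ h, hU.vanish01 _ (by omega), map_zero]
    obtain ⟨k, rfl⟩ := Int.eq_ofNat_of_zero_le h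
    rw [seriesB, coeff_seriesAtInfinity, hR k (by omega)]; rfl
  fin_cases i <;> fin_cases j
  · exact hA m hm
  · exact hB m (by omega)
  · change (seriesC u s).coeff m = Hol.ev s ((U 1 0).coeff m)
    rw [seriesC, sub_mul, HahnSeries.coeff_add, HahnSeries.coeff_sub, HahnSeries.coeff_single_mul,
      HahnSeries.coeff_single_mul, hB _ (by omega), hB _ (by omega)]
    rcases lt_trichotomy m (-1) with h | h | h
    · rw [vanishBelow_seriesAtInfinity _ _ (by omega), hU.vanish01 _ (by omega),
        hU.vanish01 _ (by omega), hU.vanish10 _ (by omega), map_zero]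
      ring
    · rw [h, vanishBelow_seriesAtInfinity _ _ (by omega), hU.coeff10, hU.vanish01 (-1 - 0) (by omega),
        show (-1 - -1 : ℤ) = 0 by norm_num, hU.coeff01, map_one, map_zero]
      ring
    obtain ⟨k, rfl⟩ := Int.eq_ofNat_of_zero_le (show 0 ≤ m by omega)
    rw [coeff_seriesAtInfinity, hU.entry10 k (by omega), map_sub, map_add, map_mul, Hol.ev_of,
      sub_zero, sub_neg_eq_add]
    have := congrArg (fun f => Hol.ev s (Hol.D 0 f)) (hU.entry00 k (by omega))
    simp only [two_mul, map_add, map_neg, hR k (by omega), ev_D_D_holR] at this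
    rw [hR k (by omega)]
    linear_combination (-1 / 2 : ℂ) * this
  · change (-seriesA u s).coeff m = Hol.ev s ((U 1 1).coeff m)
    rw [HahnSeries.coeff_neg, hA m hm, hU.traceless, HahnSeries.coeff_neg, map_neg]

theorem coeff_calU (hu : AnalyticOnNhd ℂ u Ω)
    (hU : IsResolventUpTo (Hol.D 0) (Hol.of u hu) N U)
    (hR : ∀ k : ℕ, k ≤ N + 1 → (U 0 1).coeff k = holR hu k) (s : Ω) {n : ℕ} (hn : n ≤ N)
    (i j : Fin 2) (k : ℕ) :
    (calU u n s i j).coeff k = Hol.ev s ((truncU U n i j).coeff (-k)) := by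
  have h1 : (polyPart (HahnSeries.single (-(n : ℤ)) 1 * matU u s i j)).coeff k =
      Hol.ev s ((plusPart (lam (Hol Ω) ^ n * U i j)).coeff (-k)) := by
    rw [coeff_polyPart, HahnSeries.coeff_single_mul, one_mul, coeff_plusPart, if_pos (by omega),
      coeff_lam_pow_mul, sub_neg_eq_add, coeff_matU hu hU hR s (by omega)]
  have h2 : ((!![0, 0; C (R u (n + 1) s), 0] : PolyMat) i j).coeff k =
      Hol.ev s ((cst ((U 0 1).coeff (n + 1)) * E21 (Hol Ω) i j).coeff (-k)) := by
    have h3 := hR (n + 1) (by omega)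
    push_cast at h3
    rw [coeff_cst_mul, h3]
    fin_cases i <;> fin_cases j
    · simp
    · simp
    · change (C (R u (n + 1) s)).coeff k = Hol.ev s (holR hu (n + 1) * (1 : LaurentSeries (Hol Ω)).coeff (-k))
      rw [coeff_C, HahnSeries.coeff_one, map_mul, holR, Hol.ev_of]
      by_cases hk : k = 0
      · simp [hk]
      · simp [hk]
    · simp
  rw [calU, truncU, Matrix.sub_apply, Matrix.sub_apply, Matrix.map_apply, Matrix.map_apply,
    Matrix.smul_apply, Matrix.smul_apply, coeff_sub, HahnSeries.coeff_sub, map_sub, h1, h2]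
  rfl

variable (Ω) in
/-- The coefficients `c_{2k-1}` as elements of the algebra of holomorphic functions. -/
def holTime (k : ℕ) : Hol Ω :=
  if h : k < g then algebraMap ℂ (Hol Ω) ((2 * (k : ℂ) + 1) / 2) * Hol.coord ⟨k, h⟩
  else if k = g + 1 then 1 else 0

omit [NeZero g] in
theorem ev_holTime (k : ℕ) (s : Ω) : Hol.ev s (holTime Ω k) = c g s k := by
  rw [holTime, c]
  split_ifs
  · rw [map_mul, AlgHom.commutes]; rfl
  · rw [map_one]
  · rw [map_zero]

omit [NeZero g] in
theorem D_holTime (i : Fin g) (k : ℕ) : Hol.D i (holTime Ω k) =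
    if k = i.val then algebraMap ℂ (Hol Ω) ((2 * (k : ℂ) + 1) / 2) else 0 := by
  rw [holTime]
  by_cases h : k < g
  · rw [dif_pos h, Derivation.leibniz, Derivation.map_algebraMap, smul_zero, add_zero, Hol.D_coord,
      smul_eq_mul]
    by_cases h1 : k = i.val
    · rw [if_pos h1, if_pos (Fin.ext h1.symm), mul_one]
    · rw [if_neg h1, if_neg (fun h2 => h1 (by rw [h2])), mul_zero]
  · rw [dif_neg h, if_neg (show ¬k = i.val by have := i.2; omega)]
    split_ifs <;> simp

theorem coeff_stringLax (hu : AnalyticOnNhd ℂ u Ω)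
    (hU : IsResolventUpTo (Hol.D 0) (Hol.of u hu) N U)
    (hR : ∀ k : ℕ, k ≤ N + 1 → (U 0 1).coeff k = holR hu k) (hN : g ≤ N) (s : Ω) (i j : Fin 2)
    (k : ℕ) : (stringLax u s i j).coeff k = Hol.ev s ((laxOf U (holTime Ω) g i j).coeff (-k)) := by
  rw [stringLax, laxOf, Matrix.sum_apply, Matrix.sum_apply, finsetSum_coeff, HahnSeries.coeff_sum,
    map_sum]
  refine Finset.sum_congr rfl fun l hl => ?_
  have := Finset.mem_range.mp hl
  rw [Matrix.smul_apply, Matrix.smul_apply, coeff_smul, smul_eq_mul, smul_eq_mul, coeff_cst_mul,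
    map_mul, ev_holTime, coeff_calU hu hU hR s (by omega)]

end Bridge

/-! ### Dependence of the time series on the times -/

section Times

theorem lam_mul_timeSeries {K : Type*} [CommRing K] (c : ℕ → K) (g : ℕ) :
    lam K * timeSeries c g = ∑ l ∈ Finset.range (g + 2), cst (c l) * lam K ^ l := by
  rw [timeSeries, mul_add, Finset.mul_sum, Finset.sum_range_succ' _ (g + 1)]
  congr 1
  · exact Finset.sum_congr rfl fun l _ => by ring
  · linear_combination cst (c 0) * lam_mul_lamInv (K := K)

theorem coeff_lam_mul_timeSeries {K : Type*} [CommRing K] (c : ℕ → K) (g k : ℕ) :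
    (lam K * timeSeries c g).coeff (-k) = if k < g + 2 then c k else 0 := by
  rw [lam_mul_timeSeries, HahnSeries.coeff_sum]
  have h : ∀ l ∈ Finset.range (g + 2), (cst (c l) * lam K ^ l).coeff (-k : ℤ) =
      if l = k then c l else 0 := by
    intro l _
    rw [coeff_cst_mul, lam_pow, HahnSeries.coeff_single]
    by_cases h : l = k
    · simp [h]
    · rw [if_neg h, if_neg (by omega), mul_zero]
  rw [Finset.sum_congr rfl h, Finset.sum_ite_eq']
  simp

/-- Only the term `c_{2n-1} λⁿ` of `λ · timeSeries` depends on the `n`-th time, with slope `(2n +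
1)/2`. -/
theorem two_lam_mul_coeffDerivation_timeSeries {K : Type*} [CommRing K] [Algebra ℂ K]
    {D : Derivation ℂ K K} {c : ℕ → K} {g n : ℕ} (hn : n < g)
    (hc : ∀ l, D (c l) = if l = n then algebraMap ℂ K ((2 * (l : ℂ) + 1) / 2) else 0) :
    2 * lam K * coeffDerivation D (timeSeries c g) = (2 * n + 1) * lam K ^ n := by
  have h1 := congrArg (coeffDerivation D) (lam_mul_timeSeries c g)
  rw [isLeibniz_coeffDerivation, coeffDerivation_lam, mul_zero, add_zero, map_sum,
    Finset.sum_eq_single n] at h1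
  · rw [isLeibniz_coeffDerivation, coeffDerivation_lam_pow, mul_zero, zero_add,
      coeffDerivation_cst, hc, if_pos rfl] at h1
    have h2 : (2 : LaurentSeries K) * cst (algebraMap ℂ K ((2 * (n : ℂ) + 1) / 2)) =
        2 * (n : LaurentSeries K) + 1 := by
      have h3 : (2 : K) * algebraMap ℂ K ((2 * (n : ℂ) + 1) / 2) = 2 * n + 1 := by
        rw [← map_ofNat (algebraMap ℂ K), ← map_mul, mul_div_cancel₀ _ (two_ne_zero), map_add,
          map_mul, map_natCast, map_one]
      rw [← map_ofNat cst, ← map_mul, h3, map_add, map_mul, map_natCast, map_one, map_ofNat]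
    linear_combination 2 * h1 + lam K ^ n * h2
  · intro l _ hl
    rw [isLeibniz_coeffDerivation, coeffDerivation_lam_pow, mul_zero, zero_add,
      coeffDerivation_cst, hc, if_neg hl, map_zero, mul_zero]
  · intro h
    exact absurd (Finset.mem_range.mpr (by omega)) h

end Times

/-! ### Roots with multiplicity and relabelling -/

section Darboux

/-- Equal multisets have fibres of equal cardinality; bijections of the fibres glue to a
permutation. -/
theorem exists_perm_of_map_eq {ι α : Type*} [Fintype ι] {f h : ι → α}
    (H : Finset.univ.val.map f = Finset.univ.val.map h) :
    ∃ σ : Equiv.Perm ι, ∀ j, f j = h (σ j) := by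
  classical
  have e : ∀ a, Nonempty ({i // f i = a} ≃ {i // h i = a}) := fun a => by
    rw [← Fintype.card_eq, Fintype.card_subtype, Fintype.card_subtype]
    have := congrArg (Multiset.count a) H
    rw [Multiset.count_map, Multiset.count_map] at this
    simp only [eq_comm (a := a)] at this
    exact this
  exact ⟨Equiv.ofFiberEquiv fun a => (e a).some, fun j => (Equiv.ofFiberEquiv_map _ j).symm⟩

theorem exists_map_univ_eq {α : Type*} {n : ℕ} {m : Multiset α} (hm : m.card = n) :
    ∃ f : Fin n → α, m = Finset.univ.val.map f := by
  subst hm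
  refine ⟨fun i => m.toList.get (i.cast (Multiset.length_toList m).symm), ?_⟩
  conv_lhs => rw [← Multiset.coe_toList m, ← List.ofFn_get m.toList]
  rw [Fin.univ_val_map]
  congr 1
  rw [List.ofFn_congr (Multiset.length_toList m)]

/-- A normalized `L₁₂` is monic of degree `g`, and `ℂ` is algebraically closed. -/
theorem exists_isOperDarboux {g : ℕ} {L : PolyMat} (hL : IsNormalized g L) :
    ∃ q p : Fin g → ℂ, IsOperDarboux L q p := by
  have hdeg : (L 0 1).natDegree = g := by
    refine le_antisymm (natDegree_le_iff_coeff_eq_zero.mpr fun k hk => hL.coeff01_of_lt hk)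
      (le_natDegree_of_ne_zero ?_)
    rw [hL.coeff01]; exact one_ne_zero
  obtain ⟨q, hq⟩ := exists_map_univ_eq
    ((IsAlgClosed.splits (L 0 1)).natDegree_eq_card_roots.symm.trans hdeg)
  exact ⟨q, fun j => (L 0 0).eval (q j), hq, fun _ => rfl⟩

end Darboux

/-! ### Polynomial matrices inside Laurent matrices -/

section PolynomialMatrices

variable {K : Type*} [CommRing K]

theorem exists_polyLaurent_eq {f : LaurentSeries K} (hf : IsPoly f) :
    ∃ p : K[X], polyLaurent K p = f := by
  obtain ⟨n, hn⟩ := exists_vanishBelow f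
  refine ⟨∑ k ∈ Finset.range (n.natAbs + 1), monomial k (f.coeff (-k)), ?_⟩
  ext k
  rcases lt_or_ge 0 k with h | h
  · rw [coeff_polyLaurent_of_pos _ h, hf k h]
  obtain ⟨m, rfl⟩ := Int.exists_eq_neg_ofNat h
  rw [coeff_polyLaurent, finsetSum_coeff]
  simp only [coeff_monomial]
  rw [Finset.sum_ite_eq']
  split_ifs with hm
  · rfl
  · rw [hn _ (by have := Finset.mem_range.not.mp hm; omega)]

theorem vanishBelow_polyLaurent_of_coeff {p : K[X]} {n : ℤ} (h : ∀ k : ℕ, n < k → p.coeff k = 0) :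
    VanishBelow (polyLaurent K p) (-n) := fun k hk => by
  rcases lt_or_ge 0 k with h0 | h0
  · exact coeff_polyLaurent_of_pos _ h0
  obtain ⟨m, rfl⟩ := Int.exists_eq_neg_ofNat h0
  rw [coeff_polyLaurent, h m (by omega)]

theorem isPoly_polyLaurent (p : K[X]) : IsPoly (polyLaurent K p) :=
  fun _ hk => coeff_polyLaurent_of_pos p hk

theorem polyLaurent_X : polyLaurent K X = lam K := by simp [polyLaurent, lam]

theorem polyLaurent_timePoly (c : ℕ → K) (g : ℕ) :
    polyLaurent K (timePoly c g) = lam K * timeSeries c g := by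
  ext k
  rcases lt_or_ge 0 k with h | h
  · rw [coeff_polyLaurent_of_pos _ h, lam_mul_timeSeries]
    exact (IsPoly.sum (fun l _ => (isPoly_cst _).mul
      (by rw [lam_pow]; exact isPoly_single (by omega) _)) k h).symm
  obtain ⟨m, rfl⟩ := Int.exists_eq_neg_ofNat h
  rw [coeff_polyLaurent, coeff_timePoly, coeff_lam_mul_timeSeries]

/-- A polynomial matrix, as a matrix of Laurent series in `1/λ`. -/
def polyLMat (M : Matrix (Fin 2) (Fin 2) K[X]) : LMat K := (polyLaurent K).mapMatrix M

theorem polyLMat_apply (M : Matrix (Fin 2) (Fin 2) K[X]) (i j : Fin 2) :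
    polyLMat M i j = polyLaurent K (M i j) := rfl

theorem exists_polyLMat_eq {M : LMat K} (hM : ∀ i j, IsPoly (M i j)) :
    ∃ P : Matrix (Fin 2) (Fin 2) K[X], polyLMat P = M := by
  choose P hP using fun i j => exists_polyLaurent_eq (hM i j)
  exact ⟨P, by ext1 i j; exact hP i j⟩

theorem polyLMat_mul (M N : Matrix (Fin 2) (Fin 2) K[X]) :
    polyLMat (M * N) = polyLMat M * polyLMat N := map_mul _ _ _

theorem det_polyLMat (M : Matrix (Fin 2) (Fin 2) K[X]) :
    (polyLMat M).det = polyLaurent K M.det :=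
  (AlgHom.map_det (polyLaurent K) M).symm

theorem map_timePoly {R : Type*} [CommRing R] (φ : K →+* R) (c : ℕ → K) (g : ℕ) :
    (timePoly c g).map φ = timePoly (fun k => φ (c k)) g := by
  simp [timePoly, Polynomial.map_sum]

theorem coeff_map_det {R : Type*} [CommRing R] (φ : K →+* R)
    (M : Matrix (Fin 2) (Fin 2) K[X]) (c : ℕ → K) (g k : ℕ) :
    φ ((X * M.det + timePoly c g ^ 2).coeff k) =
      (X * ((mapRingHom φ).mapMatrix M).det + timePoly (fun k => φ (c k)) g ^ 2).coeff k := by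
  rw [← RingHom.map_det, ← map_timePoly, ← coeff_map]
  simp

/-- The zero curvature expression of polynomial matrices, coefficient by coefficient. -/
theorem coeff_zeroCurvature [Algebra ℂ K] (E : Derivation ℂ K K)
    (L V : Matrix (Fin 2) (Fin 2) K[X]) (i j : Fin 2) (n : ℕ) :
    (((coeffDerivation E).mapMatrix (polyLMat L) - (lambdaDerivation K).mapMatrix (polyLMat V)
      + (polyLMat L * polyLMat V - polyLMat V * polyLMat L)) i j).coeff (-n) =
    E ((L i j).coeff n) - (derivative (V i j)).coeff n + ((L * V - V * L) i j).coeff n := by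
  rw [← polyLMat_mul, ← polyLMat_mul, Matrix.add_apply, Matrix.sub_apply, Matrix.sub_apply,
    Matrix.sub_apply, AddMonoidHom.mapMatrix_apply, AddMonoidHom.mapMatrix_apply, Matrix.map_apply,
    Matrix.map_apply, polyLMat_apply, polyLMat_apply, polyLMat_apply, polyLMat_apply,
    ← polyLaurent_derivative, HahnSeries.coeff_add, HahnSeries.coeff_sub, HahnSeries.coeff_sub,
    coeff_coeffDerivation, coeff_polyLaurent, coeff_polyLaurent, coeff_polyLaurent,
    coeff_polyLaurent, coeff_sub]

theorem isPoly_zeroCurvature [Algebra ℂ K] (E : Derivation ℂ K K)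
    (L V : Matrix (Fin 2) (Fin 2) K[X]) (i j : Fin 2) :
    IsPoly (((coeffDerivation E).mapMatrix (polyLMat L)
      - (lambdaDerivation K).mapMatrix (polyLMat V)
      + (polyLMat L * polyLMat V - polyLMat V * polyLMat L)) i j) := by
  rw [← polyLMat_mul, ← polyLMat_mul]
  exact (((isPoly_polyLaurent (L i j)).coeffDerivation E).sub
    (isPoly_polyLaurent (V i j)).lambdaDerivation).add
    ((isPoly_polyLaurent ((L * V) i j)).sub (isPoly_polyLaurent ((V * L) i j)))

end PolynomialMatrices

/-! ### Holomorphic families of polynomials -/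

section HolomorphicPolynomials

open TopologicalSpace

variable {g : ℕ} {Ω : Opens (Fin g → ℂ)}

theorem Hol.poly_ext {p q : (Hol Ω)[X]}
    (h : ∀ s : Ω, p.map (Hol.ev s : Hol Ω →+* ℂ) = q.map (Hol.ev s : Hol Ω →+* ℂ)) : p = q := by
  ext1 n
  refine Hol.ext_ev fun s => ?_
  have := congrArg (fun p => Polynomial.coeff p n) (h s)
  simpa [coeff_map] using this

/-- A holomorphic family of polynomials, as a polynomial over the algebra of holomorphic
functions. -/
def Hol.poly (P : (Fin g → ℂ) → ℂ[X]) (hP : ∀ n, AnalyticOnNhd ℂ (fun s => (P s).coeff n) Ω)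
    (N : ℕ) : (Hol Ω)[X] :=
  ∑ n ∈ Finset.range (N + 1), monomial n (Hol.of (fun s => (P s).coeff n) (hP n))

theorem Hol.coeff_poly {P : (Fin g → ℂ) → ℂ[X]}
    (hP : ∀ n, AnalyticOnNhd ℂ (fun s => (P s).coeff n) Ω) {N : ℕ}
    (hN : ∀ s ∈ Ω, (P s).natDegree ≤ N) (n : ℕ) :
    (Hol.poly P hP N).coeff n = Hol.of (fun s => (P s).coeff n) (hP n) := by
  rw [Hol.poly, finsetSum_coeff]
  simp only [coeff_monomial]
  rw [Finset.sum_ite_eq']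
  split_ifs with hm
  · rfl
  · refine Hol.ext_ev fun s => ?_
    have := Finset.mem_range.not.mp hm
    rw [Hol.ev_of, map_zero, coeff_eq_zero_of_natDegree_lt]
    exact (hN s s.2).trans_lt (by omega)

theorem Hol.map_ev_poly {P : (Fin g → ℂ) → ℂ[X]}
    (hP : ∀ n, AnalyticOnNhd ℂ (fun s => (P s).coeff n) Ω) {N : ℕ}
    (hN : ∀ s ∈ Ω, (P s).natDegree ≤ N) (s : Ω) :
    (Hol.poly P hP N).map (Hol.ev s : Hol Ω →+* ℂ) = P s := by
  ext n
  rw [coeff_map, Hol.coeff_poly hP hN]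
  rfl

/-- Evaluation of a matrix of polynomials. -/
def Hol.evMat (s : Ω) : Matrix (Fin 2) (Fin 2) (Hol Ω)[X] →+* PolyMat :=
  (mapRingHom (Hol.ev s : Hol Ω →+* ℂ)).mapMatrix

theorem Hol.evMat_apply (s : Ω) (M : Matrix (Fin 2) (Fin 2) (Hol Ω)[X]) (i j : Fin 2) :
    Hol.evMat s M i j = (M i j).map (Hol.ev s : Hol Ω →+* ℂ) := rfl

theorem Hol.coeff_evMat (s : Ω) (M : Matrix (Fin 2) (Fin 2) (Hol Ω)[X]) (i j : Fin 2) (n : ℕ) :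
    (Hol.evMat s M i j).coeff n = Hol.ev s ((M i j).coeff n) := by
  rw [Hol.evMat_apply, coeff_map]; rfl

theorem Hol.coeff_evMat_polyLMat (s : Ω) (M : Matrix (Fin 2) (Fin 2) (Hol Ω)[X]) (i j : Fin 2)
    (n : ℕ) : (Hol.evMat s M i j).coeff n = Hol.ev s ((polyLMat M i j).coeff (-n)) := by
  rw [Hol.coeff_evMat, polyLMat_apply, coeff_polyLaurent]

theorem Hol.ev_coeff_det (s : Ω) (M : Matrix (Fin 2) (Fin 2) (Hol Ω)[X]) (k : ℕ) :
    Hol.ev s ((X * M.det + timePoly (holTime Ω) g ^ 2).coeff k) =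
      (X * (Hol.evMat s M).det + timePoly (c g s) g ^ 2).coeff k := by
  have h : (fun k => (Hol.ev s : Hol Ω →+* ℂ) (holTime Ω k)) = c g s :=
    funext fun k => ev_holTime k s
  rw [← h]
  exact coeff_map_det (Hol.ev s : Hol Ω →+* ℂ) M (holTime Ω) g k

theorem Hol.ev_coeff_zeroCurvature (s : Ω) (M N : Matrix (Fin 2) (Fin 2) (Hol Ω)[X]) (i j : Fin 2)
    (n : ℕ) : Hol.ev s ((derivative (N i j)).coeff n) = (derivative (Hol.evMat s N i j)).coeff n ∧
      Hol.ev s (((M * N - N * M) i j).coeff n) =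
        ((Hol.evMat s M * Hol.evMat s N - Hol.evMat s N * Hol.evMat s M) i j).coeff n := by
  constructor
  · rw [Hol.evMat_apply, derivative_map, coeff_map]; rfl
  · rw [← map_mul, ← map_mul, ← map_sub, Hol.coeff_evMat]

end HolomorphicPolynomials

/-! ### The change of times `t = D s` -/

section TimeChange

variable {g : ℕ}

/-- The change of times `s ↦ D s` as a continuous linear map. -/
def timeMapCLM (g : ℕ) : (Fin g → ℂ) →L[ℂ] (Fin g → ℂ) :=
  ContinuousLinearMap.pi fun l => (2 * (l.val : ℂ) + 1) • ContinuousLinearMap.proj l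

theorem timeMapCLM_apply (s : Fin g → ℂ) : timeMapCLM g s = timeMap g s := rfl

/-- The inverse change of times `t ↦ D⁻¹ t`. -/
def timeInvCLM (g : ℕ) : (Fin g → ℂ) →L[ℂ] (Fin g → ℂ) :=
  ContinuousLinearMap.pi fun l => (2 * (l.val : ℂ) + 1)⁻¹ • ContinuousLinearMap.proj l

theorem two_mul_add_one_ne_zero (l : ℕ) : (2 * (l : ℂ) + 1) ≠ 0 := by
  exact_mod_cast Nat.succ_ne_zero (2 * l)

theorem timeMap_timeInvCLM (t : Fin g → ℂ) : timeMap g (timeInvCLM g t) = t := by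
  funext l
  change (2 * (l.val : ℂ) + 1) * ((2 * (l.val : ℂ) + 1)⁻¹ * t l) = t l
  rw [mul_inv_cancel_left₀ (two_mul_add_one_ne_zero l)]

theorem timeInvCLM_timeMap (s : Fin g → ℂ) : timeInvCLM g (timeMap g s) = s := by
  funext l
  change (2 * (l.val : ℂ) + 1)⁻¹ * ((2 * (l.val : ℂ) + 1) * s l) = s l
  rw [inv_mul_cancel_left₀ (two_mul_add_one_ne_zero l)]

theorem analyticOnNhd_comp_timeMap {F : (Fin g → ℂ) → ℂ} {Ω : Set (Fin g → ℂ)}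
    (hF : AnalyticOnNhd ℂ F Ω) : AnalyticOnNhd ℂ (fun s => F (timeMap g s)) (timeMap g ⁻¹' Ω) :=
  hF.comp (fun s _ => (timeMapCLM g).analyticAt s) fun _ hs => hs

theorem analyticOnNhd_comp_timeInvCLM {F : (Fin g → ℂ) → ℂ} {Ω : Set (Fin g → ℂ)}
    (hF : AnalyticOnNhd ℂ F (timeMap g ⁻¹' Ω)) :
    AnalyticOnNhd ℂ (fun t => F (timeInvCLM g t)) Ω :=
  hF.comp (fun s _ => (timeInvCLM g).analyticAt s) fun t ht => by
    rwa [Set.mem_preimage, timeMap_timeInvCLM]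

/-- This factor is why the auxiliary matrices are matched as `(2ℓ+1) Â = 𝒰_{2ℓ+1}`. -/
theorem pderiv_comp_timeMap {F : (Fin g → ℂ) → ℂ} {s : Fin g → ℂ}
    (hF : AnalyticAt ℂ F (timeMap g s)) (l : Fin g) :
    pderiv l (fun s => F (timeMap g s)) s = (2 * (l.val : ℂ) + 1) * pderiv l F (timeMap g s) := by
  have h1 : HasFDerivAt (fun s => F (timeMap g s)) _ s :=
    HasFDerivAt.comp s hF.differentiableAt.hasFDerivAt (timeMapCLM g).hasFDerivAt
  have h2 : timeMapCLM g (Pi.single l 1) = (2 * (l.val : ℂ) + 1) • Pi.single l 1 := by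
    funext i
    rw [timeMapCLM_apply, timeMap, Pi.smul_apply, smul_eq_mul]
    by_cases h : i = l
    · rw [h]
    · rw [Pi.single_eq_of_ne h, mul_zero, mul_zero]
  rw [pderiv, h1.fderiv, ContinuousLinearMap.comp_apply, h2, map_smul, smul_eq_mul]
  rfl

end TimeChange

/-! ### Leading coefficients of the Lax matrix of the string equation -/

section StringLax

variable {g : ℕ} [NeZero g] (u : (Fin g → ℂ) → ℂ) (s : Fin g → ℂ)

theorem dx_R_zero : dx (R u 0) = fun _ => 0 := by
  funext s; rw [R_zero]; exact pderiv_const 1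

theorem R_one : R u 1 s = u s / 2 := by
  have h : dx (fun _ : Fin g → ℂ => (0 : ℂ)) s = 0 := pderiv_const 0
  have h1 : R u 1 s = _ := congrFun (R_succ u 0) s
  rw [h1]
  simp [R_zero u, h, show dx (fun _ : Fin g → ℂ => (1 : ℂ)) = fun _ => 0 from
    funext fun _ => pderiv_const 1]

theorem matU_00_coeff {m : ℤ} (hm : m < 1) : (matU u s 0 0).coeff m = 0 := by
  change (seriesA u s).coeff m = 0
  rcases lt_or_ge m 0 with h | h
  · exact vanishBelow_seriesAtInfinity _ _ h
  obtain rfl : m = ((0 : ℕ) : ℤ) := by omega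
  rw [seriesA, coeff_seriesAtInfinity, dx_R_zero, mul_zero]

theorem matU_01_coeff {m : ℤ} (hm : m < 1) :
    (matU u s 0 1).coeff m = if m = 0 then 1 else 0 := by
  change (seriesB u s).coeff m = _
  rcases lt_or_ge m 0 with h | h
  · rw [if_neg (by omega)]; exact vanishBelow_seriesAtInfinity _ _ h
  obtain rfl : m = ((0 : ℕ) : ℤ) := by omega
  rw [seriesB, coeff_seriesAtInfinity, R_zero]
  simp

theorem matU_10_coeff {m : ℤ} (hm : m < 1) :
    (matU u s 1 0).coeff m = if m = -1 then 1 else if m = 0 then -u s / 2 else 0 := by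
  have hB : ∀ m : ℤ, m < 1 → (seriesB u s).coeff m = if m = 0 then 1 else 0 :=
    fun m hm => matU_01_coeff u s hm
  change (seriesC u s).coeff m = _
  rw [seriesC, sub_mul, HahnSeries.coeff_add, HahnSeries.coeff_sub, HahnSeries.coeff_single_mul,
    HahnSeries.coeff_single_mul, hB (m - 0) (by omega)]
  rcases lt_or_ge m 0 with h | h
  · rw [vanishBelow_seriesAtInfinity _ _ h, hB _ (by omega)]
    by_cases h1 : m = -1
    · simp [h1]
    · simp [h1, show m ≠ 0 by omega, show m + 1 ≠ 0 by omega]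
  obtain rfl : m = ((0 : ℕ) : ℤ) := by omega
  have h1 : (seriesB u s).coeff 1 = u s / 2 := by
    have := coeff_seriesAtInfinity (fun k => R u k s) 1
    rw [seriesB, ← R_one u s]
    exact_mod_cast this
  have h0 : dx (fun _ : Fin g → ℂ => (0 : ℂ)) s = 0 := pderiv_const 0
  rw [coeff_seriesAtInfinity, dx_R_zero, h0]
  simp [h1]
  ring

/-- The correction by `R_{2n+1}` lives in degree zero, so coefficients of positive degree are those
of `λⁿ U`. -/
theorem coeff_calU_of_pos (n : ℕ) (i j : Fin 2) {k : ℕ} (hk : 0 < k) :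
    (calU u n s i j).coeff k = (matU u s i j).coeff (n - k) := by
  have h : ((!![0, 0; C (R u (n + 1) s), 0] : PolyMat) i j).coeff k = 0 := by
    fin_cases i <;> fin_cases j <;> simp [coeff_C, hk.ne']
  rw [calU, Matrix.sub_apply, coeff_sub, h, sub_zero, Matrix.map_apply, coeff_polyPart,
    HahnSeries.coeff_single_mul, one_mul]
  congr 1
  ring

theorem calU_traceless (n : ℕ) : calU u n s 1 1 = -calU u n s 0 0 := by
  ext k
  simp only [calU, matU, coeff_polyPart, Matrix.sub_apply, Matrix.map_apply, coeff_sub, coeff_neg,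
    Matrix.of_apply, Matrix.cons_val', Matrix.cons_val_zero, Matrix.cons_val_one,
    Matrix.cons_val_fin_one, HahnSeries.coeff_single_mul, HahnSeries.coeff_neg, coeff_zero, mul_neg]
  ring

theorem coeff_stringLax_of_pos (i j : Fin 2) {k : ℕ} (hk : 0 < k) :
    (stringLax u s i j).coeff k =
      ∑ l ∈ Finset.range (g + 1), c g s (l + 1) * (matU u s i j).coeff (l - k) := by
  rw [stringLax, Matrix.sum_apply, finsetSum_coeff]
  refine Finset.sum_congr rfl fun l _ => ?_
  rw [Matrix.smul_apply, coeff_smul, coeff_calU_of_pos u s l i j hk, smul_eq_mul]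

theorem stringLax_traceless : stringLax u s 1 1 = -stringLax u s 0 0 := by
  simp [stringLax, Matrix.sum_apply, calU_traceless]

omit [NeZero g] in
theorem c_succ_self : c g s (g + 1) = 1 := by simp [c]

omit [NeZero g] in
theorem c_self : c g s g = 0 := by simp [c]

theorem stringLax_00_coeff {k : ℕ} (hk : g ≤ k) : (stringLax u s 0 0).coeff k = 0 := by
  have hg := NeZero.pos g
  rw [coeff_stringLax_of_pos u s 0 0 (by omega)]
  refine Finset.sum_eq_zero fun l hl => ?_
  have := Finset.mem_range.mp hl
  rw [matU_00_coeff u s (by omega), mul_zero]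

theorem stringLax_01_coeff {k : ℕ} (hk : g ≤ k) :
    (stringLax u s 0 1).coeff k = if k = g then 1 else 0 := by
  have hg := NeZero.pos g
  rw [coeff_stringLax_of_pos u s 0 1 (by omega), Finset.sum_range_succ, Finset.sum_eq_zero,
    c_succ_self, matU_01_coeff u s (by omega), zero_add, one_mul]
  · by_cases h : k = g
    · simp [h]
    · rw [if_neg h, if_neg (by omega)]
  · intro l hl
    have := Finset.mem_range.mp hl
    rw [matU_01_coeff u s (by omega), if_neg (by omega), mul_zero]

theorem stringLax_10_coeff {k : ℕ} (hk : g ≤ k) :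
    (stringLax u s 1 0).coeff k = if k = g + 1 then 1 else if k = g then -u s / 2 else 0 := by
  have hg := NeZero.pos g
  rw [coeff_stringLax_of_pos u s 1 0 (by omega), Finset.sum_range_succ, Finset.sum_eq_zero,
    c_succ_self, matU_10_coeff u s (by omega), zero_add, one_mul]
  · split_ifs <;> first | rfl | omega
  · intro l hl
    have := Finset.mem_range.mp hl
    -- The term `l = g - 1` would contribute to the coefficient of `λ^g`; it is removed by `c_{2g-1}
    -- = 0`, the vanishing of `t_{∞,2g+1}`.
    by_cases h : l + 1 = g
    · rw [h, c_self, zero_mul]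
    · rw [matU_10_coeff u s (by omega), if_neg (by omega), if_neg (by omega), mul_zero]

/-- Only `R_{-1} = 1` and `R₁ = u/2` enter the leading coefficients, so this holds for an arbitrary
function `u`. -/
theorem isNormalized_stringLax : IsNormalized g (stringLax u s) := by
  refine ⟨-u s / 2, fun i j => (degree_lt_iff_coeff_zero _ _).mpr fun k hk => ?_⟩
  fin_cases i <;> fin_cases j
  · simp [stringLax_00_coeff u s hk]
  · simp [stringLax_01_coeff u s hk, coeff_X_pow]
  · simp only [Fin.zero_eta, Fin.mk_one, coeff_sub, coeff_add, coeff_C_mul, coeff_X_pow,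
      stringLax_10_coeff u s hk]
    by_cases h1 : k = g + 1
    · simp [h1]
    · by_cases h2 : k = g
      · simp [h2]
      · simp [h1, h2]
  · simp [stringLax_traceless, stringLax_00_coeff u s hk]

omit [NeZero g] in
theorem sum_c_mul (f : ℕ → ℂ) : ∑ l ∈ Finset.range (g + 2), c g s l * f l =
    f (g + 1) + ∑ l : Fin g, (2 * (l : ℂ) + 1) / 2 * s l * f l.val := by
  rw [Finset.sum_range_succ, Finset.sum_range_succ, c_succ_self, c_self, zero_mul, add_zero,
    one_mul, add_comm, Finset.sum_range]
  congr 1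
  refine Finset.sum_congr rfl fun l _ => ?_
  rw [c, dif_pos l.2]

variable {u s}

theorem Identified.of_lax_aux {L : (Fin g → ℂ) → PolyMat} {A : Fin g → (Fin g → ℂ) → PolyMat}
    (hL : L (timeMap g s) = stringLax u s)
    (hA : ∀ l : Fin g, (2 * (l : ℂ) + 1) • A l (timeMap g s) = calU u l.val s) :
    Identified L A u s where
  lax := hL
  aux := hA
  darboux_exists := by
    obtain ⟨q, p, h⟩ := exists_isOperDarboux (isNormalized_stringLax u s)
    exact ⟨q, p, hL ▸ h, h⟩
  darboux_eq q p lam mu h1 h2 := by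
    rw [hL] at h1
    obtain ⟨σ, hσ⟩ := exists_perm_of_map_eq (h1.1.symm.trans h2.1)
    exact ⟨σ, fun j => by rw [h1.2, h2.2, hσ]⟩

end StringLax

/-! ### From isomonodromic systems to solutions of the hierarchy -/

section IsomonodromicToString

open TopologicalSpace

variable {g : ℕ} [NeZero g]

/-- The derivations of the algebra of holomorphic functions, numbered by natural numbers. -/
def holE (Ω : Opens (Fin g → ℂ)) (n : ℕ) : Derivation ℂ (Hol Ω) (Hol Ω) :=
  if h : n < g then Hol.D ⟨n, h⟩ else 0

omit [NeZero g] in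
theorem holE_of_lt (Ω : Opens (Fin g → ℂ)) {n : ℕ} (h : n < g) : holE Ω n = Hol.D ⟨n, h⟩ := dif_pos h

theorem holE_zero (Ω : Opens (Fin g → ℂ)) : holE Ω 0 = Hol.D 0 := holE_of_lt Ω (NeZero.pos g)

omit [NeZero g] in
theorem IsNormalized.natDegree_le {L : PolyMat} (h : IsNormalized g L) (h11 : L 1 1 = -L 0 0)
    (i j : Fin 2) : (L i j).natDegree ≤ g + 1 := by
  refine natDegree_le_iff_coeff_eq_zero.mpr fun k hk => ?_
  fin_cases i <;> fin_cases j
  · exact h.coeff00_of_le (by omega)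
  · exact h.coeff01_of_lt (by omega)
  · exact h.coeff10_of_lt hk
  · change (L 1 1).coeff k = 0
    rw [h11, coeff_neg, h.coeff00_of_le (by omega), neg_zero]

omit [NeZero g] in
/-- Holomorphic families of normalized matrices with the correct irregular times. -/
theorem isNormalLax_polyLMat {Ω : Opens (Fin g → ℂ)} {M : Matrix (Fin 2) (Fin 2) (Hol Ω)[X]}
    (hN : ∀ s : Ω, IsNormalized g (Hol.evMat s M))
    (htr : ∀ s : Ω, Hol.evMat s M 1 1 = -Hol.evMat s M 0 0)
    (hdet : ∀ s : Ω, ∀ k : ℕ, g < k →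
      (X * (Hol.evMat s M).det + timePoly (c g s) g ^ 2).coeff k = 0) :
    IsNormalLax (holTime Ω) g (polyLMat M) where
  isPoly i j := isPoly_polyLaurent _
  traceless := by
    rw [polyLMat_apply, polyLMat_apply, ← map_neg]
    refine congrArg _ (Hol.poly_ext fun s => ?_)
    rw [Polynomial.map_neg]
    exact htr s
  vanish00 := (vanishBelow_polyLaurent_of_coeff (n := g - 1) fun k hk => Hol.ext_ev fun s => by
    rw [← Hol.coeff_evMat, map_zero]
    exact (hN s).coeff00_of_le (by omega)).mono (by omega)
  vanish01 := (vanishBelow_polyLaurent_of_coeff (n := g) fun k hk => Hol.ext_ev fun s => by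
    rw [← Hol.coeff_evMat, map_zero]
    exact (hN s).coeff01_of_lt (by omega))
  vanish10 := (vanishBelow_polyLaurent_of_coeff (n := g + 1) fun k hk => Hol.ext_ev fun s => by
    rw [← Hol.coeff_evMat, map_zero]
    exact (hN s).coeff10_of_lt (by omega)).mono (by omega)
  coeff01 := Hol.ext_ev fun s => by
    rw [← Hol.coeff_evMat_polyLMat, map_one]
    exact (hN s).coeff01
  coeff10 := Hol.ext_ev fun s => by
    rw [show (-(g : ℤ) - 1) = -((g + 1 : ℕ) : ℤ) by push_cast; ring, ← Hol.coeff_evMat_polyLMat,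
      map_one]
    exact (hN s).coeff10
  det := by
    rw [det_polyLMat, ← polyLaurent_timePoly, ← polyLaurent_X, ← map_mul, ← map_pow, ← neg_add',
      ← map_add]
    exact (vanishBelow_polyLaurent_of_coeff (n := g) fun k hk => Hol.ext_ev fun s => by
      rw [Hol.ev_coeff_det, map_zero, hdet s k (by omega)]).neg

/-- The open set of times `s` attached to an open set of times `t`. -/
def timeOpens (Ω : Set (Fin g → ℂ)) (hΩ : IsOpen Ω) : Opens (Fin g → ℂ) :=
  ⟨timeMap g ⁻¹' Ω, hΩ.preimage (timeMapCLM g).continuous⟩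

/-- The system, pulled back to the variables `s`, is a formal system over `Hol`, to which
`IsFormalSystem.exists_resolvent` applies. Evaluating at points of the domain returns the analytic
statements. -/
theorem IsIsomonodromic.exists_solution {Ω : Set (Fin g → ℂ)} (hΩ : IsOpen Ω)
    {L : (Fin g → ℂ) → PolyMat} {A : Fin g → (Fin g → ℂ) → PolyMat}
    (h : IsIsomonodromic g Ω L A) : ∃ u : (Fin g → ℂ) → ℂ,
      IsPISolution (timeMap g ⁻¹' Ω) u ∧ ∀ s ∈ timeMap g ⁻¹' Ω, Identified L A u s := by
  obtain ⟨Ω', hΩ'⟩ : ∃ Ω' : Opens (Fin g → ℂ), (Ω' : Set (Fin g → ℂ)) = timeMap g ⁻¹' Ω :=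
    ⟨timeOpens Ω hΩ, rfl⟩
  have hmem : ∀ s : Ω', timeMap g s ∈ Ω := fun s => by
    have := s.2
    rwa [← SetLike.mem_coe, hΩ'] at this
  have hdet := fun s : Ω' => (h.irregular_times _ (hmem s)).trace_eq_zero_and_det
    (h.normalized _ (hmem s))
  -- the Lax matrices over the algebra of holomorphic functions
  have hLa : ∀ i j n, AnalyticOnNhd ℂ (fun s => (L (timeMap g s) i j).coeff n) Ω' := fun i j n => by
    rw [hΩ']; exact analyticOnNhd_comp_timeMap (h.analytic_lax i j n)
  have hLd : ∀ i j, ∀ s ∈ Ω', (L (timeMap g s) i j).natDegree ≤ g + 1 := fun i j s hs =>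
    (h.normalized _ (hmem ⟨s, hs⟩)).natDegree_le (hdet ⟨s, hs⟩).1 i j
  obtain ⟨M, hM⟩ : ∃ M : Matrix (Fin 2) (Fin 2) (Hol Ω')[X],
      ∀ i j, M i j = Hol.poly (fun s => L (timeMap g s) i j) (hLa i j) (g + 1) := ⟨_, fun _ _ => rfl⟩
  have hMev : ∀ s : Ω', Hol.evMat s M = L (timeMap g s) := fun s => by
    ext1 i j
    rw [Hol.evMat_apply, hM, Hol.map_ev_poly (hLa i j) (hLd i j)]
  -- The auxiliary matrices are rescaled by `2ℓ + 1`, so that zero curvature in `t` becomes zero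
  -- curvature in `s`.
  have hAa : ∀ l i j n, AnalyticOnNhd ℂ
      (fun s => (((2 * (l.val : ℂ) + 1) • A l (timeMap g s)) i j).coeff n) Ω' := fun l i j n => by
    rw [hΩ']
    have := (analyticOnNhd_const (v := 2 * (l.val : ℂ) + 1)).mul
      (analyticOnNhd_comp_timeMap (h.analytic_aux l i j n))
    simpa only [Matrix.smul_apply, coeff_smul, smul_eq_mul] using this
  have hAd : ∀ l i j, ∀ s ∈ Ω',
      (((2 * (l.val : ℂ) + 1) • A l (timeMap g s)) i j).natDegree ≤ g + 1 := fun l i j s hs =>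
    (natDegree_smul_le _ _).trans (h.natDegree_aux l _ (hmem ⟨s, hs⟩) i j)
  obtain ⟨V, hV⟩ : ∃ V : Fin g → Matrix (Fin 2) (Fin 2) (Hol Ω')[X], ∀ l i j, V l i j =
      Hol.poly (fun s => ((2 * (l.val : ℂ) + 1) • A l (timeMap g s)) i j) (hAa l i j) (g + 1) :=
    ⟨_, fun _ _ _ => rfl⟩
  have hVev : ∀ l (s : Ω'), Hol.evMat s (V l) = (2 * (l.val : ℂ) + 1) • A l (timeMap g s) :=
    fun l s => by
      ext1 i j
      rw [Hol.evMat_apply, hV, Hol.map_ev_poly (hAa l i j) (hAd l i j)]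
  have hsys : IsFormalSystem (holE Ω') (holTime Ω') g (polyLMat M)
      (fun n => if hn : n < g then polyLMat (V ⟨n, hn⟩) else 0) := by
    refine ⟨isNormalLax_polyLMat (fun s => ?_) (fun s => ?_) (fun s => ?_), ?_, ?_, ?_, ?_, ?_, ?_⟩
    · rw [hMev]; exact h.normalized _ (hmem s)
    · rw [hMev]; exact (hdet s).1
    · rw [hMev]; exact (hdet s).2
    · rw [holTime, dif_neg (by omega), if_pos rfl]
    · intro n hn
      rw [holE_of_lt _ hn]
      exact two_lam_mul_coeffDerivation_timeSeries hn fun l => D_holTime ⟨n, hn⟩ l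
    · intro n hn i j
      simp only [dif_pos hn]
      exact isPoly_polyLaurent _
    · intro n hn
      simp only [dif_pos hn, polyLMat_apply, ← map_neg]
      refine congrArg _ (Hol.poly_ext fun s => ?_)
      rw [Polynomial.map_neg, ← Hol.evMat_apply, ← Hol.evMat_apply, hVev]
      have := h.trace_aux ⟨n, hn⟩ _ (hmem s)
      rw [Matrix.trace_fin_two] at this
      rw [Matrix.smul_apply, Matrix.smul_apply, ← smul_neg, eq_neg_of_add_eq_zero_right this]
    · intro n hn i j
      simp only [dif_pos hn]
      refine (vanishBelow_polyLaurent_of_coeff (n := g + 1) fun k hk => Hol.ext_ev fun s => ?_).mono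
        (by omega)
      rw [← Hol.coeff_evMat, hVev, map_zero]
      exact natDegree_le_iff_coeff_eq_zero.mp (hAd ⟨n, hn⟩ i j s s.2) k (by omega)
    · intro n hn
      simp only [dif_pos hn]
      ext1 i j
      refine HahnSeries.ext (funext fun k => ?_)
      rcases lt_or_ge 0 k with hk | hk
      · exact isPoly_zeroCurvature _ _ _ i j k hk
      obtain ⟨k, rfl⟩ := Int.exists_eq_neg_ofNat hk
      rw [coeff_zeroCurvature, holE_of_lt _ hn]
      refine Hol.ext_ev fun s => ?_
      obtain ⟨e1, e2⟩ := Hol.ev_coeff_zeroCurvature s M (V ⟨n, hn⟩) i j k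
      have e3 : Hol.ev s (Hol.D ⟨n, hn⟩ ((M i j).coeff k)) =
          (2 * (n : ℂ) + 1) * pderiv ⟨n, hn⟩ (fun t => (L t i j).coeff k) (timeMap g s) := by
        rw [hM, Hol.coeff_poly (hLa i j) (hLd i j), Hol.ev_D_of]
        exact pderiv_comp_timeMap (h.analytic_lax i j k _ (hmem s)) ⟨n, hn⟩
      have e4 := h.zero_curvature ⟨n, hn⟩ _ (hmem s) i j k
      rw [map_add, map_sub, e1, e2, e3, hMev, hVev, Matrix.mul_smul, Matrix.smul_mul, ← smul_sub,
        Matrix.smul_apply, Matrix.smul_apply, derivative_smul, coeff_smul, coeff_smul]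
      simp only [smul_eq_mul]
      change _ = Hol.ev s 0
      rw [map_zero]
      linear_combination (2 * (n : ℂ) + 1) * e4
  obtain ⟨v, U, hU, -, hLU, hVU, hstring, hkdv⟩ := hsys.exists_resolvent (NeZero.pos g)
  obtain ⟨u, hu⟩ : ∃ u, u = Hol.toFun v := ⟨_, rfl⟩
  have hua : AnalyticOnNhd ℂ u Ω' := hu ▸ Hol.analyticOnNhd v
  have huv : Hol.of u hua = v := by subst hu; exact Hol.of_toFun v
  rw [holE_zero, ← huv] at hU
  -- Both sequences start with `1` and solve the resolvent equations of index at most `g`, which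
  -- determine coefficients up to index `g + 1`, the last one in the string equation.
  have hR : ∀ k : ℕ, k ≤ g + 1 → (U 0 1).coeff k = holR hua k := fun k hk =>
    eq_of_resolventCoeff (b := fun k : ℕ => (U 0 1).coeff k) (D := Hol.D 0) hU.coeff01
      (holR_zero hua) hU.resolvent (fun l _ => resolventCoeff_holR hua l) hk
  refine ⟨u, ⟨hΩ' ▸ hua, fun s hs => ?_, fun l hl s hs => ?_⟩, fun s hs => ?_⟩
  · rw [← hΩ'] at hs
    have := congrArg (Hol.ev (⟨s, hs⟩ : Ω')) hstring
    rw [map_sum, map_zero, Finset.sum_congr rfl (g := fun l => c g s l * R u l s)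
      (fun l hl => by
        rw [hR l (by have := Finset.mem_range.mp hl; omega), map_mul, ev_holTime]; rfl)] at this
    rw [← this, sum_c_mul]
  · rw [← hΩ'] at hs
    have := congrArg (Hol.ev (⟨s, hs⟩ : Ω')) (hkdv l l.2)
    have h1 := hR (l + 1) (by omega)
    push_cast at h1
    rw [holE_zero, holE_of_lt _ l.2, ← huv, Hol.ev_D_of, h1, map_mul, map_ofNat, ev_D_holR] at this
    exact this
  · rw [← hΩ'] at hs
    refine Identified.of_lax_aux ?_ fun l => ?_
    · ext i j k
      rw [coeff_stringLax hua hU hR le_rfl ⟨s, hs⟩, ← hLU, ← Hol.coeff_evMat_polyLMat, hMev]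
    · ext i j k
      have := hVU l l.2
      rw [dif_pos l.2] at this
      rw [coeff_calU hua hU hR ⟨s, hs⟩ l.2.le, ← this, ← Hol.coeff_evMat_polyLMat, hVev]

/-- The potential is visible in the Lax matrix: the coefficient of `λ^g` in the lower left entry is
`-u/2`. -/
theorem eqOn_of_stringLax_eq {Ω : Set (Fin g → ℂ)} {u v : (Fin g → ℂ) → ℂ}
    (h : ∀ s ∈ Ω, stringLax u s = stringLax v s) : Set.EqOn v u Ω := fun s hs => by
  have h1 := congrArg (fun M : PolyMat => (M 1 0).coeff g) (h s hs)
  simp only [stringLax_10_coeff _ s le_rfl, if_neg (show ¬g = g + 1 by omega), if_true] at h1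
  linear_combination 2 * h1

end IsomonodromicToString

/-! ### From solutions of the hierarchy to isomonodromic systems -/

section StringToIsomonodromic

open TopologicalSpace

variable {g : ℕ} [NeZero g]

theorem IsResolvent.resolventUpTo {K : Type*} [CommRing K] [Algebra ℂ K] {D : Derivation ℂ K K}
    {u : K} {U : LMat K} (h : IsResolvent D u U) (N : ℕ) : IsResolventUpTo D u N U :=
  h.toIsSpectral.resolventUpTo (E01 := 0) (E00 := 0) (by rw [h.coeffDerivation_entry01, add_zero])
    (by rw [h.entry10]; ring) (vanishBelow_zero _) (vanishBelow_zero _)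

/-- The resolvent matrix of a holomorphic potential. -/
theorem exists_isResolvent {Ω : Opens (Fin g → ℂ)} {u : (Fin g → ℂ) → ℂ}
    (hu : AnalyticOnNhd ℂ u Ω) : ∃ U : LMat (Hol Ω), IsResolvent (Hol.D 0) (Hol.of u hu) U ∧
      ∀ k : ℕ, (U 0 1).coeff k = holR hu k := by
  obtain ⟨B, hB⟩ : ∃ B, B = HahnSeries.ofPowerSeries ℤ (Hol Ω) (PowerSeries.mk (holR hu)) := ⟨_, rfl⟩
  have hB1 : ∀ k : ℕ, B.coeff k = holR hu k := fun k => by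
    rw [hB, coeff_ofPowerSeries, PowerSeries.coeff_mk]
  refine ⟨resolventMatrix (Hol.D 0) (Hol.of u hu) B, isResolvent_resolventMatrix
    (hB ▸ vanishBelow_ofPowerSeries _) ?_ fun l => ?_, hB1⟩
  · exact (hB1 0).trans (holR_zero hu)
  · simp only [hB1]
    exact resolventCoeff_holR hu l

theorem natDegree_calU_le (u : (Fin g → ℂ) → ℂ) (s : Fin g → ℂ) (n : ℕ) (i j : Fin 2) :
    (calU u n s i j).natDegree ≤ n + 1 := by
  refine natDegree_le_iff_coeff_eq_zero.mpr fun k hk => ?_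
  have h00 : ∀ k > n + 1, (calU u n s 0 0).coeff k = 0 := fun k hk => by
    rw [coeff_calU_of_pos u s n 0 0 (by omega), matU_00_coeff u s (by omega)]
  fin_cases i <;> fin_cases j
  · exact h00 k hk
  · change (calU u n s 0 1).coeff k = 0
    rw [coeff_calU_of_pos u s n 0 1 (by omega), matU_01_coeff u s (by omega), if_neg (by omega)]
  · change (calU u n s 1 0).coeff k = 0
    rw [coeff_calU_of_pos u s n 1 0 (by omega), matU_10_coeff u s (by omega), if_neg (by omega),
      if_neg (by omega)]
  · change (calU u n s 1 1).coeff k = 0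
    rw [calU_traceless, coeff_neg, h00 k hk, neg_zero]

/-- The system is read off from the string side, with `A` divided by `2ℓ + 1`. The work lies in the
irregular times, obtained from the spectral curve, and in zero curvature, obtained from
`IsResolvent.zero_curvature_laxOf` over `Hol`. -/
theorem IsPISolution.exists_isIsomonodromic {Ω : Set (Fin g → ℂ)} (hΩ : IsOpen Ω)
    {u : (Fin g → ℂ) → ℂ} (h : IsPISolution (timeMap g ⁻¹' Ω) u) :
    ∃ (L : (Fin g → ℂ) → PolyMat) (A : Fin g → (Fin g → ℂ) → PolyMat),
      IsIsomonodromic g Ω L A ∧ ∀ s ∈ timeMap g ⁻¹' Ω, Identified L A u s := by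
  obtain ⟨Ω', hΩ'⟩ : ∃ Ω' : Opens (Fin g → ℂ), (Ω' : Set (Fin g → ℂ)) = timeMap g ⁻¹' Ω :=
    ⟨timeOpens Ω hΩ, rfl⟩
  have hmem : ∀ t ∈ Ω, timeInvCLM g t ∈ Ω' := fun t ht => by
    rw [← SetLike.mem_coe, hΩ', Set.mem_preimage, timeMap_timeInvCLM]; exact ht
  have hu : AnalyticOnNhd ℂ u Ω' := hΩ' ▸ h.analytic
  have hg := NeZero.pos g
  obtain ⟨U, hU, hR⟩ := exists_isResolvent hu
  have hUN : IsResolventUpTo (Hol.D 0) (Hol.of u hu) g U := hU.resolventUpTo g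
  have hR' : ∀ k : ℕ, k ≤ g + 1 → (U 0 1).coeff k = holR hu k := fun k _ => hR k
  have hstring : ∑ l ∈ Finset.range (g + 2), holTime Ω' l * (U 0 1).coeff l = 0 := by
    refine Hol.ext_ev fun s => ?_
    have hs : (s : Fin g → ℂ) ∈ timeMap g ⁻¹' Ω := hΩ' ▸ s.2
    rw [map_sum, map_zero, ← h.string_equation s hs]
    refine Eq.trans ?_ (sum_c_mul (s : Fin g → ℂ) fun l => R u l s)
    refine Finset.sum_congr rfl fun l _ => ?_
    rw [map_mul, ev_holTime, hR]; rfl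
  have hc0 : 2 * Hol.D 0 (holTime Ω' 0) = 1 := by
    rw [D_holTime, if_pos (by simp), ← map_ofNat (algebraMap ℂ (Hol Ω')), ← map_mul]
    simp
  have hc : ∀ l, Hol.D 0 (holTime Ω' (l + 1)) = 0 := fun l => by
    rw [D_holTime, if_neg (by simp)]
  have hkdv : ∀ l : Fin g, Hol.D l (Hol.of u hu) = 2 * Hol.D 0 ((U 0 1).coeff (l.val + 1)) := by
    intro l
    refine Hol.ext_ev fun s => ?_
    have hs : (s : Fin g → ℂ) ∈ timeMap g ⁻¹' Ω := hΩ' ▸ s.2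
    have h1 := hR (l + 1)
    push_cast at h1
    rw [h1, map_mul, map_ofNat, ev_D_holR, Hol.ev_D_of]
    rcases Nat.eq_zero_or_pos l.val with hl | hl
    -- The flow in `s₁ = x` is not part of the hypotheses, but it is automatic because `R₁ = u/2`.
    · obtain rfl : l = 0 := Fin.ext hl
      have h2 : R u (0 + 1) = fun s => (1 / 2) * u s := funext fun s => by rw [zero_add, R_one]; ring
      rw [Fin.val_zero, h2, dx, pderiv_const_mul (hu s s.2)]
      ring
    · exact h.kdv_flows l hl s hs
  obtain ⟨M, hM⟩ := exists_polyLMat_eq (isPoly_laxOf U (holTime Ω') g)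
  choose V hV using fun n : ℕ => exists_polyLMat_eq (isPoly_truncU U n)
  have hMev : ∀ s : Ω', Hol.evMat s M = stringLax u s := fun s => by
    ext i j k
    rw [coeff_stringLax hu hUN hR' le_rfl, Hol.coeff_evMat_polyLMat, hM]
  have hVev : ∀ (l : Fin g) (s : Ω'), Hol.evMat s (V l) = calU u l s := fun l s => by
    ext i j k
    rw [coeff_calU hu hUN hR' s l.2.le, Hol.coeff_evMat_polyLMat, hV]
  have hLa : ∀ i j n, AnalyticOnNhd ℂ (fun s => (stringLax u s i j).coeff n) (timeMap g ⁻¹' Ω) :=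
    fun i j n => by
      rw [← hΩ']
      refine (Hol.analyticOnNhd ((M i j).coeff n)).congr Ω'.isOpen fun s hs => ?_
      rw [Hol.toFun_apply _ ⟨s, hs⟩, ← Hol.coeff_evMat, hMev]
  have hAa : ∀ (l : Fin g) i j n,
      AnalyticOnNhd ℂ (fun s => (calU u l s i j).coeff n) (timeMap g ⁻¹' Ω) := fun l i j n => by
    rw [← hΩ']
    refine (Hol.analyticOnNhd ((V l i j).coeff n)).congr Ω'.isOpen fun s hs => ?_
    rw [Hol.toFun_apply _ ⟨s, hs⟩, ← Hol.coeff_evMat, hVev]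
  refine ⟨fun t => stringLax u (timeInvCLM g t),
    fun l t => (2 * (l.val : ℂ) + 1)⁻¹ • calU u l (timeInvCLM g t), ?_, fun s hs => ?_⟩
  swap
  · refine Identified.of_lax_aux (by rw [timeInvCLM_timeMap]) fun l => ?_
    rw [timeInvCLM_timeMap, smul_smul, mul_inv_cancel₀ (two_mul_add_one_ne_zero l.val), one_smul]
  refine ⟨fun i j n => analyticOnNhd_comp_timeInvCLM (hLa i j n), fun l i j n => ?_,
    fun t _ => isNormalized_stringLax u _, fun t ht => ?_, fun l t _ i j => ?_, fun l t _ => ?_,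
    fun l t ht i j n => ?_⟩
  · have := (analyticOnNhd_const (v := (2 * (l.val : ℂ) + 1)⁻¹)).mul
      (analyticOnNhd_comp_timeInvCLM (hAa l i j n))
    simpa only [Matrix.smul_apply, coeff_smul, smul_eq_mul] using this
  · have := hasIrregularTimes_of_det (s := timeInvCLM g t)
      (isNormalized_stringLax u (timeInvCLM g t)) (stringLax_traceless u _) fun k hk => ?_
    · rwa [timeMap_timeInvCLM] at this
    rw [← hMev ⟨_, hmem t ht⟩, ← Hol.ev_coeff_det, ← map_zero (Hol.ev ⟨_, hmem t ht⟩)]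
    congr 1
    -- The spectral curve over `Hol`, evaluated at the given times, is the determinant condition for
    -- the irregular times.
    have h1 := hU.det_laxOf hstring
    rw [← hM, det_polyLMat, ← polyLaurent_timePoly, ← polyLaurent_X, ← map_mul, ← map_pow,
      ← neg_add', ← map_add] at h1
    have h2 := h1 (-k) (by omega)
    rwa [HahnSeries.coeff_neg, coeff_polyLaurent, neg_eq_zero] at h2
  · refine (natDegree_smul_le _ _).trans ((natDegree_calU_le u _ l i j).trans (by omega))
  · rw [Matrix.trace_smul, Matrix.trace_fin_two, calU_traceless, add_neg_cancel, smul_zero]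
  · obtain ⟨s, hs⟩ : ∃ s : Ω', (s : Fin g → ℂ) = timeInvCLM g t := ⟨⟨_, hmem t ht⟩, rfl⟩
    have hst : timeMap g s = t := by rw [hs, timeMap_timeInvCLM]
    have h1 := hU.zero_curvature_laxOf hstring hc0 hc (fun a => Hol.D_comm 0 l a) (hkdv l)
      (two_lam_mul_coeffDerivation_timeSeries l.2 fun k => D_holTime l k)
    rw [← hM, ← hV] at h1
    have h2 := coeff_zeroCurvature (K := Hol Ω') (Hol.D l) M (V l) i j n
    rw [h1] at h2
    obtain ⟨e1, e2⟩ := Hol.ev_coeff_zeroCurvature s M (V l) i j n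
    have h3 := congrArg (Hol.ev s) h2
    rw [map_add, map_sub, e1, e2, hMev, hVev] at h3
    have e3 : Hol.ev s (Hol.D l ((M i j).coeff n)) = (2 * (l.val : ℂ) + 1) *
        pderiv l (fun t => (stringLax u (timeInvCLM g t) i j).coeff n) t := by
      have h4 := pderiv_comp_timeMap (s := s) (l := l)
        (F := fun t => (stringLax u (timeInvCLM g t) i j).coeff n)
        (analyticOnNhd_comp_timeInvCLM (hLa i j n) _ (hst.symm ▸ ht))
      rw [hst] at h4
      rw [← h4, Hol.ev_D]
      refine pderiv_congr Ω'.isOpen (fun r hr => ?_) s.2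
      rw [Hol.toFun_apply _ ⟨r, hr⟩, ← Hol.coeff_evMat, hMev, timeInvCLM_timeMap]
    rw [e3] at h3
    rw [← hs, Matrix.mul_smul, Matrix.smul_mul, ← smul_sub, Matrix.smul_apply, Matrix.smul_apply,
      derivative_smul, coeff_smul, coeff_smul]
    simp only [smul_eq_mul]
    have h5 : Hol.ev s (((0 : LMat (Hol Ω')) i j).coeff (-(n : ℤ))) = 0 := map_zero _
    rw [h5] at h3
    have h6 := two_mul_add_one_ne_zero l.val
    rw [← mul_right_inj' h6, mul_zero, h3, mul_add, mul_sub, mul_inv_cancel_left₀ h6,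
      mul_inv_cancel_left₀ h6]

end StringToIsomonodromic

end PainleveOne

end

theorem mainTheorem2 (g : ℕ) [NeZero g] (Ω : Set (Fin g → ℂ)) (hΩ : IsOpen Ω) :
    (∀ (L : (Fin g → ℂ) → PainleveOne.PolyMat) (A : Fin g → (Fin g → ℂ) → PainleveOne.PolyMat),
      PainleveOne.IsIsomonodromic g Ω L A →
        ∃ u : (Fin g → ℂ) → ℂ,
          PainleveOne.IsPISolution (PainleveOne.timeMap g ⁻¹' Ω) u ∧
          (∀ s ∈ PainleveOne.timeMap g ⁻¹' Ω, PainleveOne.Identified L A u s) ∧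
          (∀ v : (Fin g → ℂ) → ℂ,
            PainleveOne.IsPISolution (PainleveOne.timeMap g ⁻¹' Ω) v →
            (∀ s ∈ PainleveOne.timeMap g ⁻¹' Ω,
              L (PainleveOne.timeMap g s) = PainleveOne.stringLax v s) →
            Set.EqOn v u (PainleveOne.timeMap g ⁻¹' Ω))) ∧
    (∀ u : (Fin g → ℂ) → ℂ,
      PainleveOne.IsPISolution (PainleveOne.timeMap g ⁻¹' Ω) u →
        ∃ (L : (Fin g → ℂ) → PainleveOne.PolyMat) (A : Fin g → (Fin g → ℂ) → PainleveOne.PolyMat),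
          PainleveOne.IsIsomonodromic g Ω L A ∧
          ∀ s ∈ PainleveOne.timeMap g ⁻¹' Ω, PainleveOne.Identified L A u s) := by
  refine ⟨fun L A h => ?_, fun u hu => hu.exists_isIsomonodromic hΩ⟩
  obtain ⟨u, hu, hI⟩ := h.exists_solution hΩ
  exact ⟨u, hu, hI, fun v _ hv => PainleveOne.eqOn_of_stringLax_eq fun s hs =>
    (hI s hs).lax.symm.trans (hv s hs)⟩
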